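/- **Theorem 4.2.** Let $m,n_1,n_2\ge 0$ be integers, $n=n_1+n_2$, and consider on $\mathbb R^m$ the linear system $$ w_t+\sum_{\alpha=1}^m A_\alpha w_{x_\alpha}=Bw,\qquad w(0,\cdot)=w^0,\qquad w=(w_c,w_d)\in\mathbb R^{n_1}\times\mathbb R^{n_2}, \tag{1}$$ in conservative–dissipative form: the real $n\times n$ matrices $A_1,\dots,A_m$ are symmetric and $B=\begin{pmatrix}0&0\\0&D\end{pmatrix}$, where $D\in\mathbb R^{n_2\times n_2}$ is negative definite, i.e. $y^TDy<0$ for all $y\neq0$ ($D$ need not be symmetric). Put $A(\xi)=\sum_\alpha\xi_\alpha A_\alpha$ and $E(i\xi)=B-iA(\xi)$, and assume condition (SK): for every $\xi\in\mathbb R^m\setminus\{0\}$, no eigenvector of $A(\xi)$ lies in the null space of $B$. Let $L_0w=w_c$ and $L_-w=w_d$ be the conservative and the dissipative components. Then (1) has a solution operator $\Gamma(t)$, $t\ge0$: these are bounded linear operators on $L^2(\mathbb R^m,\mathbb R^n)$ such that, for every $w^0\in L^2$, $w(t)=\Gamma(t)w^0$ is the unique weak solution of (1) in $C([0,\infty);L^2)$.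 (Weak solution: $w(0)=w^0$ and, for every $\varphi\in C_c^\infty(\mathbb R^m,\mathbb R^n)$ and $t\ge0$, $\frac{d}{dt}(w(t),\varphi)_{L^2}=(w(t),\sum_\alpha A_\alpha^T\varphi_{x_\alpha}+B^T\varphi)_{L^2}$.) Moreover there are $r,a>0$, with $r<|\mu|$ for every eigenvalue $\mu\ne0$ of $B$ and such that $E(i\xi)$ has no eigenvalue on the circle $|z|=r$ when $|\xi|\le a$, and there are bounded linear operators $K(t),\mathcal K(t)$ on $L^2(\mathbb R^m,\mathbb R^n)$, $t\ge0$, with $$\Gamma(t)=K(t)+\mathcal K(t)\qquad(t\ge0),$$ such that the following hold. * **$K(t)$ is the projected low-frequency part.** For $w^0\in L^1\cap L^2$ and $t\ge0$, $$\widehat{K(t)w^0}(\xi)=\chi(|\xi|\le a)\,P(i\xi)\,e^{tE(i\xi)}\,\widehat{w^0}(\xi),\qquad P(i\xi)=-\frac1{2\pi i}\oint_{|z|=r}(E(i\xi)-zI)^{-1}dz ,$$ where $\hat f(\xi)=\int e^{-ix\cdot\xi}f(x)\,dx$; that is, $P(i\xi)$ is the total eigenprojector for the eigenvalues of $E(i\xi)$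 near $0$. * **$K(t)$ estimates.** For each $k\in\mathbb N$ there is a constant $C(k)$ such that for every multi-index $\beta$, every $p\in[2,\infty]$, every $w^0\in L^1\cap L^2(\mathbb R^m,\mathbb R^n)$ and every $t\ge0$, $$\|L_0D^\beta K(t)w^0\|_{L^p}\le C(|\beta|)\min\{1,t^{-\frac m2(1-\frac1p)-\frac{|\beta|}2}\}\|L_0w^0\|_{L^1}+C(|\beta|)\min\{1,t^{-\frac m2(1-\frac1p)-\frac12-\frac{|\beta|}2}\}\|L_-w^0\|_{L^1},$$ $$\|L_-D^\beta K(t)w^0\|_{L^p}\le C(|\beta|)\min\{1,t^{-\frac m2(1-\frac1p)-\frac12-\frac{|\beta|}2}\}\|L_0w^0\|_{L^1}+C(|\beta|)\min\{1,t^{-\frac m2(1-\frac1p)-1-\frac{|\beta|}2}\}\|L_-w^0\|_{L^1},$$ each minimum being read as $1$ at $t=0$. * **$\mathcal K(t)$ estimate.** There are constants $c,C>0$ such that for every multi-index $\beta$, every $w^0\in L^1\cap L^2(\mathbb R^m,\mathbb R^n)$ with $D^\beta w^0\in L^2$ and every $t\ge0$, $$\|D^\beta\mathcal K(t)w^0\|_{L^2}\le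 Ce^{-ct}\|D^\beta w^0\|_{L^2}.$$ Here $D^\beta$ are weak derivatives, whose existence is part of the assertions about $K(t)w^0$ and $\mathcal K(t)w^0$. The constants depend only on the system (with $r$ and $a$ fixed) and, for $C(|\beta|)$, on $|\beta|$. -/

import Mathlib

open MeasureTheory Set Filter
open scoped ENNReal NNReal ContDiff FourierTransform InnerProductSpace

noncomputable section

namespace CDForm

/-- The space `ℝ^m` with its Euclidean norm. -/
abbrev Space (m : ℕ) : Type := EuclideanSpace ℝ (Fin m)

/-- The state space `ℝ^{n₁ + n₂} = ℝ^{n₁} × ℝ^{n₂}` with its Euclidean norm. -/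
abbrev State (n₁ n₂ : ℕ) : Type := EuclideanSpace ℝ (Fin n₁ ⊕ Fin n₂)

/-- The complexified state space `ℂ^{n₁ + n₂}`. -/
abbrev CState (n₁ n₂ : ℕ) : Type := EuclideanSpace ℂ (Fin n₁ ⊕ Fin n₂)

/-- Real `(n₁ + n₂) × (n₁ + n₂)` matrices. -/
abbrev Mat (n₁ n₂ : ℕ) : Type := Matrix (Fin n₁ ⊕ Fin n₂) (Fin n₁ ⊕ Fin n₂) ℝ

/-- Complex `(n₁ + n₂) × (n₁ + n₂)` matrices. -/
abbrev CMat (n₁ n₂ : ℕ) : Type := Matrix (Fin n₁ ⊕ Fin n₂) (Fin n₁ ⊕ Fin n₂) ℂ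

/-- `L²(ℝ^m, ℝ^{n₁ + n₂})` for Lebesgue measure. -/
abbrev L2 (m n₁ n₂ : ℕ) : Type := Lp (State n₁ n₂) 2 (volume : Measure (Space m))

variable {m n₁ n₂ : ℕ}

/-! ### The system -/

/-- Negative definiteness of a real square matrix, which need not be symmetric. -/
def IsNegDef {n : ℕ} (D : Matrix (Fin n) (Fin n) ℝ) : Prop :=
  ∀ y : Fin n → ℝ, y ≠ 0 → y ⬝ᵥ D.mulVec y < 0

/-- The source matrix `B = [[0, 0], [0, D]]` of a conservative-dissipative form. -/
def sourceMat (n₁ : ℕ) (D : Matrix (Fin n₂) (Fin n₂) ℝ) : Mat n₁ n₂ :=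
  Matrix.fromBlocks 0 0 0 D

/-- `A(ξ) = ∑ α, ξ_α A_α`. -/
def fluxMat (A : Fin m → Mat n₁ n₂) (ξ : Space m) : Mat n₁ n₂ :=
  ∑ α, ξ α • A α

/-- The Shizuta-Kawashima condition: for `ξ ≠ 0` no eigenvector of `A(ξ)` lies in the null space
of `B`. (The matrices `A(ξ)` are real symmetric below, so real eigenvectors suffice.) -/
def ShizutaKawashima (A : Fin m → Mat n₁ n₂) (B : Mat n₁ n₂) : Prop :=
  ∀ ξ : Space m, ξ ≠ 0 → ∀ (l : ℝ) (v : Fin n₁ ⊕ Fin n₂ → ℝ),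
    v ≠ 0 → (fluxMat A ξ).mulVec v = l • v → B.mulVec v ≠ 0

/-- A real matrix acting on the Euclidean state space. -/
def act (M : Mat n₁ n₂) (v : State n₁ n₂) : State n₁ n₂ :=
  WithLp.toLp 2 (M.mulVec (WithLp.ofLp v))

/-- A complex matrix acting on the complexified state space. -/
def cact (M : CMat n₁ n₂) (v : CState n₁ n₂) : CState n₁ n₂ :=
  WithLp.toLp 2 (M.mulVec (WithLp.ofLp v))

/-- `L₀ = [I 0]`: the conservative components. -/
def L₀ (v : State n₁ n₂) : EuclideanSpace ℝ (Fin n₁) :=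
  WithLp.toLp 2 fun i => v (Sum.inl i)

/-- `L₋ = [0 I]`: the dissipative components. -/
def Lminus (v : State n₁ n₂) : EuclideanSpace ℝ (Fin n₂) :=
  WithLp.toLp 2 fun i => v (Sum.inr i)

/-! ### Derivatives -/

/-- The classical partial derivative `∂f/∂x_α`. -/
def partialDeriv {F : Type*} [NormedAddCommGroup F] [NormedSpace ℝ F]
    (α : Fin m) (f : Space m → F) : Space m → F :=
  fun x => fderiv ℝ f x (EuclideanSpace.single α 1)

/-- The classical iterated derivative `D^β = ∂₁^{β₁} ⋯ ∂_m^{β_m}` of a smooth function. -/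
def multiDeriv {F : Type*} [NormedAddCommGroup F] [NormedSpace ℝ F]
    (β : Fin m → ℕ) (f : Space m → F) : Space m → F :=
  (List.finRange m).foldr (fun α g => (partialDeriv α)^[β α] g) f

/-- The order `|β|` of a multi-index. -/
def order (β : Fin m → ℕ) : ℕ := ∑ α, β α

/-- `g` is the weak derivative `D^β f`. -/
def HasWeakDeriv {F : Type*} [NormedAddCommGroup F] [NormedSpace ℝ F]
    (β : Fin m → ℕ) (f g : Space m → F) : Prop :=
  LocallyIntegrable f volume ∧ LocallyIntegrable g volume ∧
    ∀ φ : Space m → ℝ, ContDiff ℝ ∞ φ → HasCompactSupport φ →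
      ∫ x, multiDeriv β φ x • f x = (-1 : ℝ) ^ order β • ∫ x, φ x • g x

/-! ### The Cauchy problem -/

/-- The formal adjoint `∑ α, A_αᵀ ∂_α φ + Bᵀ φ` of the spatial operator
`w ↦ - ∑ α, A_α ∂_α w + B w`. -/
def adjointOp (A : Fin m → Mat n₁ n₂) (B : Mat n₁ n₂) (φ : Space m → State n₁ n₂) :
    Space m → State n₁ n₂ :=
  fun x => ∑ α, act (A α).transpose (partialDeriv α φ x) + act B.transpose (φ x)

/-- `w ∈ C([0, ∞); L²)` is the (weak) solution of `w_t + ∑ α, A_α w_{x_α} = B w`, `w(0) = w₀`: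
for each test function `φ`, the pairing `(w(t), φ)` is differentiable on `[0, ∞)` and its
derivative is the one which the equation prescribes. Values at `t < 0` are irrelevant. -/
def IsSolution (A : Fin m → Mat n₁ n₂) (B : Mat n₁ n₂) (w₀ : L2 m n₁ n₂)
    (w : ℝ → L2 m n₁ n₂) : Prop :=
  ContinuousOn w (Ici 0) ∧ w 0 = w₀ ∧
    ∀ φ : Space m → State n₁ n₂, ContDiff ℝ ∞ φ → HasCompactSupport φ →
      ∀ t : ℝ, 0 ≤ t →
        HasDerivWithinAt (fun s => ∫ x, ⟪w s x, φ x⟫_ℝ)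
          (∫ x, ⟪w t x, adjointOp A B φ x⟫_ℝ) (Ici 0) t

/-- `Γ` is the solution operator: for each `w₀ ∈ L²`, `t ↦ Γ(t) w₀` is a solution with initial
value `w₀`, and it is the only one. -/
def IsSolutionOperator (A : Fin m → Mat n₁ n₂) (B : Mat n₁ n₂)
    (Γ : ℝ → L2 m n₁ n₂ →L[ℝ] L2 m n₁ n₂) : Prop :=
  ∀ w₀ : L2 m n₁ n₂, IsSolution A B w₀ (fun t => Γ t w₀) ∧
    ∀ w : ℝ → L2 m n₁ n₂, IsSolution A B w₀ w → ∀ t : ℝ, 0 ≤ t → w t = Γ t w₀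

/-! ### The projected low-frequency part -/

/-- Entrywise complexification of a real matrix. -/
def toC (M : Mat n₁ n₂) : CMat n₁ n₂ := M.map Complex.ofReal

/-- Complexification of a real state vector. -/
def vecToC (v : State n₁ n₂) : CState n₁ n₂ := WithLp.toLp 2 fun i => (v i : ℂ)

/-- The symbol `E(iξ) = B - i A(ξ)`. -/
def symbol (A : Fin m → Mat n₁ n₂) (B : Mat n₁ n₂) (ξ : Space m) : CMat n₁ n₂ :=
  toC B - Complex.I • toC (fluxMat A ξ)

/-- The total eigenprojector `-(1 / 2πi) ∮_{|z| = r} (M - z)⁻¹ dz` for the eigenvalues of `M` in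
the disc `|z| < r` (no eigenvalue may lie on the circle). -/
def totalProj (r : ℝ) (M : CMat n₁ n₂) : CMat n₁ n₂ :=
  Matrix.of fun i j =>
    -(2 * Real.pi * Complex.I)⁻¹ * ∮ z in C(0, r), (M - z • (1 : CMat n₁ n₂))⁻¹ i j

/-- The circle `|z| = r` separates the eigenvalue `0` of `B` from all its other eigenvalues, and it
meets no eigenvalue of `E(iξ)` for `|ξ| ≤ a`. Hence, for `|ξ| ≤ a`, the disc `|z| < r` contains
precisely the group of eigenvalues of `E(iξ)` which bifurcates from the eigenvalue `0` of `E(0)`. -/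
def Separates (A : Fin m → Mat n₁ n₂) (B : Mat n₁ n₂) (r a : ℝ) : Prop :=
  (∀ z : ℂ, z ≠ 0 → (toC B - z • (1 : CMat n₁ n₂)).det = 0 → r < ‖z‖) ∧
    ∀ ξ : Space m, ‖ξ‖ ≤ a → ∀ z : ℂ, ‖z‖ = r →
      (symbol A B ξ - z • (1 : CMat n₁ n₂)).det ≠ 0

open Classical in
/-- The multiplier `χ(|ξ| ≤ a) P(iξ) e^{t E(iξ)}` with `P(iξ)` the total projector above. -/
def lowMultiplier (A : Fin m → Mat n₁ n₂) (B : Mat n₁ n₂) (r a t : ℝ) (ξ : Space m) :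
    CMat n₁ n₂ :=
  if ‖ξ‖ ≤ a then
    totalProj r (symbol A B ξ) * NormedSpace.exp ((t : ℂ) • symbol A B ξ)
  else 0

/-- The function whose Fourier transform is `χ(|ξ| ≤ a) P(iξ) e^{t E(iξ)} ŵ₀(ξ)`, for an integrable
`w₀`. Mathlib's Fourier transform uses the characters `e^{-2πi x·η}`, so that the frequency
`ξ` of the transform with characters `e^{-i x·ξ}` is `ξ = 2πη`. -/
def lowFreq (A : Fin m → Mat n₁ n₂) (B : Mat n₁ n₂) (r a t : ℝ)
    (w₀ : Space m → State n₁ n₂) : Space m → CState n₁ n₂ :=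
  𝓕⁻ (fun η : Space m =>
    cact (lowMultiplier A B r a t ((2 * Real.pi) • η)) (𝓕 (fun x => vecToC (w₀ x)) η))

/-! ### Decay rates -/

/-- `min {1, t^{-s}}` for `t ≥ 0` and `s ≥ 0`, with value `1` at `t = 0`. -/
def decay (t s : ℝ) : ℝ≥0∞ := min 1 (ENNReal.ofReal t ^ (-s))

/-- The exponent `(m/2)(1 - 1/p) + b/2`; here `1/p = 0` for `p = ∞`. -/
def rate (m : ℕ) (p : ℝ≥0∞) (b : ℕ) : ℝ :=
  (m : ℝ) / 2 * (1 - (p⁻¹).toReal) + (b : ℝ) / 2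

end CDForm

end

open CDForm

/-! The Fourier transform turns the system into the ODEs ŵ_t = E(iξ)ŵ, so Γ(t) is the multiplier
e^{tE(iξ)}. As A(ξ) is symmetric, -iA(ξ) is skew-Hermitian and only B changes the energy; hence
e^{tE} is a contraction for t ≥ 0, and existence follows from Plancherel and differentiation under
the integral. For uniqueness, weak solutions are paired with band-limited test functions, on which
the adjoint operator is bounded: k uses of the equation bound the pairing of a solution with zero
data by a multiple of (Ct)^k/k!, which tends to 0.

Decay rests on ‖e^{tE(iξ)}‖ ≤ C exp(-ct|ξ|²/(1+|ξ|²)), `exists_kawashima_decay`. It is proved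
through observability: by (SK) the hyperbolic flow e^{-isA(θ)}, |θ| = 1, cannot keep the dissipative
components equal to zero, compactness makes this uniform (`exists_observability`), and comparison of
the two flows over a time 1/|ξ| shows that the full flow loses a definite fraction of its energy
(`energy_drop`).

Near ξ = 0 the Riesz projector P(iξ) is Lipschitz, and P(0) is the projection onto the conservative
components. So P is O(|ξ|) when composed on either side with the projection onto the dissipative
ones. Since P e^{tE} = P e^{tE} P, each dissipative index of a block of the symbol of K(t)
contributes a factor |ξ|. Against the Gaussian e^{-c|ξ|²t} a factor |ξ|^k is worth t^{-k/2}; this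
accounts for the gains 1/2 and 1 and for |β|/2. The L^∞ bound is the L¹ norm on the Fourier side,
the L² bound is Plancherel, and the other p follow by interpolation.

The remainder has symbol (1-P)e^{tE} for |ξ| ≤ a and e^{tE} beyond. The range of 1-P is almost
dissipative, so B damps it at a fixed rate; for |ξ| > a the Kawashima rate is bounded below
(`exists_spectralBounds`). Fourier multipliers commute with D^β, so this pointwise bound is the
whole estimate. -/

noncomputable section

namespace CDForm

/-! ### Matrices acting on states, and growth of exponentials from the numerical range -/

section LinearAlgebra

open scoped Matrix.Norms.L2Operator

variable {m n₁ n₂ : ℕ}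

/-- The projection onto the conservative components. -/
def projC : CMat n₁ n₂ := Matrix.fromBlocks 1 0 0 0

/-- The projection onto the dissipative components. -/
def projD : CMat n₁ n₂ := Matrix.fromBlocks 0 0 0 1

lemma cact_eq_toEuclideanCLM (M : CMat n₁ n₂) (v : CState n₁ n₂) :
    cact M v = Matrix.toEuclideanCLM (𝕜 := ℂ) M v := rfl

lemma cact_mul (M N : CMat n₁ n₂) (v : CState n₁ n₂) : cact (M * N) v = cact M (cact N v) := by
  simp [cact]

lemma cact_add (M N : CMat n₁ n₂) (v : CState n₁ n₂) :
    cact (M + N) v = cact M v + cact N v := by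
  simp [cact_eq_toEuclideanCLM]

lemma cact_sub (M N : CMat n₁ n₂) (v : CState n₁ n₂) :
    cact (M - N) v = cact M v - cact N v := by
  simp [cact_eq_toEuclideanCLM]

lemma cact_neg (M : CMat n₁ n₂) (v : CState n₁ n₂) : cact (-M) v = -cact M v := by
  simp [cact_eq_toEuclideanCLM]

lemma cact_smul (c : ℂ) (M : CMat n₁ n₂) (v : CState n₁ n₂) :
    cact (c • M) v = c • cact M v := by
  simp [cact_eq_toEuclideanCLM]

lemma cact_one (v : CState n₁ n₂) : cact 1 v = v := by
  simp [cact_eq_toEuclideanCLM]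

lemma cact_zero (v : CState n₁ n₂) : cact (0 : CMat n₁ n₂) v = 0 := by
  simp [cact_eq_toEuclideanCLM]

lemma cact_vadd (M : CMat n₁ n₂) (v w : CState n₁ n₂) :
    cact M (v + w) = cact M v + cact M w := by
  simp [cact_eq_toEuclideanCLM]

lemma cact_vsub (M : CMat n₁ n₂) (v w : CState n₁ n₂) :
    cact M (v - w) = cact M v - cact M w := by
  simp [cact_eq_toEuclideanCLM]

lemma cact_vsmul (c : ℂ) (M : CMat n₁ n₂) (v : CState n₁ n₂) :
    cact M (c • v) = c • cact M v := by
  simp [cact_eq_toEuclideanCLM]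

lemma cact_vzero (M : CMat n₁ n₂) : cact M (0 : CState n₁ n₂) = 0 := by
  simp [cact_eq_toEuclideanCLM]

lemma norm_cact_le (M : CMat n₁ n₂) (v : CState n₁ n₂) : ‖cact M v‖ ≤ ‖M‖ * ‖v‖ :=
  Matrix.l2_opNorm_mulVec M v

lemma norm_le_of_norm_cact_le {M : CMat n₁ n₂} {C : ℝ} (hC : 0 ≤ C)
    (h : ∀ v : CState n₁ n₂, ‖cact M v‖ ≤ C * ‖v‖) : ‖M‖ ≤ C :=
  ContinuousLinearMap.opNorm_le_bound _ hC h

lemma ext_cact {M N : CMat n₁ n₂} (h : ∀ v : CState n₁ n₂, cact M v = cact N v) : M = N :=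
  (Matrix.toEuclideanCLM (𝕜 := ℂ)).injective (ContinuousLinearMap.ext h)

lemma inner_cact_left (M : CMat n₁ n₂) (u v : CState n₁ n₂) :
    inner ℂ (cact M u) v = inner ℂ u (cact M.conjTranspose v) := by
  rw [cact_eq_toEuclideanCLM, cact_eq_toEuclideanCLM, ← Matrix.star_eq_conjTranspose, map_star,
    ContinuousLinearMap.star_eq_adjoint, ContinuousLinearMap.adjoint_inner_right]

lemma hasDerivAt_cact_exp (M : CMat n₁ n₂) (v : CState n₁ n₂) (t : ℝ) :
    HasDerivAt (fun s : ℝ => cact (NormedSpace.exp ((s : ℂ) • M)) v)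
      (cact M (cact (NormedSpace.exp ((t : ℂ) • M)) v)) t := by
  have h1 : HasDerivAt (fun s : ℂ => NormedSpace.exp (s • M))
      (M * NormedSpace.exp ((t : ℂ) • M)) (t : ℂ) := hasDerivAt_exp_smul_const' M (t : ℂ)
  have h2 := h1.scomp t (Complex.ofRealCLM.hasDerivAt (x := t))
  rw [Complex.ofRealCLM_apply, Complex.ofReal_one, one_smul] at h2
  let L : CMat n₁ n₂ →L[ℂ] CState n₁ n₂ := LinearMap.toContinuousLinearMap
    { toFun := fun N => cact N v
      map_add' := fun _ _ => cact_add _ _ _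
      map_smul' := fun _ _ => cact_smul _ _ _ }
  have h3 := (L.restrictScalars ℝ).hasFDerivAt.comp_hasDerivAt t h2
  rw [← cact_mul]
  exact h3

lemma hasDerivAt_norm_sq {H : Type*} [NormedAddCommGroup H] [InnerProductSpace ℂ H]
    {u : ℝ → H} {u' : H} {t : ℝ} (h : HasDerivAt u u' t) :
    HasDerivAt (fun s => ‖u s‖ ^ 2) (2 * (inner ℂ (u t) u').re) t := by
  have h1 := h.inner ℂ h
  have h2 := Complex.reCLM.hasFDerivAt.comp_hasDerivAt t h1
  have h3 : (fun s => ‖u s‖ ^ 2) = Complex.reCLM ∘ fun s => inner ℂ (u s) (u s) := by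
    ext s
    exact (inner_self_eq_norm_sq (𝕜 := ℂ) (u s)).symm
  rw [h3]
  convert! h2 using 1
  rw [Complex.reCLM_apply, Complex.add_re, ← inner_conj_symm u' (u t), Complex.conj_re]
  ring

/-- Growth bound along an orbit from a bound of the numerical range on that orbit. -/
lemma norm_cact_exp_le_of_orbit {M : CMat n₁ n₂} {μ : ℝ} {v : CState n₁ n₂}
    (h : ∀ s : ℝ, (inner ℂ (cact (NormedSpace.exp ((s : ℂ) • M)) v)
      (cact M (cact (NormedSpace.exp ((s : ℂ) • M)) v))).re ≤
        μ * ‖cact (NormedSpace.exp ((s : ℂ) • M)) v‖ ^ 2) {t : ℝ} (ht : 0 ≤ t) :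
    ‖cact (NormedSpace.exp ((t : ℂ) • M)) v‖ ≤ Real.exp (μ * t) * ‖v‖ := by
  set u : ℝ → CState n₁ n₂ := fun s => cact (NormedSpace.exp ((s : ℂ) • M)) v with hu
  -- The weight e^{-2μs} absorbs the admissible growth, so that the weighted energy can only
  -- decrease. The hypothesis is needed on the orbit alone, which later allows orbits confined to an
  -- invariant subspace.
  have hd : ∀ s, HasDerivAt (fun s => Real.exp (-(2 * μ * s)) * ‖u s‖ ^ 2)
      (Real.exp (-(2 * μ * s)) * (2 * (inner ℂ (u s) (cact M (u s))).re - 2 * μ * ‖u s‖ ^ 2)) s := by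
    intro s
    have h1 := hasDerivAt_norm_sq (hasDerivAt_cact_exp M v s)
    have h2 : HasDerivAt (fun s : ℝ => Real.exp (-(2 * μ * s)))
        (Real.exp (-(2 * μ * s)) * (-(2 * μ))) s := by
      have := ((hasDerivAt_id s).const_mul (2 * μ)).neg.exp
      simpa using this
    exact (h2.mul h1).congr_deriv (by ring)
  have hanti : Antitone (fun s => Real.exp (-(2 * μ * s)) * ‖u s‖ ^ 2) := by
    apply antitone_of_deriv_nonpos (fun s => (hd s).differentiableAt)
    intro s
    rw [(hd s).deriv]
    apply mul_nonpos_of_nonneg_of_nonpos (Real.exp_pos _).le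
    linarith [h s]
  have h0 := hanti ht
  have hu0 : u 0 = v := by simp [hu, cact_one]
  simp only [hu0, mul_zero, neg_zero, Real.exp_zero, one_mul] at h0
  have h3 : ‖u t‖ ^ 2 ≤ (Real.exp (μ * t) * ‖v‖) ^ 2 := by
    have : Real.exp (μ * t) ^ 2 * Real.exp (-(2 * μ * t)) = 1 := by
      rw [← Real.exp_nat_mul, ← Real.exp_add]
      simp only [Nat.cast_ofNat]
      ring_nf
      simp
    calc ‖u t‖ ^ 2 = Real.exp (μ * t) ^ 2 * (Real.exp (-(2 * μ * t)) * ‖u t‖ ^ 2) := by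
          rw [← mul_assoc, this, one_mul]
      _ ≤ Real.exp (μ * t) ^ 2 * ‖v‖ ^ 2 := by gcongr
      _ = _ := by ring
  exact (pow_le_pow_iff_left₀ (norm_nonneg _) (by positivity) two_ne_zero).1 h3

/-- Growth bound from a bound of the numerical range. -/
lemma norm_cact_exp_le {M : CMat n₁ n₂} {μ : ℝ}
    (h : ∀ u : CState n₁ n₂, (inner ℂ u (cact M u)).re ≤ μ * ‖u‖ ^ 2)
    {t : ℝ} (ht : 0 ≤ t) (v : CState n₁ n₂) :
    ‖cact (NormedSpace.exp ((t : ℂ) • M)) v‖ ≤ Real.exp (μ * t) * ‖v‖ :=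
  norm_cact_exp_le_of_orbit (fun _ => h _) ht

lemma norm_exp_le {M : CMat n₁ n₂} {μ : ℝ}
    (h : ∀ u : CState n₁ n₂, (inner ℂ u (cact M u)).re ≤ μ * ‖u‖ ^ 2) {t : ℝ} (ht : 0 ≤ t) :
    ‖NormedSpace.exp ((t : ℂ) • M)‖ ≤ Real.exp (μ * t) :=
  norm_le_of_norm_cact_le (Real.exp_pos _).le fun v => norm_cact_exp_le h ht v

end LinearAlgebra

/-! ### The symbol -/

section Symbol

open scoped Matrix.Norms.L2Operator

variable {m n₁ n₂ : ℕ}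

lemma toC_conjTranspose (M : Mat n₁ n₂) : (toC M).conjTranspose = toC M.transpose := by
  ext i j
  simp [toC]

lemma toC_add (M N : Mat n₁ n₂) : toC (M + N) = toC M + toC N := by
  ext i j
  simp [toC]

lemma toC_smul (c : ℝ) (M : Mat n₁ n₂) : toC (c • M) = (c : ℂ) • toC M := by
  ext i j
  simp [toC]

lemma toC_sum {ι : Type*} (s : Finset ι) (M : ι → Mat n₁ n₂) :
    toC (∑ i ∈ s, M i) = ∑ i ∈ s, toC (M i) := by
  ext i j
  simp [toC, Matrix.sum_apply]

lemma fluxMat_isSymm {A : Fin m → Mat n₁ n₂} (hA : ∀ α, (A α).IsSymm) (ξ : Space m) :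
    (fluxMat A ξ).IsSymm := by
  simp only [Matrix.IsSymm, fluxMat, Matrix.transpose_sum, Matrix.transpose_smul]
  exact Finset.sum_congr rfl fun α _ => by rw [hA α]

lemma inner_flux_im {A : Fin m → Mat n₁ n₂} (hA : ∀ α, (A α).IsSymm) (ξ : Space m)
    (u : CState n₁ n₂) : (inner ℂ u (cact (toC (fluxMat A ξ)) u)).im = 0 := by
  have h := inner_cact_left (toC (fluxMat A ξ)) u u
  rw [toC_conjTranspose, fluxMat_isSymm hA ξ] at h
  rw [← inner_conj_symm] at h
  have := congrArg Complex.im h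
  rw [Complex.conj_im] at this
  linarith

lemma projD_apply_inl (u : CState n₁ n₂) (i : Fin n₁) : cact projD u (Sum.inl i) = 0 := by
  simp [cact, projD, Matrix.fromBlocks_mulVec]

lemma projD_apply_inr (u : CState n₁ n₂) (i : Fin n₂) :
    cact projD u (Sum.inr i) = u (Sum.inr i) := by
  simp [cact, projD, Matrix.fromBlocks_mulVec]

lemma projC_apply_inl (u : CState n₁ n₂) (i : Fin n₁) :
    cact projC u (Sum.inl i) = u (Sum.inl i) := by
  simp [cact, projC, Matrix.fromBlocks_mulVec]

lemma projC_apply_inr (u : CState n₁ n₂) (i : Fin n₂) : cact projC u (Sum.inr i) = 0 := by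
  simp [cact, projC, Matrix.fromBlocks_mulVec]

lemma projC_add_projD : (projC + projD : CMat n₁ n₂) = 1 := by
  simp [projC, projD, Matrix.fromBlocks_add, ← Matrix.fromBlocks_one]

lemma norm_sq_projC_add (u : CState n₁ n₂) :
    ‖cact projC u‖ ^ 2 + ‖cact projD u‖ ^ 2 = ‖u‖ ^ 2 := by
  simp [EuclideanSpace.norm_sq_eq, Fintype.sum_sum_type, projD_apply_inl, projD_apply_inr,
    projC_apply_inl, projC_apply_inr]

lemma norm_projC_le (u : CState n₁ n₂) : ‖cact projC u‖ ≤ ‖u‖ := by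
  refine (pow_le_pow_iff_left₀ (norm_nonneg _) (norm_nonneg _) two_ne_zero).1 ?_
  linarith [norm_sq_projC_add u, sq_nonneg ‖cact projD u‖]

lemma norm_projD_le (u : CState n₁ n₂) : ‖cact projD u‖ ≤ ‖u‖ := by
  refine (pow_le_pow_iff_left₀ (norm_nonneg _) (norm_nonneg _) two_ne_zero).1 ?_
  linarith [norm_sq_projC_add u, sq_nonneg ‖cact projC u‖]

/-- The quadratic form attains its maximum on the compact unit sphere, where it is negative;
homogeneity of degree two does the rest. -/
lemma exists_coercive {n : ℕ} {D : Matrix (Fin n) (Fin n) ℝ} (hD : IsNegDef D) :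
    ∃ δ : ℝ, 0 < δ ∧ ∀ y : Fin n → ℝ, y ⬝ᵥ D.mulVec y ≤ -δ * ∑ i, y i ^ 2 := by
  let q : EuclideanSpace ℝ (Fin n) → ℝ := fun y => -((y : Fin n → ℝ) ⬝ᵥ D.mulVec y)
  have hq : Continuous q := by
    simp only [q, dotProduct, Matrix.mulVec]
    fun_prop
  have hpos : ∀ y, y ≠ 0 → 0 < q y := by
    intro y hy
    have : (y : Fin n → ℝ) ≠ 0 := fun h => hy (by ext i; simpa using congrFun h i)
    have := hD _ this
    simp only [q]
    linarith
  -- The sphere is empty for n = 0; every δ > 0 serves there.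
  rcases (Metric.sphere (0 : EuclideanSpace ℝ (Fin n)) 1).eq_empty_or_nonempty with he | hne
  · refine ⟨1, one_pos, fun y => ?_⟩
    have hy : y = 0 := by
      by_contra hy
      have hy' : (WithLp.toLp 2 y : EuclideanSpace ℝ (Fin n)) ≠ 0 := by
        intro h
        apply hy
        simpa using h
      have : (‖WithLp.toLp 2 y‖⁻¹ • (WithLp.toLp 2 y : EuclideanSpace ℝ (Fin n))) ∈
          Metric.sphere (0 : EuclideanSpace ℝ (Fin n)) 1 := by
        simp [norm_smul, hy]
      rw [he] at this
      exact this
    simp [hy]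
  · obtain ⟨y₀, hy₀, hmin⟩ := (isCompact_sphere (0 : EuclideanSpace ℝ (Fin n)) 1).exists_isMinOn
      hne hq.continuousOn
    have hy₀' : y₀ ≠ 0 := by
      rintro rfl
      simp at hy₀
    refine ⟨q y₀, hpos y₀ hy₀', fun y => ?_⟩
    by_cases hy : y = 0
    · simp [hy]
    set Y : EuclideanSpace ℝ (Fin n) := WithLp.toLp 2 y with hY
    have hYn : 0 < ‖Y‖ := by
      rw [norm_pos_iff]
      intro h
      apply hy
      simpa [hY] using h
    have h1 : q y₀ ≤ q (‖Y‖⁻¹ • Y) := hmin (by simp [norm_smul, hYn.ne'])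
    have h2 : q (‖Y‖⁻¹ • Y) = (‖Y‖ ^ 2)⁻¹ * -(y ⬝ᵥ D.mulVec y) := by
      simp only [q, WithLp.ofLp_smul, Matrix.mulVec_smul, smul_dotProduct,
        dotProduct_smul, smul_eq_mul, hY]
      ring
    have h3 : ‖Y‖ ^ 2 = ∑ i, y i ^ 2 := by
      simp [EuclideanSpace.norm_sq_eq, hY]
    rw [h2, inv_mul_eq_div, le_div_iff₀ (by positivity), h3] at h1
    linarith

/-- For real D the form at p + iq has real part pᵀDp + qᵀDq, since the cross terms are purely
imaginary. Hence D need not be symmetric. -/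
lemma re_inner_sourceMat_le {D : Matrix (Fin n₂) (Fin n₂) ℝ} {δ : ℝ}
    (hδ : ∀ y : Fin n₂ → ℝ, y ⬝ᵥ D.mulVec y ≤ -δ * ∑ i, y i ^ 2) (u : CState n₁ n₂) :
    (inner ℂ u (cact (toC (sourceMat n₁ D)) u)).re ≤ -δ * ‖cact projD u‖ ^ 2 := by
  have h1 := hδ fun i => (u (Sum.inr i)).re
  have h2 := hδ fun i => (u (Sum.inr i)).im
  have h3 : ‖cact projD u‖ ^ 2 = ∑ i, (u (Sum.inr i)).re ^ 2 + ∑ i, (u (Sum.inr i)).im ^ 2 := by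
    rw [← Finset.sum_add_distrib]
    rw [EuclideanSpace.norm_sq_eq]
    simp [Fintype.sum_sum_type, projD_apply_inl, projD_apply_inr, Complex.sq_norm,
      Complex.normSq_apply, ← sq]
  have h4 : (inner ℂ u (cact (toC (sourceMat n₁ D)) u)).re =
      (fun i => (u (Sum.inr i)).re) ⬝ᵥ D.mulVec (fun i => (u (Sum.inr i)).re) +
      (fun i => (u (Sum.inr i)).im) ⬝ᵥ D.mulVec (fun i => (u (Sum.inr i)).im) := by
    simp only [PiLp.inner_apply, Fintype.sum_sum_type, cact, toC, sourceMat,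
      Matrix.fromBlocks_map, Matrix.mulVec, dotProduct, Complex.re_sum, Complex.add_re,
      Matrix.fromBlocks_apply₁₁, Matrix.fromBlocks_apply₁₂, Matrix.fromBlocks_apply₂₁,
      Matrix.fromBlocks_apply₂₂, Matrix.map_apply, ← Finset.sum_add_distrib, Finset.mul_sum]
    simp only [Matrix.zero_apply, Complex.ofReal_zero, zero_mul, Finset.sum_const_zero, add_zero,
      RCLike.inner_apply, Complex.zero_re, zero_add, Finset.sum_mul, Complex.re_sum]
    refine Finset.sum_congr rfl fun i _ => ?_
    simp
    refine Finset.sum_congr rfl fun j _ => ?_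
    ring
  rw [h4, h3]
  linarith

lemma cact_symbol (A : Fin m → Mat n₁ n₂) (B : Mat n₁ n₂) (ξ : Space m) (u : CState n₁ n₂) :
    cact (symbol A B ξ) u = cact (toC B) u - Complex.I • cact (toC (fluxMat A ξ)) u := by
  rw [symbol, cact_sub, cact_smul]

/-- The part -iA(ξ) is skew-Hermitian, so energy is dissipated by the source alone, at every
frequency. -/
lemma re_inner_symbol {A : Fin m → Mat n₁ n₂} (hA : ∀ α, (A α).IsSymm) (B : Mat n₁ n₂)
    (ξ : Space m) (u : CState n₁ n₂) :
    (inner ℂ u (cact (symbol A B ξ) u)).re = (inner ℂ u (cact (toC B) u)).re := by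
  rw [cact_symbol, inner_sub_right, inner_smul_right]
  simp [inner_flux_im hA]

end Symbol

/-! ### Observability under (SK) and the Kawashima decay estimate -/

section Decay

open scoped Matrix.Norms.L2Operator

variable {m n₁ n₂ : ℕ}

lemma continuous_cact {X : Type*} [TopologicalSpace X] {M : X → CMat n₁ n₂}
    {v : X → CState n₁ n₂} (hM : Continuous M) (hv : Continuous v) :
    Continuous fun x => cact (M x) (v x) := by
  unfold cact
  refine (PiLp.continuous_toLp 2 _).comp ?_
  exact hM.matrix_mulVec ((PiLp.continuous_ofLp 2 _).comp hv)

lemma continuous_toC_fluxMat (A : Fin m → Mat n₁ n₂) :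
    Continuous fun ξ : Space m => toC (fluxMat A ξ) := by
  refine continuous_matrix fun i j => ?_
  simp only [toC, fluxMat, Matrix.map_apply, Matrix.sum_apply, Matrix.smul_apply, smul_eq_mul]
  fun_prop

lemma continuous_symbol (A : Fin m → Mat n₁ n₂) (B : Mat n₁ n₂) :
    Continuous fun ξ : Space m => symbol A B ξ := by
  have h : Continuous fun ξ : Space m => Complex.I • toC (fluxMat A ξ) :=
    (continuous_toC_fluxMat A).const_smul Complex.I
  exact continuous_const.sub h

lemma continuous_exp_smul {X : Type*} [TopologicalSpace X] {t : X → ℂ} {M : X → CMat n₁ n₂}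
    (ht : Continuous t) (hM : Continuous M) :
    Continuous fun x => NormedSpace.exp (t x • M x) := by
  let _ : NormedAlgebra ℚ (CMat n₁ n₂) := NormedAlgebra.restrictScalars ℚ ℂ _
  exact (NormedSpace.exp_continuous (𝔸 := CMat n₁ n₂)).comp (ht.smul hM)

lemma cact_sourceMat_projD (D : Matrix (Fin n₂) (Fin n₂) ℝ) (u : CState n₁ n₂) :
    cact (toC (sourceMat n₁ D)) (cact projD u) = cact (toC (sourceMat n₁ D)) u := by
  rw [← cact_mul]
  congr 1
  simp [toC, sourceMat, projD, Matrix.fromBlocks_map, Matrix.fromBlocks_multiply]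

/-- Under the Shizuta-Kawashima condition no complex eigenvector of `A(ξ)`, `ξ ≠ 0`, has vanishing
dissipative components. -/
lemma eq_zero_of_eigenvector {A : Fin m → Mat n₁ n₂} {D : Matrix (Fin n₂) (Fin n₂) ℝ}
    (hA : ∀ α, (A α).IsSymm) (hSK : ShizutaKawashima A (sourceMat n₁ D)) {ξ : Space m}
    (hξ : ξ ≠ 0) {w : CState n₁ n₂} {l : ℂ} (hw : cact (toC (fluxMat A ξ)) w = l • w)
    (hd : cact projD w = 0) : w = 0 := by
  by_contra h0
  -- A(ξ) is Hermitian, so the eigenvalue is real; real and imaginary parts of `w` are then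
  -- separately eigenvectors, to which the real form of (SK) applies.
  have hl : l.im = 0 := by
    have h := inner_flux_im hA ξ w
    rw [hw, inner_smul_right, inner_self_eq_norm_sq_to_K, RCLike.ofReal_eq_complex_ofReal,
      ← Complex.ofReal_pow, Complex.im_mul_ofReal] at h
    simpa [h0] using h
  have hl' : l = (l.re : ℂ) := Complex.ext rfl (by simpa using hl)
  have hd' : ∀ i, w (Sum.inr i) = 0 := fun i => by
    rw [← projD_apply_inr w i, hd]; rfl
  have hcomp : ∀ i, ∑ j, (fluxMat A ξ i j : ℂ) * w j = (l.re : ℂ) * w i := fun i => by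
    have h := congrArg (fun v : CState n₁ n₂ => v i) hw
    rw [hl'] at h
    simpa [cact, toC, Matrix.mulVec, dotProduct] using h
  have hB : ∀ v : Fin n₁ ⊕ Fin n₂ → ℝ, (∀ i, v (Sum.inr i) = 0) →
      (sourceMat n₁ D).mulVec v = 0 := by
    intro v hv
    have : v ∘ Sum.inr = 0 := funext hv
    rw [sourceMat, Matrix.fromBlocks_mulVec, this]
    ext (i | i) <;> simp
  have hre : (fun i => (w i).re) = 0 := by
    by_contra hne
    refine hSK ξ hξ l.re _ hne ?_ (hB _ fun i => by simp [hd' i])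
    ext i
    have := congrArg Complex.re (hcomp i)
    simpa [Matrix.mulVec, dotProduct] using this
  have him : (fun i => (w i).im) = 0 := by
    by_contra hne
    refine hSK ξ hξ l.re _ hne ?_ (hB _ fun i => by simp [hd' i])
    ext i
    have := congrArg Complex.im (hcomp i)
    simpa [Matrix.mulVec, dotProduct] using this
  apply h0
  ext i
  exact Complex.ext (congrFun hre i) (congrFun him i)

/-- The purely hyperbolic flow does not stay in the null space of the source. -/
lemma exists_projD_exp_ne_zero {A : Fin m → Mat n₁ n₂} {D : Matrix (Fin n₂) (Fin n₂) ℝ}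
    (hA : ∀ α, (A α).IsSymm) (hSK : ShizutaKawashima A (sourceMat n₁ D)) {ξ : Space m}
    (hξ : ξ ≠ 0) {v : CState n₁ n₂} (hv : v ≠ 0) :
    ∃ s ∈ Icc (0 : ℝ) 1,
      cact projD (cact (NormedSpace.exp ((s : ℂ) • symbol A 0 ξ)) v) ≠ 0 := by
  by_contra! hcon
  set N := symbol A 0 ξ with hN
  set w : ℝ → CState n₁ n₂ := fun s => cact (NormedSpace.exp ((s : ℂ) • N)) v with hw
  -- An observation that vanishes on all of [0, 1] may be differentiated there, with one-sided
  -- derivatives at the end points; each derivative brings down one factor `N`.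
  have key : ∀ k : ℕ, ∀ s ∈ Icc (0 : ℝ) 1, cact (projD * N ^ k) (w s) = 0 := by
    intro k
    induction k with
    | zero => intro s hs; simpa [hw] using hcon s hs
    | succ k ih =>
      intro s hs
      have h1 : HasDerivAt (fun s => cact (projD * N ^ k) (w s))
          (cact (projD * N ^ k) (cact N (w s))) s := by
        have h2 := hasDerivAt_cact_exp N v s
        exact ((Matrix.toEuclideanCLM (𝕜 := ℂ) (projD * N ^ k)).restrictScalars
          ℝ).hasFDerivAt.comp_hasDerivAt s h2
      have h3 : HasDerivWithinAt (fun s => cact (projD * N ^ k) (w s)) 0 (Icc 0 1) s :=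
        (hasDerivWithinAt_const s (Icc (0 : ℝ) 1) (0 : CState n₁ n₂)).congr ih (ih s hs)
      have := (uniqueDiffOn_Icc zero_lt_one s hs).eq_deriv _ h1.hasDerivWithinAt h3
      rw [pow_succ, ← mul_assoc, cact_mul]
      exact this
  let T : Module.End ℂ (CState n₁ n₂) := (Matrix.toEuclideanCLM (𝕜 := ℂ) N).toLinearMap
  -- The unobservable subspace in the sense of Kalman. It is invariant under `N`, so if it contains
  -- `v ≠ 0` it contains an eigenvector of `N`, and that eigenvector has no dissipative part.
  let W : Submodule ℂ (CState n₁ n₂) :=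
    ⨅ k : ℕ, LinearMap.ker (Matrix.toEuclideanCLM (𝕜 := ℂ) (projD * N ^ k)).toLinearMap
  have hWmem : ∀ x, x ∈ W ↔ ∀ k : ℕ, cact (projD * N ^ k) x = 0 := by
    intro x
    simp only [W, Submodule.mem_iInf, LinearMap.mem_ker]
    rfl
  have hWinv : ∀ x ∈ W, T x ∈ W := by
    intro x hx
    rw [hWmem] at hx ⊢
    intro k
    have := hx (k + 1)
    rw [pow_succ, ← mul_assoc, cact_mul] at this
    exact this
  have hvW : v ∈ W := by
    rw [hWmem]
    intro k
    have := key k 0 (by simp)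
    simpa [hw, cact_one] using this
  have : Nontrivial W := ⟨⟨⟨v, hvW⟩, 0, fun h => hv (congrArg Subtype.val h)⟩⟩
  obtain ⟨μ, hμ⟩ := Module.End.exists_eigenvalue (T.restrict hWinv)
  obtain ⟨x, hx⟩ := hμ.exists_hasEigenvector
  have hx1 : cact N (x : CState n₁ n₂) = μ • (x : CState n₁ n₂) :=
    congrArg Subtype.val hx.apply_eq_smul
  have hx2 : (x : CState n₁ n₂) ≠ 0 := fun h => hx.2 (Subtype.ext h)
  have hx3 : cact projD (x : CState n₁ n₂) = 0 := by
    simpa using (hWmem _).1 x.2 0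
  -- Here N = -iA(ξ), so an eigenvalue μ of N is the eigenvalue iμ of A(ξ).
  refine hx2 (eq_zero_of_eigenvector hA hSK hξ (l := Complex.I * μ) ?_ hx3)
  rw [mul_smul, ← hx1, hN, cact_symbol, show toC (0 : Mat n₁ n₂) = 0 by ext; simp [toC], cact_zero,
    zero_sub, smul_neg, smul_smul, Complex.I_mul_I, neg_smul, one_smul, neg_neg]

/-- Uniform observability of the dissipative components under the hyperbolic flow. -/
lemma exists_observability {A : Fin m → Mat n₁ n₂} {D : Matrix (Fin n₂) (Fin n₂) ℝ}
    (hA : ∀ α, (A α).IsSymm) (hSK : ShizutaKawashima A (sourceMat n₁ D)) :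
    ∃ c : ℝ, 0 < c ∧ ∀ θ : Space m, ‖θ‖ = 1 → ∀ v : CState n₁ n₂,
      c * ‖v‖ ^ 2 ≤ ∫ s in (0 : ℝ)..1,
        ‖cact projD (cact (NormedSpace.exp ((s : ℂ) • symbol A 0 θ)) v)‖ ^ 2 := by
  have hcont : Continuous fun p : (Space m × CState n₁ n₂) × ℝ =>
      ‖cact projD (cact (NormedSpace.exp ((p.2 : ℂ) • symbol A 0 p.1.1)) p.1.2)‖ ^ 2 := by
    refine (continuous_cact continuous_const (continuous_cact (continuous_exp_smul ?_ ?_)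
      (by fun_prop))).norm.pow 2
    · fun_prop
    · exact (continuous_symbol A 0).comp (by fun_prop)
  have hF := intervalIntegral.continuous_parametric_intervalIntegral_of_continuous'
    (μ := volume) (f := fun (p : Space m × CState n₁ n₂) (s : ℝ) =>
      ‖cact projD (cact (NormedSpace.exp ((s : ℂ) • symbol A 0 p.1)) p.2)‖ ^ 2) hcont 0 1
  -- A continuous positive function on a compact set has a positive lower bound; this form of the
  -- statement also covers empty spheres (dimension zero).
  obtain ⟨c, hc, hle⟩ := ((isCompact_sphere (0 : Space m) 1).prod
    (isCompact_sphere (0 : CState n₁ n₂) 1)).exists_forall_le' (a := 0) hF.continuousOn (by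
      rintro ⟨θ, v⟩ ⟨hθ, hv⟩
      simp only [mem_sphere_iff_norm, sub_zero] at hθ hv
      obtain ⟨s, hs, hne⟩ := exists_projD_exp_ne_zero hA hSK (ξ := θ) (v := v)
        (by rintro rfl; simp at hθ) (by rintro rfl; simp at hv)
      refine intervalIntegral.integral_pos zero_lt_one ?_ (fun _ _ => by positivity)
        ⟨s, hs, by positivity⟩
      exact (hcont.comp (Continuous.prodMk_right (θ, v))).continuousOn)
  refine ⟨c, hc, fun θ hθ v => ?_⟩
  by_cases hv : v = 0
  · subst hv
    simp [cact_vzero]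
  have hvn : 0 < ‖v‖ := norm_pos_iff.2 hv
  have h1 := hle (θ, ((‖v‖⁻¹ : ℝ) : ℂ) • v) ⟨by simpa using hθ, by simp [norm_smul, hvn.ne']⟩
  have h2 : ∀ s : ℝ, ‖cact projD (cact (NormedSpace.exp ((s : ℂ) • symbol A 0 θ))
      (((‖v‖⁻¹ : ℝ) : ℂ) • v))‖ ^ 2 =
      (‖v‖ ^ 2)⁻¹ * ‖cact projD (cact (NormedSpace.exp ((s : ℂ) • symbol A 0 θ)) v)‖ ^ 2 := by
    intro s
    rw [cact_vsmul, cact_vsmul, norm_smul, mul_pow]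
    simp
  simp only [h2, intervalIntegral.integral_const_mul] at h1
  rwa [inv_mul_eq_div, le_div_iff₀ (by positivity)] at h1

/-- Rescaling of time: for ε = 1/|ξ| the flow during a time ε becomes a flow during unit time with
unit frequency and the weak source εB. -/
lemma smul_symbol (A : Fin m → Mat n₁ n₂) (B : Mat n₁ n₂) (ξ : Space m) (ε : ℝ) :
    (ε : ℂ) • symbol A B ξ = (ε : ℂ) • toC B + symbol A 0 (ε • ξ) := by
  have : fluxMat A (ε • ξ) = ε • fluxMat A ξ := by
    simp [fluxMat, Finset.smul_sum, smul_smul]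
  rw [symbol, symbol, this, toC_smul, show toC (0 : Mat n₁ n₂) = 0 by ext; simp [toC], smul_sub,
    zero_sub, ← sub_eq_add_neg, smul_comm]

/-- Loss of energy within the time `ε = 1 / |ξ|`. -/
lemma energy_drop {A : Fin m → Mat n₁ n₂} {D : Matrix (Fin n₂) (Fin n₂) ℝ}
    (hA : ∀ α, (A α).IsSymm) {δ c b : ℝ} (hδ0 : 0 < δ)
    (hδ : ∀ y : Fin n₂ → ℝ, y ⬝ᵥ D.mulVec y ≤ -δ * ∑ i, y i ^ 2)
    (hb : ‖toC (sourceMat n₁ D)‖ ≤ b)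
    (hc : ∀ θ : Space m, ‖θ‖ = 1 → ∀ v : CState n₁ n₂,
      c * ‖v‖ ^ 2 ≤ ∫ s in (0 : ℝ)..1,
        ‖cact projD (cact (NormedSpace.exp ((s : ℂ) • symbol A 0 θ)) v)‖ ^ 2)
    {ε : ℝ} (hε : 0 < ε) {ξ : Space m} (hξ : ‖ε • ξ‖ = 1) (v : CState n₁ n₂) :
    c * ‖v‖ ^ 2 ≤ (1 / (ε * δ) + Real.exp 1 * ε * b ^ 2 / δ) *
      (‖v‖ ^ 2 - ‖cact (NormedSpace.exp ((ε : ℂ) • symbol A (sourceMat n₁ D) ξ)) v‖ ^ 2) := by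
  set B := sourceMat n₁ D with hB
  set M := (ε : ℂ) • symbol A B ξ with hM
  set N := symbol A 0 (ε • ξ) with hN
  have hMN : M = (ε : ℂ) • toC B + N := smul_symbol A B ξ ε
  set u : ℝ → CState n₁ n₂ := fun s => cact (NormedSpace.exp ((s : ℂ) • M)) v with hu
  set w : ℝ → CState n₁ n₂ := fun s => cact (NormedSpace.exp ((s : ℂ) • N)) v with hw
  have hu' : ∀ s, HasDerivAt u (cact M (u s)) s := hasDerivAt_cact_exp M v
  have hw' : ∀ s, HasDerivAt w (cact N (w s)) s := hasDerivAt_cact_exp N v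
  have hu0 : u 0 = v := by simp [hu, cact_one]
  have hw0 : w 0 = v := by simp [hw, cact_one]
  have hN0 : ∀ x : CState n₁ n₂, (inner ℂ x (cact N x)).re = 0 := by
    intro x
    rw [hN, re_inner_symbol hA, show toC (0 : Mat n₁ n₂) = 0 by ext; simp [toC], cact_zero,
      inner_zero_right, Complex.zero_re]
  have hdu : ∀ s, 2 * (inner ℂ (u s) (cact M (u s))).re ≤
      -(2 * ε * δ) * ‖cact projD (u s)‖ ^ 2 := by
    intro s
    rw [hMN, cact_add, inner_add_right, Complex.add_re, hN0, cact_smul, inner_smul_right,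
      Complex.re_ofReal_mul]
    nlinarith [re_inner_sourceMat_le (n₁ := n₁) hδ (u s)]
  have hb0 : 0 ≤ b := (norm_nonneg _).trans hb
  have hE : Antitone fun s => ‖u s‖ ^ 2 := by
    refine antitone_of_deriv_nonpos (fun s => (hasDerivAt_norm_sq (hu' s)).differentiableAt)
      fun s => ?_
    rw [(hasDerivAt_norm_sq (hu' s)).deriv]
    nlinarith [hdu s, mul_nonneg (mul_nonneg hε.le hδ0.le) (sq_nonneg ‖cact projD (u s)‖)]
  -- The source drives `u - w` by at most ε b |projD u|, whereas the energy of `u` drops at the rate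
  -- 2εδ|projD u|². This `K` makes the energy term cancel ε²b²|projD u|² exactly, so the sum below
  -- is nonincreasing.
  set K : ℝ := ε * b ^ 2 / (2 * δ) with hK
  have hz : AntitoneOn (fun s => Real.exp (-s) * ‖u s - w s‖ ^ 2 + K * ‖u s‖ ^ 2)
      (Icc (0 : ℝ) 1) := by
    have hd : ∀ s, HasDerivAt (fun s => Real.exp (-s) * ‖u s - w s‖ ^ 2 + K * ‖u s‖ ^ 2)
        (Real.exp (-s) * (2 * (inner ℂ (u s - w s) (cact M (u s) - cact N (w s))).re -
          ‖u s - w s‖ ^ 2) + K * (2 * (inner ℂ (u s) (cact M (u s))).re)) s := by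
      intro s
      have h1 := hasDerivAt_norm_sq ((hu' s).sub (hw' s))
      have h2 : HasDerivAt (fun s : ℝ => Real.exp (-s)) (-Real.exp (-s)) s := by
        simpa using (hasDerivAt_neg s).exp
      have h3 := (h2.mul h1).add ((hasDerivAt_norm_sq (hu' s)).const_mul K)
      exact h3.congr_deriv (by simp only [Pi.sub_apply]; ring)
    refine antitoneOn_of_deriv_nonpos (convex_Icc 0 1)
      (fun s _ => (hd s).continuousAt.continuousWithinAt)
      (fun s _ => (hd s).differentiableAt.differentiableWithinAt) fun s hs => ?_
    rw [interior_Icc] at hs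
    rw [(hd s).deriv]
    have h1 : cact M (u s) - cact N (w s) =
        cact N (u s - w s) + (ε : ℂ) • cact (toC B) (u s) := by
      rw [hMN, cact_add, cact_smul, cact_vsub]
      abel
    have h2 : (inner ℂ (u s - w s) ((ε : ℂ) • cact (toC B) (u s))).re ≤
        ε * b * ‖u s - w s‖ * ‖cact projD (u s)‖ := by
      refine (Complex.re_le_norm _).trans ((norm_inner_le_norm _ _).trans ?_)
      rw [norm_smul, Complex.norm_real, Real.norm_of_nonneg hε.le,
        ← cact_sourceMat_projD D (u s)]
      have := (norm_cact_le (toC B) (cact projD (u s))).trans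
        (mul_le_mul_of_nonneg_right hb (norm_nonneg _))
      calc _ ≤ ‖u s - w s‖ * (ε * (b * ‖cact projD (u s)‖)) := by gcongr
        _ = _ := by ring
    rw [h1, inner_add_right, Complex.add_re, hN0, zero_add]
    have h3 : 2 * (inner ℂ (u s - w s) ((ε : ℂ) • cact (toC B) (u s))).re - ‖u s - w s‖ ^ 2 ≤
        ε ^ 2 * b ^ 2 * ‖cact projD (u s)‖ ^ 2 := by
      nlinarith [sq_nonneg (ε * b * ‖cact projD (u s)‖ - ‖u s - w s‖)]
    have h4 : Real.exp (-s) ≤ 1 := Real.exp_le_one_iff.2 (by linarith [hs.1])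
    have h5 : K * (2 * (inner ℂ (u s) (cact M (u s))).re) ≤
        -(ε ^ 2 * b ^ 2 * ‖cact projD (u s)‖ ^ 2) := by
      calc _ ≤ K * (-(2 * ε * δ) * ‖cact projD (u s)‖ ^ 2) := by
            exact mul_le_mul_of_nonneg_left (hdu s) (by positivity)
        _ = _ := by rw [hK]; field_simp
    have h6 : 0 ≤ ε ^ 2 * b ^ 2 * ‖cact projD (u s)‖ ^ 2 := by positivity
    nlinarith [Real.exp_pos (-s)]
  set Δ : ℝ := ‖v‖ ^ 2 - ‖u 1‖ ^ 2 with hΔ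
  have hK0 : 0 ≤ K := by positivity
  -- Both flows start at `v`, so monotonicity bounds their distance by the energy lost; e^s ≤ e
  -- removes the weight.
  have hzs : ∀ s ∈ Icc (0 : ℝ) 1, ‖u s - w s‖ ^ 2 ≤ Real.exp 1 * K * Δ := by
    intro s hs
    have h1 := hz (left_mem_Icc.2 zero_le_one) hs hs.1
    simp only [hu0, hw0, sub_self, norm_zero, ne_eq, OfNat.ofNat_ne_zero, not_false_eq_true,
      zero_pow, mul_zero, zero_add] at h1
    have h2 := hE hs.2
    simp only at h2
    have h3 : Real.exp (-s) * ‖u s - w s‖ ^ 2 ≤ K * Δ := by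
      rw [hΔ]
      nlinarith
    calc ‖u s - w s‖ ^ 2 = Real.exp s * (Real.exp (-s) * ‖u s - w s‖ ^ 2) := by
          rw [← mul_assoc, ← Real.exp_add, add_neg_cancel, Real.exp_zero, one_mul]
      _ ≤ Real.exp 1 * (K * Δ) := by
          have : 0 ≤ Real.exp (-s) * ‖u s - w s‖ ^ 2 := by positivity
          gcongr
          exact hs.2
      _ = _ := by ring
  have hcu : Continuous u := continuous_iff_continuousAt.2 fun s => (hu' s).continuousAt
  have hcw : Continuous w := continuous_iff_continuousAt.2 fun s => (hw' s).continuousAt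
  have hcM : Continuous fun s => 2 * (inner ℂ (u s) (cact M (u s))).re :=
    continuous_const.mul (Complex.continuous_re.comp
      (hcu.inner (continuous_cact continuous_const hcu)))
  have hint : ∫ s in (0 : ℝ)..1, 2 * (inner ℂ (u s) (cact M (u s))).re = -Δ := by
    rw [intervalIntegral.integral_eq_sub_of_hasDerivAt (fun s _ => hasDerivAt_norm_sq (hu' s))
      (hcM.intervalIntegrable 0 1), hu0, hΔ]
    ring
  calc c * ‖v‖ ^ 2 ≤ ∫ s in (0 : ℝ)..1, ‖cact projD (w s)‖ ^ 2 := hc _ hξ v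
    -- The observation of `w` is split into that of `u`, which the dissipation controls, and the
    -- distance of the two flows. The first term is an exact derivative and integrates to Δ/(εδ).
    _ ≤ ∫ s in (0 : ℝ)..1, (-(1 / (ε * δ)) * (2 * (inner ℂ (u s) (cact M (u s))).re) +
          2 * (Real.exp 1 * K * Δ)) := by
        refine intervalIntegral.integral_mono_on zero_le_one
          ((continuous_cact continuous_const hcw).norm.pow 2 |>.intervalIntegrable 0 1)
          (((hcM.const_mul _).add continuous_const).intervalIntegrable 0 1) fun s hs => ?_
        have h1 : ‖cact projD (w s)‖ ≤ ‖cact projD (u s)‖ + ‖u s - w s‖ := by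
          have : cact projD (w s) = cact projD (u s) - cact projD (u s - w s) := by
            rw [cact_vsub]
            abel
          rw [this]
          exact (norm_sub_le _ _).trans (by gcongr; exact norm_projD_le _)
        have h2 : ‖cact projD (w s)‖ ^ 2 ≤
            2 * ‖cact projD (u s)‖ ^ 2 + 2 * ‖u s - w s‖ ^ 2 := by
          nlinarith [norm_nonneg (cact projD (w s)),
            sq_nonneg (‖cact projD (u s)‖ - ‖u s - w s‖)]
        have h3 : 2 * ‖cact projD (u s)‖ ^ 2 ≤
            -(1 / (ε * δ)) * (2 * (inner ℂ (u s) (cact M (u s))).re) := by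
          have := mul_le_mul_of_nonneg_left (hdu s) (by positivity : (0 : ℝ) ≤ 1 / (ε * δ))
          have h : 1 / (ε * δ) * (-(2 * ε * δ) * ‖cact projD (u s)‖ ^ 2) =
              -(2 * ‖cact projD (u s)‖ ^ 2) := by field_simp
          rw [h] at this
          linarith
        linarith [hzs s hs]
    _ = (1 / (ε * δ) + Real.exp 1 * ε * b ^ 2 / δ) * Δ := by
        rw [intervalIntegral.integral_add ((hcM.const_mul _).intervalIntegrable 0 1)
          (continuous_const.intervalIntegrable 0 1), intervalIntegral.integral_const_mul, hint,
          intervalIntegral.integral_const, hK]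
        simp only [sub_zero, one_smul]
        field_simp
    _ = _ := by
        rw [hΔ, hu]
        simp only [Complex.ofReal_one, one_smul, hM]

/-- The Kawashima decay estimate. -/
theorem exists_kawashima_decay {A : Fin m → Mat n₁ n₂} {D : Matrix (Fin n₂) (Fin n₂) ℝ}
    (hA : ∀ α, (A α).IsSymm) (hD : IsNegDef D) (hSK : ShizutaKawashima A (sourceMat n₁ D)) :
    ∃ C c : ℝ, 0 < C ∧ 0 < c ∧ ∀ ξ : Space m, ∀ t : ℝ, 0 ≤ t →
      ‖NormedSpace.exp ((t : ℂ) • symbol A (sourceMat n₁ D) ξ)‖ ≤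
        C * Real.exp (-(c * (‖ξ‖ ^ 2 / (1 + ‖ξ‖ ^ 2)) * t)) := by
  obtain ⟨δ, hδ0, hδ⟩ := exists_coercive hD
  obtain ⟨c, hc0, hc⟩ := exists_observability hA hSK
  set B := sourceMat n₁ D with hB
  -- The summand 1 ensures b ≥ 1 and hence K ≥ 1, also when B = 0.
  set b : ℝ := ‖toC B‖ + 1 with hb
  have hb0 : 0 ≤ ‖toC B‖ := norm_nonneg _
  set K : ℝ := Real.exp 1 * b ^ 2 with hK
  have hK1 : 1 ≤ K := by
    have := Real.one_le_exp (zero_le_one : (0 : ℝ) ≤ 1)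
    have h2 : 1 ≤ b ^ 2 := by rw [hb]; nlinarith
    rw [hK]
    nlinarith
  have hcontr : ∀ ξ : Space m, ∀ t : ℝ, 0 ≤ t → ‖NormedSpace.exp ((t : ℂ) • symbol A B ξ)‖ ≤ 1 := by
    intro ξ t ht
    have := norm_exp_le (M := symbol A B ξ) (μ := 0) (fun u => by
      rw [re_inner_symbol hA]
      nlinarith [re_inner_sourceMat_le (n₁ := n₁) hδ u, sq_nonneg ‖cact projD u‖]) ht
    simpa using this
  refine ⟨Real.exp (c * δ), c * δ / (2 * K), Real.exp_pos _, by positivity, fun ξ t ht => ?_⟩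
  by_cases hξ : ξ = 0
  · subst hξ
    refine (hcontr 0 t ht).trans ?_
    simp only [norm_zero, ne_eq, OfNat.ofNat_ne_zero, not_false_eq_true, zero_pow, zero_div,
      mul_zero, zero_mul, neg_zero, Real.exp_zero, mul_one]
    exact Real.one_le_exp (by positivity)
  set ρ := ‖ξ‖ with hρ
  have hρ0 : 0 < ρ := norm_pos_iff.2 hξ
  -- The fraction of the energy lost during 1/ρ: for ε = 1/ρ the factor in `energy_drop` is (ρ² +
  -- K)/(ρδ).
  set κ : ℝ := c * δ * ρ / (ρ ^ 2 + K) with hκ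
  have hκ0 : 0 < κ := by positivity
  have hκ1 : κ ≤ c * δ := by
    rw [hκ, div_le_iff₀ (by positivity)]
    have : ρ ≤ ρ ^ 2 + K := by nlinarith [sq_nonneg (ρ - 1)]
    have h : 0 < c * δ := by positivity
    nlinarith
  have hstep : ‖NormedSpace.exp (((ρ⁻¹ : ℝ) : ℂ) • symbol A B ξ)‖ ≤ Real.exp (-(κ / 2)) := by
    refine norm_le_of_norm_cact_le (Real.exp_pos _).le fun v => ?_
    have h1 := energy_drop hA (ε := ρ⁻¹) (ξ := ξ) hδ0 hδ (b := b)
      (by rw [hb]; linarith) hc (inv_pos.2 hρ0) (by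
        rw [norm_smul, norm_inv, norm_norm, inv_mul_cancel₀ hρ0.ne']) v
    rw [← hB] at h1
    set y := ‖cact (NormedSpace.exp (((ρ⁻¹ : ℝ) : ℂ) • symbol A B ξ)) v‖ with hy
    have h2 : 1 / (ρ⁻¹ * δ) + Real.exp 1 * ρ⁻¹ * b ^ 2 / δ = (ρ ^ 2 + K) / (ρ * δ) := by
      rw [hK]
      field_simp
    rw [h2] at h1
    have h3 : κ * ‖v‖ ^ 2 ≤ ‖v‖ ^ 2 - y ^ 2 := by
      have h4 : κ * ‖v‖ ^ 2 = (ρ * δ) / (ρ ^ 2 + K) * (c * ‖v‖ ^ 2) := by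
        rw [hκ]
        field_simp
      rw [h4]
      calc _ ≤ (ρ * δ) / (ρ ^ 2 + K) * ((ρ ^ 2 + K) / (ρ * δ) * (‖v‖ ^ 2 - y ^ 2)) := by gcongr
        _ = _ := by field_simp
    have h4 : y ^ 2 ≤ (Real.exp (-(κ / 2)) * ‖v‖) ^ 2 := by
      have h5 : Real.exp (-(κ / 2)) ^ 2 = Real.exp (-κ) := by
        rw [← Real.exp_nat_mul]
        congr 1
        push_cast
        ring
      rw [mul_pow, h5]
      nlinarith [Real.add_one_le_exp (-κ), sq_nonneg ‖v‖]
    exact (pow_le_pow_iff_left₀ (norm_nonneg _) (by positivity) two_ne_zero).1 h4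
  -- The time t consists of n steps of length 1/ρ and a remainder on which contraction suffices.
  set n := ⌊t * ρ⌋₊ with hn
  have hn1 : (n : ℝ) ≤ t * ρ := Nat.floor_le (by positivity)
  have hn2 : t * ρ < n + 1 := Nat.lt_floor_add_one _
  have hr : 0 ≤ t - n * ρ⁻¹ := by
    rw [← div_eq_mul_inv, sub_nonneg, div_le_iff₀ hρ0]
    exact hn1
  have hpow : NormedSpace.exp ((t : ℂ) • symbol A B ξ) =
      NormedSpace.exp (((t - n * ρ⁻¹ : ℝ) : ℂ) • symbol A B ξ) *
        NormedSpace.exp (((ρ⁻¹ : ℝ) : ℂ) • symbol A B ξ) ^ n := by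
    let _ : NormedAlgebra ℚ (CMat n₁ n₂) := NormedAlgebra.restrictScalars ℚ ℂ _
    rw [← NormedSpace.exp_nsmul, ← NormedSpace.exp_add_of_commute]
    · congr 1
      rw [← Nat.cast_smul_eq_nsmul ℂ, smul_smul, ← add_smul]
      congr 1
      push_cast
      ring
    · exact ((Commute.refl _).smul_left _).smul_right _ |>.smul_right _
  -- The rate per unit time is κρ/2, and ρ² + K ≤ K(1 + ρ²) because K ≥ 1.
  have hbig : κ / 2 * (t * ρ) ≥ c * δ / (2 * K) * (ρ ^ 2 / (1 + ρ ^ 2)) * t := by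
    have : κ / 2 * (t * ρ) = c * δ / 2 * (ρ ^ 2 / (ρ ^ 2 + K)) * t := by
      rw [hκ]
      field_simp
    rw [this, ge_iff_le]
    have h2 : c * δ / (2 * K) * (ρ ^ 2 / (1 + ρ ^ 2)) =
        c * δ / 2 * (ρ ^ 2 / (K * (1 + ρ ^ 2))) := by
      field_simp
    rw [h2]
    gcongr
    nlinarith [sq_nonneg ρ]
  calc ‖NormedSpace.exp ((t : ℂ) • symbol A B ξ)‖
      ≤ 1 * Real.exp (-(κ / 2)) ^ n := by
        rw [hpow]
        -- The zeroth power is treated apart: the identity does not have norm 1 when the state space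
        -- is trivial.
        by_cases hn0 : n = 0
        · rw [hn0, pow_zero, mul_one, pow_zero, mul_one]
          exact hcontr ξ _ (by simpa [hn0] using hr)
        · refine (norm_mul_le _ _).trans ?_
          gcongr
          · exact hcontr ξ _ hr
          · exact (norm_pow_le' _ (Nat.pos_of_ne_zero hn0)).trans (by gcongr)
    _ = Real.exp (-(κ / 2) * n) := by rw [one_mul, ← Real.exp_nat_mul]; congr 1; ring
    -- Rounding tρ down to n costs at most κ/2 in the exponent, and κ/2 ≤ cδ; this is the constant
    -- e^{cδ}.
    _ ≤ Real.exp (c * δ + -(c * δ / (2 * K) * (ρ ^ 2 / (1 + ρ ^ 2)) * t)) := by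
        apply Real.exp_le_exp.2
        nlinarith
    _ = _ := Real.exp_add _ _

end Decay

/-! ### The Riesz projector: commutation, idempotence and complex conjugation -/

section Riesz

open scoped Matrix.Norms.L2Operator

variable {m n₁ n₂ : ℕ}

lemma circleIntegral_clm_comp_comm {E F : Type*} [NormedAddCommGroup E] [NormedSpace ℂ E]
    [CompleteSpace E] [NormedAddCommGroup F] [NormedSpace ℂ F] [CompleteSpace F] (L : E →L[ℂ] F)
    {f : ℂ → E} {c : ℂ} {R : ℝ} (hf : CircleIntegrable f c R) :
    ∮ z in C(c, R), L (f z) = L (∮ z in C(c, R), f z) := by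
  rw [circleIntegral, circleIntegral, ← L.intervalIntegral_comp_comm hf.out]
  simp

/-- No eigenvalue of `M` lies on the circle `|z| = r`. -/
def CircleFree (r : ℝ) (M : CMat n₁ n₂) : Prop :=
  ∀ z : ℂ, ‖z‖ = r → (M - z • (1 : CMat n₁ n₂)).det ≠ 0

lemma CircleFree.isUnit {r : ℝ} {M : CMat n₁ n₂} (h : CircleFree r M) {z : ℂ} (hz : ‖z‖ = r) :
    IsUnit (M - z • (1 : CMat n₁ n₂)) :=
  (Matrix.isUnit_iff_isUnit_det _).2 (h z hz).isUnit

lemma CircleFree.inv_mul {r : ℝ} {M : CMat n₁ n₂} (h : CircleFree r M) {z : ℂ} (hz : ‖z‖ = r) :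
    (M - z • (1 : CMat n₁ n₂))⁻¹ * (M - z • (1 : CMat n₁ n₂)) = 1 :=
  Matrix.nonsing_inv_mul _ (h z hz).isUnit

lemma CircleFree.mul_inv {r : ℝ} {M : CMat n₁ n₂} (h : CircleFree r M) {z : ℂ} (hz : ‖z‖ = r) :
    (M - z • (1 : CMat n₁ n₂)) * (M - z • (1 : CMat n₁ n₂))⁻¹ = 1 :=
  Matrix.mul_nonsing_inv _ (h z hz).isUnit

lemma continuousAt_matrix_inv {M : CMat n₁ n₂} (h : IsUnit M) :
    ContinuousAt (fun N : CMat n₁ n₂ => N⁻¹) M := by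
  obtain ⟨u, rfl⟩ := h
  have h1 := NormedRing.inverse_continuousAt u
  have h2 : (fun N : CMat n₁ n₂ => N⁻¹) = Ring.inverse := by
    ext1 N
    exact Matrix.nonsing_inv_eq_ringInverse N
  rw [h2]
  exact h1

lemma CircleFree.continuousOn {r : ℝ} {M : CMat n₁ n₂} (h : CircleFree r M) :
    ContinuousOn (fun z : ℂ => (M - z • (1 : CMat n₁ n₂))⁻¹) (Metric.sphere 0 r) := by
  intro z hz
  have h1 : ContinuousAt (fun z : ℂ => M - z • (1 : CMat n₁ n₂)) z := by fun_prop
  exact ((continuousAt_matrix_inv (h.isUnit (by simpa using hz))).comp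
    (f := fun z : ℂ => M - z • (1 : CMat n₁ n₂)) h1).continuousWithinAt

/-- Entries of a matrix as continuous linear functionals. -/
def entryCLM (i j : Fin n₁ ⊕ Fin n₂) : CMat n₁ n₂ →L[ℂ] ℂ :=
  LinearMap.toContinuousLinearMap
    { toFun := fun N => N i j
      map_add' := fun _ _ => rfl
      map_smul' := fun _ _ => rfl }

/-- `M ↦ M v` as a continuous linear map. -/
def cactCLM (v : CState n₁ n₂) : CMat n₁ n₂ →L[ℂ] CState n₁ n₂ :=
  LinearMap.toContinuousLinearMap
    { toFun := fun N => cact N v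
      map_add' := fun _ _ => cact_add _ _ _
      map_smul' := fun _ _ => cact_smul _ _ _ }

lemma totalProj_eq_integral {r : ℝ} (hr : 0 ≤ r) {M : CMat n₁ n₂} (h : CircleFree r M) :
    totalProj r M = -(2 * Real.pi * Complex.I : ℂ)⁻¹ •
      ∮ z in C(0, r), (M - z • (1 : CMat n₁ n₂))⁻¹ := by
  ext i j
  have h1 := circleIntegral_clm_comp_comm (entryCLM i j) (h.continuousOn.circleIntegrable hr)
  simp only [totalProj, Matrix.of_apply, Matrix.smul_apply, smul_eq_mul]
  congr 1

lemma cact_totalProj {r : ℝ} (hr : 0 ≤ r) {M : CMat n₁ n₂} (h : CircleFree r M)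
    (v : CState n₁ n₂) :
    cact (totalProj r M) v = -(2 * Real.pi * Complex.I : ℂ)⁻¹ •
      ∮ z in C(0, r), cact (M - z • (1 : CMat n₁ n₂))⁻¹ v := by
  rw [totalProj_eq_integral hr h, cact_smul]
  congr 1
  exact (circleIntegral_clm_comp_comm (cactCLM v) (h.continuousOn.circleIntegrable hr)).symm

/-- Whatever commutes with M commutes with its resolvents, and the integral inherits this by
linearity and continuity. -/
lemma commute_totalProj {r : ℝ} (hr : 0 ≤ r) {M N : CMat n₁ n₂} (h : CircleFree r M)
    (hMN : Commute N M) : Commute N (totalProj r M) := by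
  rw [totalProj_eq_integral hr h]
  refine Commute.smul_right ?_ _
  have hint := h.continuousOn.circleIntegrable hr
  have h1 := circleIntegral_clm_comp_comm (ContinuousLinearMap.mul ℂ (CMat n₁ n₂) N) hint
  have h2 := circleIntegral_clm_comp_comm ((ContinuousLinearMap.mul ℂ (CMat n₁ n₂)).flip N) hint
  simp only [ContinuousLinearMap.mul_apply', ContinuousLinearMap.flip_apply] at h1 h2
  rw [Commute, SemiconjBy, ← h1, ← h2]
  refine circleIntegral.integral_congr hr fun z hz => ?_
  have hz' : ‖z‖ = r := by simpa using hz
  have hc : Commute N (M - z • (1 : CMat n₁ n₂)) :=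
    hMN.sub_right ((Commute.one_right N).smul_right z)
  calc N * (M - z • (1 : CMat n₁ n₂))⁻¹
      = (M - z • (1 : CMat n₁ n₂))⁻¹ * ((M - z • (1 : CMat n₁ n₂)) * N) *
          (M - z • (1 : CMat n₁ n₂))⁻¹ := by
        rw [← mul_assoc, h.inv_mul hz', one_mul]
    _ = (M - z • (1 : CMat n₁ n₂))⁻¹ * N := by
        rw [← hc.eq, ← mul_assoc, mul_assoc, h.mul_inv hz', mul_one]

/-- The contour integral of the resolvent is a scalar on each generalized eigenspace. The identity
R(z)(M - l)v = v + (z - l)R(z)v descends a Jordan chain at the price of one factor (z - l)⁻¹, so the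
induction has to carry all weights (z - l)^{-j}. -/
lemma resolvent_eigen {r : ℝ} (hr : 0 < r) {M : CMat n₁ n₂} (h : CircleFree r M) {l : ℂ}
    (hl : ‖l‖ ≠ r) (k : ℕ) : ∀ v : CState n₁ n₂, cact ((M - l • 1) ^ k) v = 0 → ∀ j : ℕ,
      ∮ z in C(0, r), (z - l) ^ (-(j : ℤ)) • cact (M - z • (1 : CMat n₁ n₂))⁻¹ v =
        -(∮ z in C(0, r), (z - l) ^ (-((j + 1 : ℕ) : ℤ))) • v := by
  have hzl : ∀ z ∈ Metric.sphere (0 : ℂ) r, z - l ≠ 0 := by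
    intro z hz hzl
    apply hl
    rw [← sub_eq_zero.1 hzl]
    simpa using hz
  have hpow : ∀ n : ℤ, ContinuousOn (fun z : ℂ => (z - l) ^ n) (Metric.sphere 0 r) := by
    intro n
    exact (continuousOn_id.sub continuousOn_const).zpow₀ n fun z hz => Or.inl (hzl z hz)
  induction k with
  | zero =>
    intro v hv j
    rw [pow_zero, cact_one] at hv
    subst hv
    simp [cact_vzero, circleIntegral]
  | succ k ih =>
    intro v hv j
    have hv' : cact ((M - l • 1) ^ k) (cact (M - l • 1) v) = 0 := by
      rwa [← cact_mul, ← pow_succ]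
    have h1 := ih _ hv' (j + 1)
    have hcR : ∀ w : CState n₁ n₂, ContinuousOn
        (fun z : ℂ => cact (M - z • (1 : CMat n₁ n₂))⁻¹ w) (Metric.sphere 0 r) :=
      fun w => (cactCLM w).continuous.comp_continuousOn h.continuousOn
    have h2 : ∮ z in C(0, r), (z - l) ^ (-(j : ℤ)) • cact (M - z • (1 : CMat n₁ n₂))⁻¹ v =
        ∮ z in C(0, r), ((z - l) ^ (-((j + 1 : ℕ) : ℤ)) •
          cact (M - z • (1 : CMat n₁ n₂))⁻¹ (cact (M - l • 1) v) -
          (z - l) ^ (-((j + 1 : ℕ) : ℤ)) • v) := by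
      refine circleIntegral.integral_congr hr.le fun z hz => ?_
      have hz' : ‖z‖ = r := by simpa using hz
      have e1 : cact (M - l • 1) v = cact (M - z • 1) v + (z - l) • v := by
        simp only [cact_sub, cact_smul, cact_one, sub_smul]
        abel
      have e2 : cact (M - z • (1 : CMat n₁ n₂))⁻¹ (cact (M - l • 1) v) =
          v + (z - l) • cact (M - z • (1 : CMat n₁ n₂))⁻¹ v := by
        rw [e1, cact_vadd, cact_vsmul, ← cact_mul, h.inv_mul hz', cact_one]
      have e3 : (z - l) ^ (-(j : ℤ)) = (z - l) ^ (-((j + 1 : ℕ) : ℤ)) * (z - l) := by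
        rw [← zpow_add_one₀ (hzl z hz)]
        congr 1
        push_cast
        ring
      change _ • _ = _ • _ - _ • _
      rw [e2, smul_add, add_sub_cancel_left, smul_smul, e3]
    have hi1 : CircleIntegrable (fun z : ℂ => (z - l) ^ (-((j + 1 : ℕ) : ℤ)) •
        cact (M - z • (1 : CMat n₁ n₂))⁻¹ (cact (M - l • 1) v)) 0 r :=
      ((hpow _).smul (hcR _)).circleIntegrable hr.le
    have hi2 : CircleIntegrable (fun z : ℂ => (z - l) ^ (-((j + 1 : ℕ) : ℤ)) • v) 0 r :=
      ((hpow _).smul continuousOn_const).circleIntegrable hr.le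
    -- The contribution of (M - l)v carries the exponent -(j + 2) ≠ -1 and integrates to zero.
    rw [h2, circleIntegral.integral_sub hi1 hi2, h1,
      circleIntegral.integral_sub_zpow_of_ne (by push_cast; omega), neg_zero, zero_smul, zero_sub,
      circleIntegral.integral_smul_const, neg_smul]

lemma circleIntegral_sub_inv {r : ℝ} (hr : 0 < r) {l : ℂ} (hl : ‖l‖ ≠ r) :
    ∮ z in C(0, r), (z - l)⁻¹ = if ‖l‖ < r then 2 * Real.pi * Complex.I else 0 := by
  split_ifs with h
  · exact circleIntegral.integral_sub_inv_of_mem_ball (by simpa using h)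
  · have hlt : r < ‖l‖ := lt_of_le_of_ne (not_lt.1 h) hl.symm
    refine DiffContOnCl.circleIntegral_eq_zero hr.le ?_
    have hd : DifferentiableOn ℂ (fun z : ℂ => (z - l)⁻¹) (Metric.closedBall 0 r) := by
      intro z hz
      refine DifferentiableAt.differentiableWithinAt ?_
      refine ((differentiableAt_id).sub_const l).inv ?_
      intro h0
      have : z = l := sub_eq_zero.1 h0
      rw [this] at hz
      simp only [Metric.mem_closedBall, dist_zero_right] at hz
      linarith
    exact (hd.mono Metric.closure_ball_subset_closedBall).diffContOnCl

/-- The total projector is idempotent. -/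
theorem totalProj_mul_self {r : ℝ} (hr : 0 < r) {M : CMat n₁ n₂} (h : CircleFree r M) :
    totalProj r M * totalProj r M = totalProj r M := by
  let T : Module.End ℂ (CState n₁ n₂) := (Matrix.toEuclideanCLM (𝕜 := ℂ) M).toLinearMap
  -- Instead of composing two contour integrals, the identity is tested on generalized eigenspaces.
  -- They span, and on each of them the projector is multiplication by 1 or by 0, according to
  -- whether the eigenvalue lies inside or outside the circle.
  let W : Submodule ℂ (CState n₁ n₂) :=
    LinearMap.ker (Matrix.toEuclideanCLM (𝕜 := ℂ)
      (totalProj r M * totalProj r M - totalProj r M)).toLinearMap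
  have hW : ∀ v, v ∈ W ↔ cact (totalProj r M * totalProj r M - totalProj r M) v = 0 :=
    fun v => Iff.rfl
  have hTpow : ∀ (l : ℂ) (k : ℕ) (v : CState n₁ n₂),
      ((T - l • 1) ^ k) v = cact ((M - l • 1) ^ k) v := by
    intro l k v
    have : T - l • 1 = (Matrix.toEuclideanCLM (𝕜 := ℂ) (M - l • 1)).toLinearMap := by
      ext1 x
      simp [T]
    induction k generalizing v with
    | zero => simp [cact_one]
    | succ k ih =>
      rw [pow_succ, Module.End.mul_apply, ih, pow_succ, cact_mul, this]
      rfl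
  have htop : (⊤ : Submodule ℂ (CState n₁ n₂)) ≤ W := by
    rw [← Module.End.iSup_maxGenEigenspace_eq_top T, iSup_le_iff]
    intro l v hv
    obtain ⟨k, hk⟩ := (Module.End.mem_maxGenEigenspace _ _ _).1 hv
    rw [hTpow] at hk
    -- On the circle M - l is invertible, so this generalized eigenspace is zero.
    by_cases hl : ‖l‖ = r
    · have hinj : ∀ k, ∀ w : CState n₁ n₂, cact ((M - l • 1) ^ k) w = 0 → w = 0 := by
        intro k
        induction k with
        | zero => intro w hw; simpa [cact_one] using hw
        | succ k ih =>
          intro w hw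
          rw [pow_succ, cact_mul] at hw
          have := congrArg (cact (M - l • (1 : CMat n₁ n₂))⁻¹) (ih _ hw)
          rwa [← cact_mul, h.inv_mul hl, cact_one, cact_vzero] at this
      rw [hinj k v hk]
      exact W.zero_mem
    · have h1 := resolvent_eigen hr h hl k v hk 0
      simp only [Nat.cast_zero, neg_zero, zpow_zero, one_smul, zero_add, Nat.cast_one,
        zpow_neg, zpow_one] at h1
      rw [circleIntegral_sub_inv hr hl] at h1
      have h2 := cact_totalProj hr.le h v
      rw [h1, neg_smul, neg_smul, smul_neg, neg_neg, smul_smul] at h2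
      rw [hW, cact_sub, cact_mul]
      split_ifs at h2 with hlt
      · rw [inv_mul_cancel₀ Complex.two_pi_I_ne_zero, one_smul] at h2
        rw [h2, h2, sub_self]
      · rw [mul_zero, zero_smul] at h2
        rw [h2, cact_vzero, sub_self]
  refine sub_eq_zero.1 (ext_cact fun v => ?_)
  rw [cact_zero]
  exact (hW v).1 (htop Submodule.mem_top)

/-- Conjugation maps the circle to itself with reversed orientation, whence the sign. In the
parametrization this is θ ↦ -θ together with periodicity. -/
lemma conj_circleIntegral (f : ℂ → ℂ) (r : ℝ) :
    (starRingEnd ℂ) (∮ z in C(0, r), f z) =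
      -∮ z in C(0, r), (starRingEnd ℂ) (f ((starRingEnd ℂ) z)) := by
  have hmap : ∀ θ : ℝ, (starRingEnd ℂ) (circleMap 0 r θ) = circleMap 0 r (-θ) := by
    intro θ
    simp [circleMap, ← Complex.exp_conj]
  rw [circleIntegral, circleIntegral, intervalIntegral.integral_of_le Real.two_pi_pos.le,
    ← integral_conj, ← intervalIntegral.integral_of_le Real.two_pi_pos.le,
    ← intervalIntegral.integral_neg]
  set g : ℝ → ℂ := fun θ => -(deriv (circleMap 0 r) θ •
    (starRingEnd ℂ) (f ((starRingEnd ℂ) (circleMap 0 r θ)))) with hg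
  have hper : Function.Periodic g (2 * Real.pi) := by
    intro θ
    simp only [hg, deriv_circleMap, periodic_circleMap 0 r θ]
  have h1 : ∫ θ in (0 : ℝ)..2 * Real.pi, g (-θ) = ∫ θ in (0 : ℝ)..2 * Real.pi, g θ := by
    rw [intervalIntegral.integral_comp_neg, neg_zero]
    have := hper.intervalIntegral_add_eq (-(2 * Real.pi)) 0
    simpa using this
  rw [← h1]
  refine intervalIntegral.integral_congr fun θ _ => ?_
  simp only [hg, deriv_circleMap, smul_eq_mul, map_mul, hmap, neg_neg, Complex.conj_I]
  ring

lemma inv_map_conj (M : CMat n₁ n₂) :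
    (M.map (starRingEnd ℂ))⁻¹ = M⁻¹.map (starRingEnd ℂ) := by
  have h1 := RingHom.map_det (starRingEnd ℂ) M
  have h2 := RingHom.map_adjugate (starRingEnd ℂ) M
  rw [RingHom.mapMatrix_apply] at h1 h2
  rw [RingHom.mapMatrix_apply] at h2
  rw [Matrix.inv_def, Matrix.inv_def, ← h1, ← h2, Ring.inverse_eq_inv']
  ext i j
  simp

/-- The sign from the reversed contour is compensated by conjugating the factor 2πi. This is what
makes K(t) map real functions to real functions. -/
lemma totalProj_map_conj (r : ℝ) (M : CMat n₁ n₂) :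
    totalProj r (M.map (starRingEnd ℂ)) = (totalProj r M).map (starRingEnd ℂ) := by
  have hinv : ∀ (z : ℂ) (i j : Fin n₁ ⊕ Fin n₂),
      (M.map (starRingEnd ℂ) - z • (1 : CMat n₁ n₂))⁻¹ i j =
      (starRingEnd ℂ) ((M - (starRingEnd ℂ) z • (1 : CMat n₁ n₂))⁻¹ i j) := by
    intro z i j
    have h1 : M.map (starRingEnd ℂ) - z • (1 : CMat n₁ n₂) =
        (M - (starRingEnd ℂ) z • (1 : CMat n₁ n₂)).map (starRingEnd ℂ) := by
      ext a b
      by_cases hab : a = b <;> simp [hab]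
    rw [h1, inv_map_conj, Matrix.map_apply]
  ext i j
  have h2 : totalProj r (M.map (starRingEnd ℂ)) i j = -(2 * Real.pi * Complex.I)⁻¹ *
      ∮ z in C(0, r), (starRingEnd ℂ) ((M - (starRingEnd ℂ) z • (1 : CMat n₁ n₂))⁻¹ i j) := by
    rw [totalProj, Matrix.of_apply]
    congr 1
    exact congrArg (fun f => circleIntegral f 0 r) (funext fun z => hinv z i j)
  have h3 := conj_circleIntegral (fun z => (M - z • (1 : CMat n₁ n₂))⁻¹ i j) r
  rw [h2, Matrix.map_apply, totalProj, Matrix.of_apply, map_mul, h3]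
  simp only [map_neg, map_inv₀, map_mul, map_ofNat, Complex.conj_ofReal, Complex.conj_I]
  rw [mul_neg (2 * (Real.pi : ℂ)) Complex.I, inv_neg, neg_neg]
  ring

end Riesz

/-! ### Resolvent bounds on the circle and perturbation of the projector from ξ = 0 -/

section Spectral

open scoped Matrix.Norms.L2Operator

variable {m n₁ n₂ : ℕ}

lemma norm_projC_le_one : ‖(projC : CMat n₁ n₂)‖ ≤ 1 :=
  norm_le_of_norm_cact_le zero_le_one fun v => by simpa using norm_projC_le v

lemma norm_projD_le_one : ‖(projD : CMat n₁ n₂)‖ ≤ 1 :=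
  norm_le_of_norm_cact_le zero_le_one fun v => by simpa using norm_projD_le v

lemma projD_mul_projC : (projD * projC : CMat n₁ n₂) = 0 := by
  simp [projC, projD, Matrix.fromBlocks_multiply]

lemma projC_mul_projD : (projC * projD : CMat n₁ n₂) = 0 := by
  simp [projC, projD, Matrix.fromBlocks_multiply]

lemma projC_mul_projC : (projC * projC : CMat n₁ n₂) = projC := by
  simp [projC, Matrix.fromBlocks_multiply]

lemma projD_mul_projD : (projD * projD : CMat n₁ n₂) = projD := by
  simp [projD, Matrix.fromBlocks_multiply]

lemma projC_mul_sourceMat (D : Matrix (Fin n₂) (Fin n₂) ℝ) :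
    projC * toC (sourceMat n₁ D) = 0 := by
  simp [toC, sourceMat, projC, Matrix.fromBlocks_map, Matrix.fromBlocks_multiply]

lemma sourceMat_mul_projC (D : Matrix (Fin n₂) (Fin n₂) ℝ) :
    toC (sourceMat n₁ D) * projC = 0 := by
  simp [toC, sourceMat, projC, Matrix.fromBlocks_map, Matrix.fromBlocks_multiply]

lemma projD_mul_sourceMat (D : Matrix (Fin n₂) (Fin n₂) ℝ) :
    projD * toC (sourceMat n₁ D) = toC (sourceMat n₁ D) := by
  simp [toC, sourceMat, projD, Matrix.fromBlocks_map, Matrix.fromBlocks_multiply]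

lemma sourceMat_mul_projD (D : Matrix (Fin n₂) (Fin n₂) ℝ) :
    toC (sourceMat n₁ D) * projD = toC (sourceMat n₁ D) := by
  simp [toC, sourceMat, projD, Matrix.fromBlocks_map, Matrix.fromBlocks_multiply]

lemma projC_cact_add_projD (u : CState n₁ n₂) : cact projC u + cact projD u = u := by
  rw [← cact_add, projC_add_projD, cact_one]

/-- A number `z` with `|z| ≤ δ / 2` is quantitatively off the spectrum of the dissipative block. -/
lemma norm_projD_le_norm_sub {D : Matrix (Fin n₂) (Fin n₂) ℝ} {δ : ℝ}
    (hδ : ∀ y : Fin n₂ → ℝ, y ⬝ᵥ D.mulVec y ≤ -δ * ∑ i, y i ^ 2) {z : ℂ} (hz : ‖z‖ ≤ δ / 2)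
    (u : CState n₁ n₂) :
    δ / 2 * ‖cact projD u‖ ≤ ‖cact projD (cact (toC (sourceMat n₁ D) - z • 1) u)‖ := by
  set p := cact projD u with hp
  have h1 : cact projD (cact (toC (sourceMat n₁ D) - z • 1) u) =
      cact (toC (sourceMat n₁ D)) p - z • p := by
    rw [cact_sub, cact_vsub, ← cact_mul, projD_mul_sourceMat, cact_smul, cact_one, cact_vsmul,
      hp, cact_sourceMat_projD]
  rw [h1]
  by_cases hp0 : p = 0
  · simp [hp0, cact_vzero]
  have hpn : 0 < ‖p‖ := norm_pos_iff.2 hp0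
  have hpp : cact projD p = p := by rw [hp, ← cact_mul, projD_mul_projD]
  have h2 := re_inner_sourceMat_le (n₁ := n₁) hδ p
  rw [hpp] at h2
  -- The numerical range of the dissipative block lies in Re ≤ -δ, at a distance of at least δ/2
  -- from z.
  have h3 : (inner ℂ p (z • p - cact (toC (sourceMat n₁ D)) p)).re ≤
      ‖p‖ * ‖cact (toC (sourceMat n₁ D)) p - z • p‖ := by
    refine (Complex.re_le_norm _).trans ((norm_inner_le_norm _ _).trans ?_)
    rw [norm_sub_rev]
  have h4 : -(δ / 2 * ‖p‖ ^ 2) ≤ (inner ℂ p (z • p)).re := by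
    have h5 : ‖inner ℂ p (z • p)‖ ≤ δ / 2 * ‖p‖ ^ 2 := by
      refine (norm_inner_le_norm _ _).trans ?_
      rw [norm_smul]
      nlinarith [mul_le_mul_of_nonneg_right hz (sq_nonneg ‖p‖)]
    have := (Complex.abs_re_le_norm _).trans h5
    linarith [neg_abs_le (inner ℂ p (z • p)).re]
  rw [inner_sub_right, Complex.sub_re] at h3
  nlinarith

/-- The two blocks decouple: the conservative one is -z, of modulus δ/2, and the dissipative one is
bounded below by δ/2. The radius δ/2 balances the two. -/
lemma norm_le_norm_source_sub {D : Matrix (Fin n₂) (Fin n₂) ℝ} {δ : ℝ} (hδ0 : 0 < δ)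
    (hδ : ∀ y : Fin n₂ → ℝ, y ⬝ᵥ D.mulVec y ≤ -δ * ∑ i, y i ^ 2) {z : ℂ} (hz : ‖z‖ = δ / 2)
    (u : CState n₁ n₂) :
    δ / 2 * ‖u‖ ≤ ‖cact (toC (sourceMat n₁ D) - z • 1) u‖ := by
  have h1 := norm_projD_le_norm_sub hδ hz.le u
  have h2 : ‖cact projC (cact (toC (sourceMat n₁ D) - z • 1) u)‖ = δ / 2 * ‖cact projC u‖ := by
    rw [cact_sub, cact_vsub, ← cact_mul, projC_mul_sourceMat, cact_zero, zero_sub, norm_neg,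
      cact_smul, cact_one, cact_vsmul, norm_smul, hz]
  have h3 := norm_sq_projC_add (cact (toC (sourceMat n₁ D) - z • 1) u)
  have h4 := norm_sq_projC_add u
  rw [h2] at h3
  refine (pow_le_pow_iff_left₀ (by positivity) (norm_nonneg _) two_ne_zero).1 ?_
  rw [mul_pow, ← h3, ← h4]
  have := pow_le_pow_left₀ (by positivity) h1 2
  nlinarith

lemma exists_norm_flux_le (A : Fin m → Mat n₁ n₂) :
    ∃ κ : ℝ, 0 < κ ∧ ∀ ξ : Space m, ‖toC (fluxMat A ξ)‖ ≤ κ * ‖ξ‖ := by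
  refine ⟨∑ α, ‖toC (A α)‖ + 1, by positivity, fun ξ => ?_⟩
  rw [fluxMat, toC_sum, add_mul, Finset.sum_mul]
  refine (norm_sum_le _ _).trans ?_
  refine le_add_of_le_of_nonneg (Finset.sum_le_sum fun α _ => ?_) (by positivity)
  rw [toC_smul, norm_smul, Complex.norm_real, mul_comm]
  gcongr
  exact PiLp.norm_apply_le ξ α

lemma symbol_sub_symbol (A : Fin m → Mat n₁ n₂) (B : Mat n₁ n₂) (ξ ξ' : Space m) :
    symbol A B ξ' - symbol A B ξ = Complex.I • toC (fluxMat A (ξ - ξ')) := by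
  have : fluxMat A (ξ - ξ') = fluxMat A ξ + (-1 : ℝ) • fluxMat A ξ' := by
    simp [fluxMat, sub_smul, Finset.sum_sub_distrib, ← sub_eq_add_neg]
  rw [this, toC_add, toC_smul, symbol, symbol, smul_add]
  simp
  abel

lemma symbol_zero (A : Fin m → Mat n₁ n₂) (B : Mat n₁ n₂) : symbol A B 0 = toC B := by
  have : toC (0 : Mat n₁ n₂) = 0 := by ext; simp [toC]
  simp [symbol, fluxMat, this]

/-- The perturbation -iA(ξ) uses up at most half of the lower bound δ/2 available at ξ = 0. -/
lemma norm_le_norm_symbol_sub {A : Fin m → Mat n₁ n₂} {D : Matrix (Fin n₂) (Fin n₂) ℝ} {δ κ : ℝ}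
    (hδ0 : 0 < δ) (hδ : ∀ y : Fin n₂ → ℝ, y ⬝ᵥ D.mulVec y ≤ -δ * ∑ i, y i ^ 2)
    (hκ : ∀ ξ : Space m, ‖toC (fluxMat A ξ)‖ ≤ κ * ‖ξ‖) {ξ : Space m} (hξ : κ * ‖ξ‖ ≤ δ / 4)
    {z : ℂ} (hz : ‖z‖ = δ / 2) (u : CState n₁ n₂) :
    δ / 4 * ‖u‖ ≤ ‖cact (symbol A (sourceMat n₁ D) ξ - z • 1) u‖ := by
  have h1 := norm_le_norm_source_sub hδ0 hδ hz u
  have h2 : cact (symbol A (sourceMat n₁ D) ξ - z • 1) u =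
      cact (toC (sourceMat n₁ D) - z • 1) u - Complex.I • cact (toC (fluxMat A ξ)) u := by
    rw [cact_sub, cact_sub, cact_symbol]
    abel
  have h3 : ‖Complex.I • cact (toC (fluxMat A ξ)) u‖ ≤ δ / 4 * ‖u‖ := by
    rw [norm_smul, Complex.norm_I, one_mul]
    exact (norm_cact_le _ _).trans (by gcongr; exact (hκ ξ).trans hξ)
  have h4 := norm_sub_norm_le (cact (toC (sourceMat n₁ D) - z • 1) u)
    (Complex.I • cact (toC (fluxMat A ξ)) u)
  rw [h2]
  linarith

lemma det_ne_zero_of_norm_le {M : CMat n₁ n₂} {c : ℝ} (hc : 0 < c)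
    (h : ∀ u : CState n₁ n₂, c * ‖u‖ ≤ ‖cact M u‖) : M.det ≠ 0 := by
  intro h0
  obtain ⟨v, hv, hMv⟩ := Matrix.exists_mulVec_eq_zero_iff.2 h0
  have h1 := h (WithLp.toLp 2 v)
  have h2 : cact M (WithLp.toLp 2 v) = 0 := by simp [cact, hMv]
  rw [h2, norm_zero] at h1
  have h3 : (WithLp.toLp 2 v : CState n₁ n₂) ≠ 0 := by simpa using hv
  have := norm_pos_iff.2 h3
  nlinarith

lemma norm_inv_le {M : CMat n₁ n₂} {c : ℝ} (hc : 0 < c)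
    (h : ∀ u : CState n₁ n₂, c * ‖u‖ ≤ ‖cact M u‖) : ‖M⁻¹‖ ≤ c⁻¹ := by
  refine norm_le_of_norm_cact_le (by positivity) fun v => ?_
  have h1 := h (cact M⁻¹ v)
  rw [← cact_mul, Matrix.mul_nonsing_inv _ (det_ne_zero_of_norm_le hc h).isUnit, cact_one] at h1
  rwa [inv_mul_eq_div, le_div_iff₀ hc, mul_comm]

/-- Lipschitz dependence of the total projector. -/
lemma norm_totalProj_sub_le {r c : ℝ} (hr : 0 < r) (hc : 0 < c) {M N : CMat n₁ n₂}
    (hM : ∀ z : ℂ, ‖z‖ = r → ∀ u : CState n₁ n₂, c * ‖u‖ ≤ ‖cact (M - z • 1) u‖)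
    (hN : ∀ z : ℂ, ‖z‖ = r → ∀ u : CState n₁ n₂, c * ‖u‖ ≤ ‖cact (N - z • 1) u‖) :
    ‖totalProj r M - totalProj r N‖ ≤ r * (c⁻¹ * ‖N - M‖ * c⁻¹) := by
  have hfM : CircleFree r M := fun z hz => det_ne_zero_of_norm_le hc (hM z hz)
  have hfN : CircleFree r N := fun z hz => det_ne_zero_of_norm_le hc (hN z hz)
  rw [totalProj_eq_integral hr.le hfM, totalProj_eq_integral hr.le hfN, ← smul_sub,
    ← circleIntegral.integral_sub (hfM.continuousOn.circleIntegrable hr.le)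
      (hfN.continuousOn.circleIntegrable hr.le), neg_smul, norm_neg]
  -- The factor r is the length 2πr of the circle over 2π; the integrand is a difference of
  -- resolvents, rewritten by the second resolvent identity.
  refine circleIntegral.norm_two_pi_i_inv_smul_integral_le_of_norm_le_const hr.le fun z hz => ?_
  have hz' : ‖z‖ = r := by simpa using hz
  have : (M - z • (1 : CMat n₁ n₂))⁻¹ - (N - z • (1 : CMat n₁ n₂))⁻¹ =
      (M - z • (1 : CMat n₁ n₂))⁻¹ * (N - M) * (N - z • (1 : CMat n₁ n₂))⁻¹ := by
    have e : N - M = (N - z • (1 : CMat n₁ n₂)) - (M - z • (1 : CMat n₁ n₂)) := by abel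
    rw [e, mul_sub, sub_mul, hfM.inv_mul hz', mul_assoc, hfN.mul_inv hz', mul_one, one_mul]
  rw [this]
  refine (norm_mul_le _ _).trans ?_
  gcongr
  · refine (norm_mul_le _ _).trans ?_
    gcongr
    exact norm_inv_le hc (hM z hz')
  · exact norm_inv_le hc (hN z hz')

lemma circleFree_sourceMat {D : Matrix (Fin n₂) (Fin n₂) ℝ} {δ : ℝ} (hδ0 : 0 < δ)
    (hδ : ∀ y : Fin n₂ → ℝ, y ⬝ᵥ D.mulVec y ≤ -δ * ∑ i, y i ^ 2) :
    CircleFree (δ / 2) (toC (sourceMat n₁ D)) := fun _ hz =>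
  det_ne_zero_of_norm_le (by positivity) (norm_le_norm_source_sub hδ0 hδ hz)

/-- The total projector of the source matrix is the projection onto the conservative part. -/
lemma totalProj_sourceMat {D : Matrix (Fin n₂) (Fin n₂) ℝ} {δ : ℝ} (hδ0 : 0 < δ)
    (hδ : ∀ y : Fin n₂ → ℝ, y ⬝ᵥ D.mulVec y ≤ -δ * ∑ i, y i ^ 2) :
    totalProj (δ / 2) (toC (sourceMat n₁ D)) = projC := by
  set r := δ / 2 with hr
  have hr0 : 0 < r := by positivity
  set B := toC (sourceMat n₁ D) with hB
  have hf : CircleFree r B := circleFree_sourceMat hδ0 hδ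
  refine ext_cact fun v => ?_
  -- Conservative vectors are eigenvectors of B for the eigenvalue 0, which lies inside the circle.
  have h1 : cact (totalProj r B) (cact projC v) = cact projC v := by
    have h := resolvent_eigen hr0 hf (l := 0) (by simpa using hr0.ne) 1 (cact projC v)
      (by rw [zero_smul, sub_zero, pow_one, ← cact_mul, hB, sourceMat_mul_projC, cact_zero]) 0
    simp only [Nat.cast_zero, neg_zero, zpow_zero, one_smul, zero_add, Nat.cast_one,
      zpow_neg, zpow_one] at h
    rw [circleIntegral_sub_inv hr0 (by simpa using hr0.ne), if_pos (by simpa using hr0)] at h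
    rw [cact_totalProj hr0.le hf, h, neg_smul, neg_smul, smul_neg, neg_neg, smul_smul,
      inv_mul_cancel₀ Complex.two_pi_I_ne_zero, one_smul]
  have h2 : cact (totalProj r B) (cact projD v) = 0 := by
    -- Subtracting 2r on the conservative block moves its eigenvalue 0 to -2r, out of the disc, and
    -- leaves the dissipative block alone. On dissipative vectors the resolvents of B and B' agree,
    -- and that of B' is holomorphic in the disc, so Cauchy's theorem gives zero.
    set B' : CMat n₁ n₂ := B - (2 * r : ℂ) • projC with hB'
    have hlow : ∀ z : ℂ, ‖z‖ ≤ r → ∀ u : CState n₁ n₂, r * ‖u‖ ≤ ‖cact (B' - z • 1) u‖ := by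
      intro z hz u
      have e1 : cact projD (cact (B' - z • 1) u) = cact projD (cact (B - z • 1) u) := by
        rw [← cact_mul, ← cact_mul, hB']
        congr 1
        rw [mul_sub, mul_sub, mul_sub, mul_smul_comm _ _ projC, projD_mul_projC, smul_zero,
          sub_zero]
      have e2 : cact projC (cact (B' - z • 1) u) = -(2 * r + z) • cact projC u := by
        rw [← cact_mul, ← cact_smul, hB']
        congr 1
        rw [mul_sub, mul_sub, hB, projC_mul_sourceMat, mul_smul_comm, projC_mul_projC,
          mul_smul_comm, mul_one, zero_sub, neg_smul, add_smul]
        abel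
      have h3 := norm_sq_projC_add (cact (B' - z • 1) u)
      have h4 := norm_sq_projC_add u
      have h5 : r * ‖cact projD u‖ ≤ ‖cact projD (cact (B' - z • 1) u)‖ := by
        rw [e1]
        exact norm_projD_le_norm_sub hδ hz u
      have h6 : r * ‖cact projC u‖ ≤ ‖cact projC (cact (B' - z • 1) u)‖ := by
        rw [e2, norm_smul, norm_neg]
        gcongr
        have := norm_sub_norm_le (2 * r : ℂ) (-z)
        rw [sub_neg_eq_add, norm_neg] at this
        have h7 : ‖(2 * r : ℂ)‖ = 2 * r := by
          rw [norm_mul, Complex.norm_real, Real.norm_of_nonneg hr0.le]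
          simp
        linarith
      refine (pow_le_pow_iff_left₀ (by positivity) (norm_nonneg _) two_ne_zero).1 ?_
      rw [mul_pow, ← h3, ← h4]
      have := pow_le_pow_left₀ (by positivity) h5 2
      have := pow_le_pow_left₀ (by positivity) h6 2
      nlinarith
    have hdet : ∀ z : ℂ, ‖z‖ ≤ r → (B' - z • (1 : CMat n₁ n₂)).det ≠ 0 := fun z hz =>
      det_ne_zero_of_norm_le hr0 (hlow z hz)
    have hcomm : Commute projD B' := by
      rw [Commute, SemiconjBy, hB', mul_sub, sub_mul, mul_smul_comm, smul_mul_assoc, hB,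
        projD_mul_sourceMat, sourceMat_mul_projD, projD_mul_projC, projC_mul_projD]
    have hres : ∀ z : ℂ, ‖z‖ = r → cact (B - z • 1)⁻¹ (cact projD v) =
        cact (B' - z • 1)⁻¹ (cact projD v) := by
      intro z hz
      have hu := (hdet z hz.le).isUnit
      have e1 : projD * (B' - z • (1 : CMat n₁ n₂)) = (B' - z • (1 : CMat n₁ n₂)) * projD :=
        (hcomm.sub_right ((Commute.one_right projD).smul_right z)).eq
      have e2 : (B' - z • (1 : CMat n₁ n₂))⁻¹ * projD =
          projD * (B' - z • (1 : CMat n₁ n₂))⁻¹ := by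
        calc (B' - z • (1 : CMat n₁ n₂))⁻¹ * projD
            = (B' - z • (1 : CMat n₁ n₂))⁻¹ * (projD * (B' - z • (1 : CMat n₁ n₂))) *
                (B' - z • (1 : CMat n₁ n₂))⁻¹ := by
              rw [mul_assoc, mul_assoc, Matrix.mul_nonsing_inv _ hu, mul_one]
          _ = _ := by rw [e1, ← mul_assoc, Matrix.nonsing_inv_mul _ hu, one_mul]
      have e3 : (B - z • (1 : CMat n₁ n₂)) * projD = (B' - z • (1 : CMat n₁ n₂)) * projD := by
        rw [hB', sub_mul, sub_mul, sub_mul, smul_mul_assoc _ projC, projC_mul_projD, smul_zero,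
          sub_zero]
      rw [← cact_mul, ← cact_mul]
      congr 1
      calc (B - z • (1 : CMat n₁ n₂))⁻¹ * projD
          = (B - z • (1 : CMat n₁ n₂))⁻¹ * ((B' - z • (1 : CMat n₁ n₂)) * projD *
              (B' - z • (1 : CMat n₁ n₂))⁻¹) := by
            rw [mul_assoc _ projD, ← e2, ← mul_assoc _ _ projD, Matrix.mul_nonsing_inv _ hu,
              one_mul]
        _ = ((B - z • (1 : CMat n₁ n₂))⁻¹ * (B - z • (1 : CMat n₁ n₂))) * (projD *
              (B' - z • (1 : CMat n₁ n₂))⁻¹) := by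
            rw [← e3]
            simp only [mul_assoc]
        _ = _ := by rw [hf.inv_mul hz, one_mul, e2]
    rw [cact_totalProj hr0.le hf, circleIntegral.integral_congr hr0.le
      (g := fun z => cact (B' - z • 1)⁻¹ (cact projD v))
      fun z hz => hres z (by simpa using hz)]
    rw [DiffContOnCl.circleIntegral_eq_zero hr0.le, smul_zero]
    have hd : DifferentiableOn ℂ
        (fun z : ℂ => cact (B' - z • (1 : CMat n₁ n₂))⁻¹ (cact projD v))
        (Metric.closedBall 0 r) := by
      intro z hz
      refine DifferentiableAt.differentiableWithinAt ?_
      have hu : IsUnit (B' - z • (1 : CMat n₁ n₂)) :=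
        (Matrix.isUnit_iff_isUnit_det _).2 (hdet z (by simpa using hz)).isUnit
      have d1 : DifferentiableAt ℂ (fun z : ℂ => B' - z • (1 : CMat n₁ n₂)) z := by fun_prop
      have d2 : DifferentiableAt ℂ (fun z : ℂ => Ring.inverse (B' - z • (1 : CMat n₁ n₂))) z :=
        DifferentiableAt.comp (g := Ring.inverse) z (differentiableAt_inverse hu) d1
      have d3 := (cactCLM (cact projD v)).differentiableAt.comp z d2
      refine d3.congr_of_eventuallyEq (Eventually.of_forall fun w => ?_)
      simp only [Function.comp, ← Matrix.nonsing_inv_eq_ringInverse]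
      rfl
    exact (hd.mono Metric.closure_ball_subset_closedBall).diffContOnCl
  conv_lhs => rw [← projC_cact_add_projD v]
  rw [cact_vadd, h1, h2, add_zero]

end Spectral

/-! ### Block bounds of the low-frequency symbol and decay of the complement -/

section SpectralBounds

open scoped Matrix.Norms.L2Operator

variable {m n₁ n₂ : ℕ}

/-- Exponential decay on the range of the complementary projector. -/
lemma norm_complement_exp_le {A : Fin m → Mat n₁ n₂} (hA : ∀ α, (A α).IsSymm)
    {D : Matrix (Fin n₂) (Fin n₂) ℝ} {δ : ℝ} (hδ0 : 0 < δ)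
    (hδ : ∀ y : Fin n₂ → ℝ, y ⬝ᵥ D.mulVec y ≤ -δ * ∑ i, y i ^ 2) {ξ : Space m}
    {P : CMat n₁ n₂} (hPP : P * P = P) (hcomm : Commute (symbol A (sourceMat n₁ D) ξ) P)
    (hP : ‖P - projC‖ ≤ 1 / 2) {t : ℝ} (ht : 0 ≤ t) :
    ‖(1 - P) * NormedSpace.exp ((t : ℂ) • symbol A (sourceMat n₁ D) ξ)‖ ≤
      3 * Real.exp (-(3 / 4 * δ * t)) := by
  set M := symbol A (sourceMat n₁ D) ξ with hM
  have hcomm' : ∀ s : ℂ, Commute (1 - P) (NormedSpace.exp (s • M)) := fun s =>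
    (((Commute.one_left _).sub_left hcomm.symm).smul_right s).exp_right
  have hQQ : (1 - P) * (1 - P) = 1 - P := by
    rw [mul_sub, sub_mul, sub_mul, hPP]
    simp
  have hQ : ‖(1 - P : CMat n₁ n₂)‖ ≤ 3 := by
    have e : (1 - P : CMat n₁ n₂) = projD - (P - projC) := by
      rw [← projC_add_projD]
      abel
    rw [e]
    refine (norm_sub_le _ _).trans ?_
    linarith [norm_projD_le_one (n₁ := n₁) (n₂ := n₂)]
  refine norm_le_of_norm_cact_le (by positivity) fun v => ?_
  rw [(hcomm' _).eq, cact_mul]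
  -- The orbit stays in the range of 1 - P. There projC u = projC(projC - P)u, so the conservative
  -- part has at most half the norm of u and the dissipative part at least 3/4 of the squared norm;
  -- this yields the rate 3δ/4.
  have horb := norm_cact_exp_le_of_orbit (M := M) (μ := -(3 / 4 * δ)) (v := cact (1 - P) v)
    (fun s => by
      set u := cact (NormedSpace.exp ((s : ℂ) • M)) (cact (1 - P) v) with hu
      have hu1 : cact (1 - P) u = u := by
        rw [hu, ← cact_mul, ← cact_mul, ← cact_mul, (hcomm' _).eq, mul_assoc, hQQ]
      have hu2 : ‖cact projC u‖ ≤ 1 / 2 * ‖u‖ := by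
        have e : cact projC u = cact (projC * (projC - P)) u := by
          conv_lhs => rw [← hu1]
          rw [← cact_mul]
          congr 1
          rw [mul_sub, mul_sub, mul_one, projC_mul_projC]
        rw [e]
        refine (norm_cact_le _ _).trans ?_
        gcongr
        refine (norm_mul_le _ _).trans ?_
        rw [norm_sub_rev]
        nlinarith [norm_projC_le_one (n₁ := n₁) (n₂ := n₂), norm_nonneg (P - projC)]
      have h1 := norm_sq_projC_add u
      have h2 := pow_le_pow_left₀ (norm_nonneg _) hu2 2
      rw [re_inner_symbol hA]
      have h3 := re_inner_sourceMat_le (n₁ := n₁) hδ u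
      nlinarith) ht
  refine horb.trans ?_
  have h1 := norm_cact_le (1 - P) v
  have h2 : ‖cact (1 - P) v‖ ≤ 3 * ‖v‖ := h1.trans (by gcongr)
  calc _ ≤ Real.exp (-(3 / 4 * δ) * t) * (3 * ‖v‖) := by gcongr
    _ = _ := by rw [neg_mul]; ring

/-- Bounds of the low-frequency multiplier and of its complement. -/
structure SpectralBounds (A : Fin m → Mat n₁ n₂) (B : Mat n₁ n₂) (r a C c : ℝ) : Prop where
  pos_r : 0 < r
  pos_a : 0 < a
  pos_C : 0 < C
  pos_c : 0 < c
  separates : Separates A B r a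
  contraction : ∀ ξ : Space m, ∀ t : ℝ, 0 ≤ t → ‖NormedSpace.exp ((t : ℂ) • symbol A B ξ)‖ ≤ 1
  continuousOn : ContinuousOn (fun ξ => totalProj r (symbol A B ξ)) (Metric.closedBall 0 a)
  -- Each dissipative index in a block contributes one power of |ξ|; these powers become the
  -- additional decay t^{-1/2} per index.
  block_cc : ∀ ξ : Space m, ∀ t : ℝ, 0 ≤ t →
    ‖projC * lowMultiplier A B r a t ξ * projC‖ ≤ C * Real.exp (-(c * ‖ξ‖ ^ 2 * t))
  block_cd : ∀ ξ : Space m, ∀ t : ℝ, 0 ≤ t →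
    ‖projC * lowMultiplier A B r a t ξ * projD‖ ≤ C * ‖ξ‖ * Real.exp (-(c * ‖ξ‖ ^ 2 * t))
  block_dc : ∀ ξ : Space m, ∀ t : ℝ, 0 ≤ t →
    ‖projD * lowMultiplier A B r a t ξ * projC‖ ≤ C * ‖ξ‖ * Real.exp (-(c * ‖ξ‖ ^ 2 * t))
  block_dd : ∀ ξ : Space m, ∀ t : ℝ, 0 ≤ t →
    ‖projD * lowMultiplier A B r a t ξ * projD‖ ≤ C * ‖ξ‖ ^ 2 * Real.exp (-(c * ‖ξ‖ ^ 2 * t))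
  remainder : ∀ ξ : Space m, ∀ t : ℝ, 0 ≤ t →
    ‖NormedSpace.exp ((t : ℂ) • symbol A B ξ) - lowMultiplier A B r a t ξ‖ ≤
      C * Real.exp (-(c * t))

/-- All that the estimates need to know about the symbol. The decay of the exponential comes from
the Kawashima estimate, the powers of |ξ| from the distance of P(iξ) to P(0), and the remainder
bound from the damping of the complement. -/
theorem exists_spectralBounds {A : Fin m → Mat n₁ n₂} {D : Matrix (Fin n₂) (Fin n₂) ℝ}
    (hA : ∀ α, (A α).IsSymm) (hD : IsNegDef D) (hSK : ShizutaKawashima A (sourceMat n₁ D)) :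
    ∃ r a C c : ℝ, SpectralBounds A (sourceMat n₁ D) r a C c := by
  obtain ⟨δ, hδ0, hδ⟩ := exists_coercive hD
  obtain ⟨κ, hκ0, hκ⟩ := exists_norm_flux_le A
  obtain ⟨C₀, c₀, hC₀, hc₀, hdec⟩ := exists_kawashima_decay hA hD hSK
  set B := sourceMat n₁ D with hB
  set r : ℝ := δ / 2 with hr
  have hr0 : 0 < r := by positivity
  -- With κ|ξ| ≤ δ/16 the resolvent stays bounded on the circle, and the Lipschitz bound 8κ/δ·|ξ|
  -- for P - projC is at most 1/2.
  set a : ℝ := δ / (16 * κ) with ha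
  have ha0 : 0 < a := by positivity
  have hκa : ∀ ξ : Space m, ‖ξ‖ ≤ a → κ * ‖ξ‖ ≤ δ / 16 := by
    intro ξ hξ
    calc κ * ‖ξ‖ ≤ κ * a := by gcongr
      _ = δ / 16 := by rw [ha]; field_simp
  have hlow : ∀ ξ : Space m, ‖ξ‖ ≤ a → ∀ z : ℂ, ‖z‖ = r → ∀ u : CState n₁ n₂,
      δ / 4 * ‖u‖ ≤ ‖cact (symbol A B ξ - z • 1) u‖ := fun ξ hξ z hz u =>
    norm_le_norm_symbol_sub hδ0 hδ hκ ((hκa ξ hξ).trans (by linarith)) hz u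
  have hfree : ∀ ξ : Space m, ‖ξ‖ ≤ a → CircleFree r (symbol A B ξ) := fun ξ hξ z hz =>
    det_ne_zero_of_norm_le (by positivity) (hlow ξ hξ z hz)
  set P : Space m → CMat n₁ n₂ := fun ξ => totalProj r (symbol A B ξ) with hP
  have hLip : ∀ ξ ξ' : Space m, ‖ξ‖ ≤ a → ‖ξ'‖ ≤ a →
      ‖P ξ - P ξ'‖ ≤ 8 * κ / δ * ‖ξ - ξ'‖ := by
    intro ξ ξ' hξ hξ'
    refine (norm_totalProj_sub_le hr0 (by positivity) (hlow ξ hξ) (hlow ξ' hξ')).trans ?_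
    rw [symbol_sub_symbol, norm_smul, Complex.norm_I, one_mul]
    calc r * ((δ / 4)⁻¹ * ‖toC (fluxMat A (ξ - ξ'))‖ * (δ / 4)⁻¹)
        ≤ r * ((δ / 4)⁻¹ * (κ * ‖ξ - ξ'‖) * (δ / 4)⁻¹) := by
          gcongr
          exact hκ _
      _ = _ := by rw [hr]; field_simp; ring
  have hP0 : P 0 = projC := by
    simp only [hP, symbol_zero]
    exact totalProj_sourceMat hδ0 hδ
  have hPC : ∀ ξ : Space m, ‖ξ‖ ≤ a → ‖P ξ - projC‖ ≤ 8 * κ / δ * ‖ξ‖ := by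
    intro ξ hξ
    have := hLip ξ 0 hξ (by simpa using ha0.le)
    rwa [hP0, sub_zero] at this
  have hPhalf : ∀ ξ : Space m, ‖ξ‖ ≤ a → ‖P ξ - projC‖ ≤ 1 / 2 := by
    intro ξ hξ
    refine (hPC ξ hξ).trans ?_
    have := hκa ξ hξ
    rw [div_mul_eq_mul_div, div_le_iff₀ hδ0]
    linarith
  have hPn : ∀ ξ : Space m, ‖ξ‖ ≤ a → ‖P ξ‖ ≤ 2 := by
    intro ξ hξ
    have h1 := norm_add_le (P ξ - projC) projC
    rw [sub_add_cancel] at h1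
    linarith [hPhalf ξ hξ, norm_projC_le_one (n₁ := n₁) (n₂ := n₂)]
  have hPP : ∀ ξ : Space m, ‖ξ‖ ≤ a → P ξ * P ξ = P ξ := fun ξ hξ =>
    totalProj_mul_self hr0 (hfree ξ hξ)
  have hcomm : ∀ ξ : Space m, ‖ξ‖ ≤ a → Commute (symbol A B ξ) (P ξ) := fun ξ hξ =>
    commute_totalProj hr0.le (hfree ξ hξ) (Commute.refl _)
  set L : ℝ := 8 * κ / δ + 2 with hL
  have hL2 : 2 ≤ L := by rw [hL]; linarith [show 0 < 8 * κ / δ by positivity]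
  -- Since projD projC = 0, only the deviation of P from P(0) is seen, and it is O(|ξ|); likewise on
  -- the right.
  have hDP : ∀ ξ : Space m, ‖ξ‖ ≤ a → ‖projD * P ξ‖ ≤ L * ‖ξ‖ := by
    intro ξ hξ
    have e : projD * P ξ = projD * (P ξ - projC) := by rw [mul_sub, projD_mul_projC, sub_zero]
    rw [e]
    refine (norm_mul_le _ _).trans ?_
    have h1 := hPC ξ hξ
    have h2 := norm_projD_le_one (n₁ := n₁) (n₂ := n₂)
    calc _ ≤ 1 * (8 * κ / δ * ‖ξ‖) := by gcongr
      _ ≤ L * ‖ξ‖ := by rw [hL, one_mul]; gcongr; linarith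
  have hPD : ∀ ξ : Space m, ‖ξ‖ ≤ a → ‖P ξ * projD‖ ≤ L * ‖ξ‖ := by
    intro ξ hξ
    have e : P ξ * projD = (P ξ - projC) * projD := by rw [sub_mul, projC_mul_projD, sub_zero]
    rw [e]
    refine (norm_mul_le _ _).trans ?_
    have h1 := hPC ξ hξ
    have h2 := norm_projD_le_one (n₁ := n₁) (n₂ := n₂)
    calc _ ≤ (8 * κ / δ * ‖ξ‖) * 1 := by gcongr
      _ ≤ L * ‖ξ‖ := by rw [hL, mul_one]; gcongr; linarith
  have hCP : ∀ ξ : Space m, ‖ξ‖ ≤ a → ‖projC * P ξ‖ ≤ L := by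
    intro ξ hξ
    refine (norm_mul_le _ _).trans ?_
    nlinarith [hPn ξ hξ, norm_projC_le_one (n₁ := n₁) (n₂ := n₂), norm_nonneg (P ξ)]
  have hPC' : ∀ ξ : Space m, ‖ξ‖ ≤ a → ‖P ξ * projC‖ ≤ L := by
    intro ξ hξ
    refine (norm_mul_le _ _).trans ?_
    nlinarith [hPn ξ hξ, norm_projC_le_one (n₁ := n₁) (n₂ := n₂), norm_nonneg (P ξ)]
  -- Three rates: `c₁` bounds the Kawashima rate below by a multiple of |ξ|² inside the ball, `c₂`
  -- is its least value outside, and 3δ/4 is the rate on the complement.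
  set c₁ : ℝ := c₀ / (1 + a ^ 2) with hc₁
  set c₂ : ℝ := c₀ * (a ^ 2 / (1 + a ^ 2)) with hc₂
  set c : ℝ := min c₁ (min c₂ (3 / 4 * δ)) with hc
  have hc0 : 0 < c := by
    rw [hc]
    refine lt_min (by positivity) (lt_min (by positivity) (by positivity))
  have hcc₁ : c ≤ c₁ := min_le_left _ _
  have hcc₂ : c ≤ c₂ := (min_le_right _ _).trans (min_le_left _ _)
  have hccδ : c ≤ 3 / 4 * δ := (min_le_right _ _).trans (min_le_right _ _)
  set C : ℝ := L ^ 2 * C₀ + C₀ + 3 with hC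
  have hexp : ∀ ξ : Space m, ‖ξ‖ ≤ a → ∀ t : ℝ, 0 ≤ t →
      ‖NormedSpace.exp ((t : ℂ) • symbol A B ξ)‖ ≤ C₀ * Real.exp (-(c * ‖ξ‖ ^ 2 * t)) := by
    intro ξ hξ t ht
    have h1 : c * ‖ξ‖ ^ 2 ≤ c₀ * (‖ξ‖ ^ 2 / (1 + ‖ξ‖ ^ 2)) := by
      calc c * ‖ξ‖ ^ 2 ≤ c₁ * ‖ξ‖ ^ 2 := by gcongr
        _ = c₀ * (‖ξ‖ ^ 2 / (1 + a ^ 2)) := by rw [hc₁]; ring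
        _ ≤ _ := by gcongr
    exact (hdec ξ t ht).trans (mul_le_mul_of_nonneg_left
      (Real.exp_le_exp.2 (neg_le_neg (mul_le_mul_of_nonneg_right h1 ht))) hC₀.le)
  -- Idempotence and commutation put one copy of P next to `R` and another next to `S`, so that both
  -- sides can gain a factor |ξ|.
  have hfac : ∀ ξ : Space m, ‖ξ‖ ≤ a → ∀ t : ℝ, ∀ R S : CMat n₁ n₂,
      R * (P ξ * NormedSpace.exp ((t : ℂ) • symbol A B ξ)) * S =
        (R * P ξ) * NormedSpace.exp ((t : ℂ) • symbol A B ξ) * (P ξ * S) := by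
    intro ξ hξ t R S
    have h1 : Commute (P ξ) (NormedSpace.exp ((t : ℂ) • symbol A B ξ)) :=
      ((hcomm ξ hξ).symm.smul_right _).exp_right
    conv_lhs => rw [← hPP ξ hξ]
    rw [mul_assoc (P ξ), h1.eq]
    simp only [mul_assoc]
  have hblock : ∀ (R S : CMat n₁ n₂) (p q : ℝ → ℝ), (∀ ρ, 0 ≤ ρ → 0 ≤ p ρ) →
      (∀ ρ, 0 ≤ ρ → 0 ≤ q ρ) →
      (∀ ξ : Space m, ‖ξ‖ ≤ a → ‖R * P ξ‖ ≤ L * p ‖ξ‖) →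
      (∀ ξ : Space m, ‖ξ‖ ≤ a → ‖P ξ * S‖ ≤ L * q ‖ξ‖) → ∀ ξ : Space m, ∀ t : ℝ, 0 ≤ t →
      ‖R * lowMultiplier A B r a t ξ * S‖ ≤
        C * (p ‖ξ‖ * q ‖ξ‖) * Real.exp (-(c * ‖ξ‖ ^ 2 * t)) := by
    intro R S p q hp hq hR hS ξ t ht
    have hp' := hp ‖ξ‖ (norm_nonneg _)
    have hq' := hq ‖ξ‖ (norm_nonneg _)
    have hCpos : 0 ≤ C := by positivity
    rw [lowMultiplier]
    split_ifs with hξ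
    · rw [hfac ξ hξ]
      calc _ ≤ ‖R * P ξ‖ * ‖NormedSpace.exp ((t : ℂ) • symbol A B ξ)‖ * ‖P ξ * S‖ :=
            (norm_mul_le _ _).trans (by gcongr; exact norm_mul_le _ _)
        _ ≤ (L * p ‖ξ‖) * (C₀ * Real.exp (-(c * ‖ξ‖ ^ 2 * t))) * (L * q ‖ξ‖) := by
            gcongr
            · exact hR ξ hξ
            · exact hexp ξ hξ t ht
            · exact hS ξ hξ
        _ = (L ^ 2 * C₀) * (p ‖ξ‖ * q ‖ξ‖) * Real.exp (-(c * ‖ξ‖ ^ 2 * t)) := by ring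
        _ ≤ _ := by
            gcongr
            rw [hC]
            linarith
    · rw [mul_zero, zero_mul, norm_zero]
      positivity
  refine ⟨r, a, C, c, hr0, ha0, by positivity, hc0, ⟨?_, hfree⟩, ?_, ?_, ?_, ?_, ?_, ?_, ?_⟩
  -- For 0 < |z| ≤ r an eigenvector would have no dissipative part, and on conservative vectors B -
  -- z is -z, which is injective.
  · intro z hz hdet
    by_contra hle
    rw [not_lt] at hle
    obtain ⟨v, hv, hMv⟩ := Matrix.exists_mulVec_eq_zero_iff.2 hdet
    set u : CState n₁ n₂ := WithLp.toLp 2 v with hu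
    have h2 : cact (toC B - z • 1) u = 0 := by simp [cact, hu, hMv]
    have h3 := norm_projD_le_norm_sub (n₁ := n₁) hδ hle u
    rw [← hB, h2, cact_vzero, norm_zero] at h3
    have h4 : cact projD u = 0 := by
      rw [← norm_le_zero_iff]
      nlinarith
    have h5 : cact projC (cact (toC B - z • 1) u) = -(z • u) := by
      have e : cact projC u = u := by
        conv_rhs => rw [← projC_cact_add_projD u, h4, add_zero]
      rw [cact_sub, cact_vsub, ← cact_mul, hB, projC_mul_sourceMat, cact_zero, zero_sub,
        cact_smul, cact_one, cact_vsmul, e]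
    rw [h2, cact_vzero, eq_comm, neg_eq_zero, smul_eq_zero] at h5
    rcases h5 with h5 | h5
    · exact hz h5
    · exact hv (by simpa [hu] using h5)
  · intro ξ t ht
    have := norm_exp_le (M := symbol A B ξ) (μ := 0) (fun u => by
      rw [re_inner_symbol hA]
      nlinarith [re_inner_sourceMat_le (n₁ := n₁) hδ u, sq_nonneg ‖cact projD u‖]) ht
    simpa using this
  · refine LipschitzOnWith.continuousOn (K := (8 * κ / δ).toNNReal) ?_
    refine LipschitzOnWith.of_dist_le_mul fun ξ hξ ξ' hξ' => ?_
    rw [dist_eq_norm, dist_eq_norm, Real.coe_toNNReal _ (by positivity)]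
    exact hLip ξ ξ' (by simpa using hξ) (by simpa using hξ')
  · intro ξ t ht
    have := hblock projC projC (fun _ => 1) (fun _ => 1) (fun _ _ => zero_le_one)
      (fun _ _ => zero_le_one) (by simpa using hCP) (by simpa using hPC') ξ t ht
    simpa using this
  · intro ξ t ht
    have := hblock projC projD (fun _ => 1) id (fun _ _ => zero_le_one)
      (fun _ h => h) (by simpa using hCP) (by simpa using hPD) ξ t ht
    simpa using this
  · intro ξ t ht
    have := hblock projD projC id (fun _ => 1) (fun _ h => h) (fun _ _ => zero_le_one)
      (by simpa using hDP) (by simpa using hPC') ξ t ht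
    simpa using this
  · intro ξ t ht
    have := hblock projD projD id id (fun _ h => h) (fun _ h => h)
      (by simpa using hDP) (by simpa using hPD) ξ t ht
    simpa [sq] using this
  · intro ξ t ht
    rw [lowMultiplier]
    -- Inside the ball the difference is (1 - P)e^{tE}; outside it is all of e^{tE}, damped at the
    -- rate `c₂`.
    split_ifs with hξ
    · have h1 := norm_complement_exp_le hA hδ0 hδ (hPP ξ hξ) (hcomm ξ hξ) (hPhalf ξ hξ) ht
      rw [sub_mul, one_mul] at h1
      refine h1.trans ?_
      gcongr
      rw [hC]
      nlinarith [mul_nonneg (sq_nonneg L) hC₀.le]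
    · rw [sub_zero]
      refine (hdec ξ t ht).trans ?_
      gcongr
      · rw [hC]
        nlinarith [mul_nonneg (sq_nonneg L) hC₀.le]
      · refine hcc₂.trans ?_
        rw [hc₂]
        refine mul_le_mul_of_nonneg_left ?_ hc₀.le
        rw [div_le_div_iff₀ (by positivity) (by positivity)]
        have : a ^ 2 ≤ ‖ξ‖ ^ 2 := by
          have := (not_le.1 hξ).le
          gcongr
        nlinarith

end SpectralBounds

/-! ### Hermitian symmetry and measurability of the low-frequency symbol -/

section Multiplier

open scoped Matrix.Norms.L2Operator

variable {m n₁ n₂ : ℕ}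

/-- Entrywise complex conjugation. -/
def conjMat (M : CMat n₁ n₂) : CMat n₁ n₂ := M.map (starRingEnd ℂ)

/-- The coefficients are real. This symmetry passes to exponentials and projectors and is the
condition for a multiplier to preserve real functions. -/
lemma symbol_neg (A : Fin m → Mat n₁ n₂) (B : Mat n₁ n₂) (ξ : Space m) :
    symbol A B (-ξ) = conjMat (symbol A B ξ) := by
  have : fluxMat A (-ξ) = -fluxMat A ξ := by simp [fluxMat]
  ext i j
  simp [symbol, conjMat, this, toC]

lemma conjMat_mul (M N : CMat n₁ n₂) : conjMat (M * N) = conjMat M * conjMat N :=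
  Matrix.map_mul

lemma conjMat_exp (M : CMat n₁ n₂) :
    conjMat (NormedSpace.exp M) = NormedSpace.exp (conjMat M) := by
  let _ : NormedAlgebra ℚ (CMat n₁ n₂) := NormedAlgebra.restrictScalars ℚ ℂ _
  refine NormedSpace.map_exp (RingHom.mapMatrix (starRingEnd ℂ) : CMat n₁ n₂ →+* CMat n₁ n₂) ?_ M
  refine continuous_matrix fun i j => ?_
  simp only [RingHom.mapMatrix_apply, Matrix.map_apply]
  exact Complex.continuous_conj.comp (continuous_id.matrix_elem i j)

lemma conjMat_exp_symbol (A : Fin m → Mat n₁ n₂) (B : Mat n₁ n₂) (t : ℝ) (ξ : Space m) :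
    NormedSpace.exp ((t : ℂ) • symbol A B (-ξ)) =
      conjMat (NormedSpace.exp ((t : ℂ) • symbol A B ξ)) := by
  rw [conjMat_exp, symbol_neg]
  congr 1
  ext i j
  simp [conjMat]

lemma lowMultiplier_neg (A : Fin m → Mat n₁ n₂) (B : Mat n₁ n₂) (r a t : ℝ) (ξ : Space m) :
    lowMultiplier A B r a t (-ξ) = conjMat (lowMultiplier A B r a t ξ) := by
  rw [lowMultiplier, lowMultiplier, norm_neg]
  split_ifs
  · rw [conjMat_mul, conjMat_exp_symbol, symbol_neg]
    congr 1
    exact totalProj_map_conj r _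
  · ext
    simp [conjMat]

lemma aestronglyMeasurable_lowMultiplier {A : Fin m → Mat n₁ n₂} {B : Mat n₁ n₂} {r a : ℝ}
    (h : ContinuousOn (fun ξ => totalProj r (symbol A B ξ)) (Metric.closedBall 0 a)) (t : ℝ) :
    AEStronglyMeasurable (fun η : Space m => lowMultiplier A B r a t ((2 * Real.pi) • η))
      volume := by
  have h1 : ContinuousOn (fun ξ => totalProj r (symbol A B ξ) *
      NormedSpace.exp ((t : ℂ) • symbol A B ξ)) (Metric.closedBall 0 a) :=
    h.mul (continuous_exp_smul continuous_const (continuous_symbol A B)).continuousOn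
  have hc : Continuous fun η : Space m => (2 * Real.pi) • η := by fun_prop
  have h2 := h1.comp (s := (fun η : Space m => (2 * Real.pi) • η) ⁻¹' Metric.closedBall 0 a)
    hc.continuousOn (fun η hη => hη)
  have h3 : (fun η : Space m => lowMultiplier A B r a t ((2 * Real.pi) • η)) =
      ((fun η : Space m => (2 * Real.pi) • η) ⁻¹' Metric.closedBall 0 a).indicator
      ((fun ξ => totalProj r (symbol A B ξ) * NormedSpace.exp ((t : ℂ) • symbol A B ξ)) ∘
        fun η : Space m => (2 * Real.pi) • η) := by
    ext1 η
    rw [lowMultiplier, indicator]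
    simp only [mem_preimage, Metric.mem_closedBall, dist_zero_right, Function.comp]
  have hs : MeasurableSet ((fun η : Space m => (2 * Real.pi) • η) ⁻¹' Metric.closedBall 0 a) :=
    (Metric.isClosed_closedBall.preimage hc).measurableSet
  rw [h3, aestronglyMeasurable_indicator_iff hs]
  exact h2.aestronglyMeasurable hs

end Multiplier

/-! ### Density of compactly supported functions in the Schwartz space -/

section Density

open SchwartzMap

variable {X F : Type*} [NormedAddCommGroup X] [InnerProductSpace ℝ X] [FiniteDimensional ℝ X]
  [NormedAddCommGroup F] [NormedSpace ℝ F]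

/-- Each derivative of the dilated cutoff brings down R⁻¹ ≤ 1. Order zero is separate because χ - 1
has no compact support; there 0 ≤ χ ≤ 1 suffices. -/
lemma exists_bound_iteratedFDeriv_cutoff (χ : ContDiffBump (0 : X)) (i : ℕ) :
    ∃ K : ℝ, 0 ≤ K ∧ ∀ R : ℝ, 1 ≤ R → ∀ x : X,
      ‖iteratedFDeriv ℝ i (fun y : X => χ (R⁻¹ • y) - 1) x‖ ≤ K := by
  have hχ : ContDiff ℝ ∞ (fun y : X => χ y - 1) := χ.contDiff.sub contDiff_const
  have hcont : Continuous (iteratedFDeriv ℝ i χ) :=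
    (χ.contDiff (n := i)).continuous_iteratedFDeriv'
  obtain ⟨K₁, hK₁⟩ := hcont.bounded_above_of_compact_support (χ.hasCompactSupport.iteratedFDeriv i)
  obtain ⟨K, hK⟩ : ∃ K, ∀ x : X, ‖iteratedFDeriv ℝ i (fun y : X => χ y - 1) x‖ ≤ K := by
    rcases Nat.eq_zero_or_pos i with rfl | hi
    · refine ⟨1, fun x => ?_⟩
      rw [norm_iteratedFDeriv_zero, Real.norm_eq_abs, abs_le]
      constructor <;> linarith [χ.nonneg (x := x), χ.le_one (x := x)]
    · refine ⟨K₁, fun x => ?_⟩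
      have : iteratedFDeriv ℝ i (fun y : X => χ y - 1) x = iteratedFDeriv ℝ i χ x := by
        have h := iteratedFDeriv_sub_apply (𝕜 := ℝ) (i := i) (x := x) (f := χ)
          (g := fun _ : X => (1 : ℝ)) χ.contDiff.contDiffAt contDiff_const.contDiffAt
        rw [iteratedFDeriv_const_of_ne hi.ne', Pi.zero_apply, sub_zero] at h
        exact h
      rw [this]
      exact hK₁ x
  refine ⟨max K 0, le_max_right _ _, fun R hR x => ?_⟩
  have h1 := iteratedFDeriv_comp_const_smul (𝕜 := ℝ) (i := i) (f := fun y : X => χ y - 1) R⁻¹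
    (hχ.of_le (mod_cast le_top))
  have h2 : iteratedFDeriv ℝ i (fun y : X => χ (R⁻¹ • y) - 1) x =
      R⁻¹ ^ i • iteratedFDeriv ℝ i (fun y : X => χ y - 1) (R⁻¹ • x) := by
    exact congrFun h1 x
  rw [h2, norm_smul, norm_pow, norm_inv, Real.norm_of_nonneg (by linarith)]
  have h3 : R⁻¹ ^ i ≤ 1 := pow_le_one₀ (by positivity) (inv_le_one_of_one_le₀ hR)
  calc _ ≤ 1 * max K 0 := by
        gcongr
        exact (hK _).trans (le_max_left _ _)
    _ = _ := one_mul _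

/-- Smooth compactly supported functions are dense in the Schwartz space. -/
theorem dense_hasCompactSupport : Dense {f : 𝓢(X, F) | HasCompactSupport f} := by
  intro f
  let χ : ContDiffBump (0 : X) := ⟨1, 2, one_pos, one_lt_two⟩
  have hsupp : ∀ n : ℕ, HasCompactSupport (fun x : X => χ ((n + 1 : ℝ)⁻¹ • x) • f x) := by
    intro n
    have h0 : (n + 1 : ℝ)⁻¹ ≠ 0 := by positivity
    exact (χ.hasCompactSupport.comp_homeomorph (Homeomorph.smulOfNeZero _ h0)).smul_right
  have hsmooth : ∀ n : ℕ, ContDiff ℝ ∞ (fun x : X => χ ((n + 1 : ℝ)⁻¹ • x) • f x) := by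
    intro n
    exact (χ.contDiff.comp (contDiff_const_smul _)).smul (f.smooth ⊤)
  refine mem_closure_of_tendsto (f := fun n : ℕ => (hsupp n).toSchwartzMap (hsmooth n))
    (b := atTop) ?_ (Eventually.of_forall fun n => hsupp n)
  rw [(schwartz_withSeminorms ℝ X F).tendsto_nhds_atTop]
  rintro ⟨k, n⟩ ε hε
  choose K hK0 hK using exists_bound_iteratedFDeriv_cutoff χ
  set S : ℝ := ∑ i ∈ Finset.range (n + 1),
    (n.choose i : ℝ) * K i * SchwartzMap.seminorm ℝ (k + 1) (n - i) f with hS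
  have hS0 : 0 ≤ S := Finset.sum_nonneg fun i _ => by
    have := hK0 i
    positivity
  obtain ⟨N, hN⟩ := exists_nat_gt (S / ε)
  refine ⟨N, fun j hj => ?_⟩
  set R : ℝ := (j : ℝ) + 1 with hR
  have hR1 : 1 ≤ R := by rw [hR]; linarith [Nat.cast_nonneg (α := ℝ) j]
  -- The error (χ(x/R) - 1)f vanishes near every x with |x| < R. Elsewhere 1 ≤ |x|/R, so one more
  -- power of the weight can be spent to gain R⁻¹.
  have hbound : SchwartzMap.seminorm ℝ k n ((hsupp j).toSchwartzMap (hsmooth j) - f) ≤ R⁻¹ * S := by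
    refine SchwartzMap.seminorm_le_bound ℝ k n _ (by positivity) fun x => ?_
    have hfun : ⇑((hsupp j).toSchwartzMap (hsmooth j) - f) =
        fun x => (χ (R⁻¹ • x) - 1) • f x := by
      ext y
      simp [sub_smul, hR]
    rw [hfun]
    have hg : ContDiff ℝ ∞ (fun y : X => χ (R⁻¹ • y) - 1) :=
      (χ.contDiff.comp (contDiff_const_smul _)).sub contDiff_const
    have h1 := norm_iteratedFDeriv_smul_le (n := n) hg (f.smooth ⊤) x (mod_cast le_top)
    calc _ ≤ ‖x‖ ^ k * ∑ i ∈ Finset.range (n + 1), (n.choose i : ℝ) *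
          ‖iteratedFDeriv ℝ i (fun y : X => χ (R⁻¹ • y) - 1) x‖ *
            ‖iteratedFDeriv ℝ (n - i) f x‖ := by gcongr
      _ ≤ R⁻¹ * S := by
        rw [Finset.mul_sum, hS, Finset.mul_sum]
        refine Finset.sum_le_sum fun i _ => ?_
        have hKi := hK0 i
        by_cases hx : ‖x‖ < R
        · have hz : (fun y : X => χ (R⁻¹ • y) - 1) =ᶠ[nhds x] fun _ => (0 : ℝ) := by
            have : {y : X | ‖y‖ < R} ∈ nhds x := (isOpen_lt continuous_norm continuous_const).mem_nhds hx
            filter_upwards [this] with y hy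
            have : χ (R⁻¹ • y) = 1 := by
              refine χ.one_of_mem_closedBall ?_
              simp only [Metric.mem_closedBall, dist_zero_right, norm_smul, norm_inv,
                Real.norm_of_nonneg (zero_le_one.trans hR1)]
              change R⁻¹ * ‖y‖ ≤ 1
              rw [inv_mul_eq_div, div_le_one (by positivity)]
              exact le_of_lt hy
            rw [this, sub_self]
          have hz' : iteratedFDeriv ℝ i (fun y : X => χ (R⁻¹ • y) - 1) x = 0 := by
            rw [(hz.iteratedFDeriv ℝ i).eq_of_nhds]
            exact congrFun iteratedFDeriv_fun_zero x
          rw [hz', norm_zero, mul_zero, zero_mul, mul_zero]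
          positivity
        · have hx' : 1 ≤ R⁻¹ * ‖x‖ := by
            rw [inv_mul_eq_div, one_le_div (by positivity)]
            exact not_lt.1 hx
          have h2 := SchwartzMap.le_seminorm ℝ (k + 1) (n - i) f x
          calc _ ≤ ‖x‖ ^ k * ((n.choose i : ℝ) * K i * ‖iteratedFDeriv ℝ (n - i) f x‖) := by
                gcongr
                exact hK i R hR1 x
            _ ≤ (R⁻¹ * ‖x‖) * (‖x‖ ^ k *
                  ((n.choose i : ℝ) * K i * ‖iteratedFDeriv ℝ (n - i) f x‖)) :=
                le_mul_of_one_le_left (by positivity) hx'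
            _ = R⁻¹ * ((n.choose i : ℝ) * K i *
                  (‖x‖ ^ (k + 1) * ‖iteratedFDeriv ℝ (n - i) f x‖)) := by ring
            _ ≤ _ := by gcongr
  refine lt_of_le_of_lt hbound ?_
  rw [inv_mul_eq_div, div_lt_iff₀ (by positivity)]
  rw [div_lt_iff₀ hε] at hN
  have : (N : ℝ) ≤ R := by
    rw [hR]
    have : (N : ℝ) ≤ j := by exact_mod_cast hj
    linarith
  nlinarith

end Density

/-! ### Real test functions as complex Schwartz functions -/

section TestFunction

open SchwartzMap

variable {X : Type*} [NormedAddCommGroup X] [InnerProductSpace ℝ X]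

/-- A real test function as a complex Schwartz function. -/
def testToSchwartz {φ : X → ℝ} (h₁ : ContDiff ℝ ∞ φ) (h₂ : HasCompactSupport φ) : 𝓢(X, ℂ) :=
  HasCompactSupport.toSchwartzMap (f := fun x => (φ x : ℂ))
    (h₂.comp_left (g := fun y : ℝ => (y : ℂ)) Complex.ofReal_zero)
    (Complex.ofRealCLM.contDiff.comp h₁)

lemma testToSchwartz_apply {φ : X → ℝ} (h₁ : ContDiff ℝ ∞ φ) (h₂ : HasCompactSupport φ) (x : X) :
    testToSchwartz h₁ h₂ x = (φ x : ℂ) := rfl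

end TestFunction

/-! ### The Fourier transform on L² and its agreement with the integral on L¹ ∩ L² -/

section FourierL2

open SchwartzMap

variable {X F : Type*} [NormedAddCommGroup X] [InnerProductSpace ℝ X] [FiniteDimensional ℝ X]
  [MeasurableSpace X] [BorelSpace X]
  [NormedAddCommGroup F] [InnerProductSpace ℂ F]

lemma integrable_schwartz_smul (φ : 𝓢(X, ℂ)) (f : Lp F 2 (volume : Measure X)) :
    Integrable (fun x => φ x • f x) := by
  rw [← memLp_one_iff_integrable]
  exact (Lp.memLp f).smul (φ.memLp 2 volume)

variable [CompleteSpace F]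

lemma integral_fourier_smul_Lp (φ : 𝓢(X, ℂ)) (f : Lp F 2 (volume : Measure X)) :
    ∫ x, (𝓕 φ) x • f x = ∫ x, φ x • (𝓕 f : Lp F 2 (volume : Measure X)) x := by
  have h := congrArg (fun T : 𝓢'(X, F) => T φ) (Lp.fourier_toTemperedDistribution_eq f)
  simpa using h

lemma integral_fourierInv_smul_Lp (φ : 𝓢(X, ℂ)) (f : Lp F 2 (volume : Measure X)) :
    ∫ x, (𝓕⁻ φ) x • f x = ∫ x, φ x • (𝓕⁻ f : Lp F 2 (volume : Measure X)) x := by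
  have h := congrArg (fun T : 𝓢'(X, F) => T φ) (Lp.fourierInv_toTemperedDistribution_eq f)
  simpa using h

lemma ae_eq_of_integral_schwartz_smul_eq {f g : X → F} (hf : LocallyIntegrable f volume)
    (hg : LocallyIntegrable g volume)
    (h : ∀ φ : 𝓢(X, ℂ), ∫ x, φ x • f x = ∫ x, φ x • g x) : f =ᵐ[volume] g := by
  refine ae_eq_of_integral_contDiff_smul_eq hf hg fun φ h₁ h₂ => ?_
  have := h (testToSchwartz h₁ h₂)
  simpa only [testToSchwartz_apply, Complex.coe_smul] using this

lemma Lp_locallyIntegrable {F : Type*} [NormedAddCommGroup F] (f : Lp F 2 (volume : Measure X)) :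
    LocallyIntegrable f volume :=
  (Lp.memLp f).locallyIntegrable (by norm_num)

/-- The `L²` Fourier transform of an integrable function is given by the integral. -/
theorem Lp_fourier_ae_eq (f : Lp F 2 (volume : Measure X)) (hf : Integrable f volume) :
    (𝓕 f : Lp F 2 (volume : Measure X)) =ᵐ[volume] 𝓕 (f : X → F) := by
  have hcont : Continuous (𝓕 (f : X → F)) :=
    VectorFourier.fourierIntegral_continuous Real.continuous_fourierChar
      (by exact continuous_inner) hf
  refine ae_eq_of_integral_schwartz_smul_eq (Lp_locallyIntegrable _)
    hcont.locallyIntegrable fun φ => ?_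
  rw [← integral_fourier_smul_Lp]
  have := VectorFourier.integral_fourierIntegral_smul_eq_flip (L := innerₗ X) (μ := volume)
    (ν := volume) Real.continuous_fourierChar (by exact continuous_inner) φ.integrable hf
  rw [flip_innerₗ] at this
  exact this

lemma integral_fourierInv_smul_eq {φ : X → ℂ} {f : X → F} (hφ : Integrable φ volume)
    (hf : Integrable f volume) : ∫ x, (𝓕⁻ φ) x • f x = ∫ x, φ x • (𝓕⁻ f) x := by
  -- The pairing with the opposite sign turns the general duality formula into the one for the
  -- inverse transform.
  have := VectorFourier.integral_fourierIntegral_smul_eq_flip (L := -innerₗ X) (μ := volume)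
    (ν := volume) Real.continuous_fourierChar (by exact continuous_inner.neg) hφ hf
  have hflip : (-innerₗ X).flip = -innerₗ X := by
    ext x y
    simp [real_inner_comm]
  rw [hflip] at this
  exact this

/-- The inverse `L²` Fourier transform of an integrable function is given by the integral. -/
theorem Lp_fourierInv_ae_eq (f : Lp F 2 (volume : Measure X)) (hf : Integrable f volume) :
    (𝓕⁻ f : Lp F 2 (volume : Measure X)) =ᵐ[volume] 𝓕⁻ (f : X → F) := by
  have hcont : Continuous (𝓕⁻ (f : X → F)) :=
    VectorFourier.fourierIntegral_continuous Real.continuous_fourierChar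
      (by exact continuous_inner.neg) hf
  refine ae_eq_of_integral_schwartz_smul_eq (Lp_locallyIntegrable _)
    hcont.locallyIntegrable fun φ => ?_
  rw [← integral_fourierInv_smul_Lp, fourierInv_coe]
  exact integral_fourierInv_smul_eq φ.integrable hf

end FourierL2

/-! ### Weak derivatives in L² as Fourier multipliers -/

section WeakDerivative

open SchwartzMap LineDeriv

variable {m : ℕ}

section Smooth

variable {F G : Type*} [NormedAddCommGroup F] [NormedSpace ℝ F]
  [NormedAddCommGroup G] [NormedSpace ℝ G]

lemma contDiff_partialDeriv {f : Space m → F} (hf : ContDiff ℝ ∞ f) (α : Fin m) :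
    ContDiff ℝ ∞ (partialDeriv α f) :=
  (hf.fderiv_right (by norm_num)).clm_apply contDiff_const

lemma partialDeriv_clm_comp (L : F →L[ℝ] G) {f : Space m → F} (hf : ContDiff ℝ ∞ f)
    (α : Fin m) : partialDeriv α (fun x => L (f x)) = fun x => L (partialDeriv α f x) := by
  ext x
  have := L.hasFDerivAt.comp x ((hf.differentiable (by norm_num)) x).hasFDerivAt
  rw [partialDeriv, show (fun x => L (f x)) = L ∘ f from rfl, this.fderiv]
  rfl

lemma iterate_partialDeriv_clm_comp (L : F →L[ℝ] G) {f : Space m → F} (hf : ContDiff ℝ ∞ f)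
    (α : Fin m) (k : ℕ) : ContDiff ℝ ∞ ((partialDeriv α)^[k] f) ∧
      (partialDeriv α)^[k] (fun x => L (f x)) = fun x => L ((partialDeriv α)^[k] f x) := by
  induction k with
  | zero => exact ⟨hf, rfl⟩
  | succ k ih =>
    rw [Function.iterate_succ_apply', Function.iterate_succ_apply', ih.2]
    exact ⟨contDiff_partialDeriv ih.1 α, partialDeriv_clm_comp L ih.1 α⟩

lemma multiDeriv_clm_comp (L : F →L[ℝ] G) {f : Space m → F} (hf : ContDiff ℝ ∞ f)
    (β : Fin m → ℕ) : multiDeriv β (fun x => L (f x)) = fun x => L (multiDeriv β f x) := by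
  unfold multiDeriv
  have : ∀ l : List (Fin m),
      ContDiff ℝ ∞ (l.foldr (fun α g => (partialDeriv α)^[β α] g) f) ∧
      l.foldr (fun α g => (partialDeriv α)^[β α] g) (fun x => L (f x)) =
        fun x => L (l.foldr (fun α g => (partialDeriv α)^[β α] g) f x) := by
    intro l
    induction l with
    | nil => exact ⟨hf, rfl⟩
    | cons α l ih =>
      simp only [List.foldr_cons]
      rw [ih.2]
      exact iterate_partialDeriv_clm_comp L ih.1 α (β α)
  exact (this _).2

end Smooth

/-- The operator `D^β` on Schwartz functions. -/
def schwartzDeriv (β : Fin m → ℕ) : 𝓢(Space m, ℂ) →L[ℂ] 𝓢(Space m, ℂ) :=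
  ((List.finRange m).map fun α =>
    lineDerivOpCLM ℂ 𝓢(Space m, ℂ) (EuclideanSpace.single α (1 : ℝ)) ^ β α).prod

/-- The Fourier symbol of `D^β`. -/
def derivSymbol (β : Fin m → ℕ) (η : Space m) : ℂ :=
  ∏ α, (2 * Real.pi * Complex.I * (η α : ℂ)) ^ β α

lemma coe_schwartzDeriv (β : Fin m → ℕ) (φ : 𝓢(Space m, ℂ)) :
    ⇑(schwartzDeriv β φ) = multiDeriv β φ := by
  unfold schwartzDeriv multiDeriv
  have h1 : ∀ (α : Fin m) (k : ℕ) (ψ : 𝓢(Space m, ℂ)),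
      ⇑((lineDerivOpCLM ℂ 𝓢(Space m, ℂ) (EuclideanSpace.single α (1 : ℝ)) ^ k) ψ) =
        (partialDeriv α)^[k] ψ := by
    intro α k ψ
    induction k with
    | zero => rfl
    | succ k ih =>
      rw [pow_succ', ContinuousLinearMap.mul_def, ContinuousLinearMap.comp_apply, Function.iterate_succ_apply', ← ih]
      ext x
      rw [lineDerivOpCLM_apply, SchwartzMap.lineDerivOp_apply_eq_fderiv]
      rfl
  induction List.finRange m with
  | nil => rfl
  | cons α l ih =>
    rw [List.map_cons, List.prod_cons, ContinuousLinearMap.mul_def, ContinuousLinearMap.comp_apply, h1, ih]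
    rfl

lemma coe_schwartzDeriv_testToSchwartz (β : Fin m → ℕ) {φ : Space m → ℝ} (h₁ : ContDiff ℝ ∞ φ)
    (h₂ : HasCompactSupport φ) :
    ⇑(schwartzDeriv β (testToSchwartz h₁ h₂)) = fun x => ((multiDeriv β φ x : ℝ) : ℂ) := by
  rw [coe_schwartzDeriv]
  exact multiDeriv_clm_comp Complex.ofRealCLM h₁ β

lemma continuous_derivSymbol (β : Fin m → ℕ) : Continuous (derivSymbol β) := by
  refine continuous_finsetProd _ fun α _ => ?_
  fun_prop

lemma norm_derivSymbol_le (β : Fin m → ℕ) (η : Space m) :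
    ‖derivSymbol β η‖ ≤ ‖(2 * Real.pi) • η‖ ^ order β := by
  rw [derivSymbol, order, ← Finset.prod_pow_eq_pow_sum, norm_prod]
  refine Finset.prod_le_prod (fun _ _ => norm_nonneg _) fun α _ => ?_
  rw [norm_pow, norm_mul, norm_mul, norm_mul, Complex.norm_I, norm_smul, Complex.norm_real,
    Complex.norm_real, mul_one, Complex.norm_ofNat, norm_mul, Real.norm_ofNat]
  gcongr
  exact PiLp.norm_apply_le η α

/-- Under the inverse transform each ∂_α becomes -2πiη_α. The resulting (-1)^{|β|} is exactly the
sign in the definition of the weak derivative. -/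
lemma fourierInv_schwartzDeriv (β : Fin m → ℕ) (φ : 𝓢(Space m, ℂ)) (η : Space m) :
    (𝓕⁻ (schwartzDeriv β φ)) η = (-1) ^ order β * (derivSymbol β η * (𝓕⁻ φ) η) := by
  have h1 : ∀ (α : Fin m) (k : ℕ) (ψ : 𝓢(Space m, ℂ)),
      (𝓕⁻ ((lineDerivOpCLM ℂ 𝓢(Space m, ℂ) (EuclideanSpace.single α (1 : ℝ)) ^ k) ψ)) η =
        (-(2 * Real.pi * Complex.I * (η α : ℂ))) ^ k * (𝓕⁻ ψ) η := by
    intro α k ψ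
    induction k with
    | zero => simp
    | succ k ih =>
      have hg : (fun x : Space m => inner ℝ x (EuclideanSpace.single α (1 : ℝ))).HasTemperateGrowth :=
        by fun_prop
      rw [pow_succ', ContinuousLinearMap.mul_def, ContinuousLinearMap.comp_apply,
        lineDerivOpCLM_apply, fourierInv_lineDerivOp_eq, smul_apply,
        smulLeftCLM_apply_apply hg, ih, EuclideanSpace.inner_single_right]
      simp only [one_mul, conj_trivial, smul_eq_mul, Complex.real_smul]
      ring
  have h2 : ∀ l : List (Fin m), (𝓕⁻ ((l.map fun α =>
      lineDerivOpCLM ℂ 𝓢(Space m, ℂ) (EuclideanSpace.single α (1 : ℝ)) ^ β α).prod φ)) η =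
      (l.map fun α => (-(2 * Real.pi * Complex.I * (η α : ℂ))) ^ β α).prod * (𝓕⁻ φ) η := by
    intro l
    induction l with
    | nil => simp
    | cons α l ih =>
      rw [List.map_cons, List.prod_cons, ContinuousLinearMap.mul_def,
        ContinuousLinearMap.comp_apply, h1, ih, List.map_cons, List.prod_cons]
      exact (mul_assoc _ _ _).symm
  rw [schwartzDeriv, h2, ← Fin.prod_univ_def, derivSymbol, order, ← Finset.prod_pow_eq_pow_sum,
    ← mul_assoc, ← Finset.prod_mul_distrib]
  congr 1
  exact Finset.prod_congr rfl fun α _ => neg_pow _ _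

variable {F : Type*} [NormedAddCommGroup F] [InnerProductSpace ℂ F]

lemma locallyIntegrable_derivSymbol_smul (β : Fin m → ℕ)
    (f : Lp F 2 (volume : Measure (Space m))) :
    LocallyIntegrable (fun η => derivSymbol β η • f η) volume :=
  (Lp_locallyIntegrable f).continuous_smul (continuous_derivSymbol β)

/-- The identity for Schwartz functions gives the one for real test functions. -/
lemma integral_multiDeriv_of_schwartz {β : Fin m → ℕ}
    {f g : Lp F 2 (volume : Measure (Space m))}
    (h : ∀ φ : 𝓢(Space m, ℂ),
      ∫ x, schwartzDeriv β φ x • f x = (-1 : ℂ) ^ order β • ∫ x, φ x • g x)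
    {φ : Space m → ℝ} (h₁ : ContDiff ℝ ∞ φ) (h₂ : HasCompactSupport φ) :
      ∫ x, multiDeriv β φ x • f x = (-1 : ℝ) ^ order β • ∫ x, φ x • g x := by
  have := h (testToSchwartz h₁ h₂)
  rw [coe_schwartzDeriv_testToSchwartz] at this
  simp only [testToSchwartz_apply, Complex.coe_smul] at this
  rw [this, ← Complex.coe_smul]
  push_cast
  rfl

variable [CompleteSpace F]

lemma integral_schwartzDeriv_smul (β : Fin m → ℕ) (φ : 𝓢(Space m, ℂ))
    (f : Lp F 2 (volume : Measure (Space m))) :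
    ∫ x, schwartzDeriv β φ x • f x =
      (-1 : ℂ) ^ order β • ∫ η, (𝓕⁻ φ) η • derivSymbol β η •
        (𝓕 f : Lp F 2 (volume : Measure (Space m))) η := by
  have h := integral_fourierInv_smul_Lp (schwartzDeriv β φ) (𝓕 f)
  rw [FourierTransform.fourierInv_fourier_eq] at h
  rw [← h, ← integral_smul]
  refine integral_congr_ae (Eventually.of_forall fun η => ?_)
  simp only [fourierInv_schwartzDeriv, smul_smul]
  congr 1
  ring

/-- In `L²`, weak derivatives are Fourier multipliers: from the Fourier side to test functions. -/
lemma integral_schwartzDeriv_smul_of_fourier {β : Fin m → ℕ}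
    {f g : Lp F 2 (volume : Measure (Space m))}
    (h : (𝓕 g : Lp F 2 (volume : Measure (Space m))) =ᵐ[volume] fun η => derivSymbol β η •
        (𝓕 f : Lp F 2 (volume : Measure (Space m))) η) (φ : 𝓢(Space m, ℂ)) :
    ∫ x, schwartzDeriv β φ x • f x = (-1 : ℂ) ^ order β • ∫ x, φ x • g x := by
  rw [integral_schwartzDeriv_smul]
  congr 1
  have h2 := integral_fourierInv_smul_Lp φ (𝓕 g)
  rw [FourierTransform.fourierInv_fourier_eq] at h2
  rw [← h2]
  refine integral_congr_ae ?_
  filter_upwards [h] with η hη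
  rw [hη]

/-- In `L²`, weak derivatives are Fourier multipliers: from test functions to the Fourier side. -/
lemma fourier_ae_eq_of_integral_schwartzDeriv {β : Fin m → ℕ}
    {f g : Lp F 2 (volume : Measure (Space m))}
    (h : ∀ φ : 𝓢(Space m, ℂ),
      ∫ x, schwartzDeriv β φ x • f x = (-1 : ℂ) ^ order β • ∫ x, φ x • g x) :
    (𝓕 g : Lp F 2 (volume : Measure (Space m))) =ᵐ[volume] fun η => derivSymbol β η •
        (𝓕 f : Lp F 2 (volume : Measure (Space m))) η := by
  refine ae_eq_of_integral_schwartz_smul_eq (Lp_locallyIntegrable _)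
    (locallyIntegrable_derivSymbol_smul β _) fun ψ => ?_
  have h1 := h (𝓕 ψ)
  rw [integral_schwartzDeriv_smul, FourierTransform.fourierInv_fourier_eq] at h1
  rw [← integral_fourier_smul_Lp]
  exact (smul_right_injective F (pow_ne_zero _ (by norm_num : (-1 : ℂ) ≠ 0)) h1).symm

lemma continuous_integral_schwartz_smul (f : Lp F 2 (volume : Measure (Space m))) :
    Continuous fun φ : 𝓢(Space m, ℂ) => ∫ x, φ x • f x := by
  simp_rw [← Lp.toTemperedDistribution_apply]
  exact (Lp.toTemperedDistribution f).continuous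

/-- Real test functions suffice. -/
lemma integral_schwartzDeriv_of_real {β : Fin m → ℕ}
    {f g : Lp F 2 (volume : Measure (Space m))}
    (h : ∀ φ : Space m → ℝ, ContDiff ℝ ∞ φ → HasCompactSupport φ →
      ∫ x, multiDeriv β φ x • f x = (-1 : ℝ) ^ order β • ∫ x, φ x • g x)
    (φ : 𝓢(Space m, ℂ)) :
    ∫ x, schwartzDeriv β φ x • f x = (-1 : ℂ) ^ order β • ∫ x, φ x • g x := by
  have hreal : ∀ (ψ : Space m → ℝ) (h₁ : ContDiff ℝ ∞ ψ) (h₂ : HasCompactSupport ψ),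
      ∫ x, schwartzDeriv β (testToSchwartz h₁ h₂) x • f x =
        (-1 : ℂ) ^ order β • ∫ x, testToSchwartz h₁ h₂ x • g x := by
    intro ψ h₁ h₂
    rw [coe_schwartzDeriv_testToSchwartz]
    simp only [testToSchwartz_apply, Complex.coe_smul]
    rw [h ψ h₁ h₂, ← Complex.coe_smul]
    push_cast
    rfl
  -- Both sides are continuous in φ, so compact support may be assumed; real and imaginary parts are
  -- then admissible real test functions.
  refine dense_hasCompactSupport.induction (P := fun φ : 𝓢(Space m, ℂ) =>
    ∫ x, schwartzDeriv β φ x • f x = (-1 : ℂ) ^ order β • ∫ x, φ x • g x) ?_ ?_ φ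
  · intro φ hφ
    have h₁ : ContDiff ℝ ∞ fun x => (φ x).re := Complex.reCLM.contDiff.comp (φ.smooth ⊤)
    have h₂ : HasCompactSupport fun x => (φ x).re :=
      HasCompactSupport.comp_left (g := Complex.re) hφ Complex.zero_re
    have h₃ : ContDiff ℝ ∞ fun x => (φ x).im := Complex.imCLM.contDiff.comp (φ.smooth ⊤)
    have h₄ : HasCompactSupport fun x => (φ x).im :=
      HasCompactSupport.comp_left (g := Complex.im) hφ Complex.zero_im
    have hsplit : φ = testToSchwartz h₁ h₂ + Complex.I • testToSchwartz h₃ h₄ := by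
      ext x
      rw [add_apply, smul_apply, testToSchwartz_apply,
        testToSchwartz_apply, smul_eq_mul, mul_comm]
      exact (Complex.re_add_im _).symm
    rw [hsplit]
    have hadd : ∀ (ψ₁ ψ₂ : 𝓢(Space m, ℂ)) (k : Lp F 2 (volume : Measure (Space m))),
        ∫ x, (ψ₁ + Complex.I • ψ₂) x • k x =
          (∫ x, ψ₁ x • k x) + Complex.I • ∫ x, ψ₂ x • k x := by
      intro ψ₁ ψ₂ k
      have h5 : Integrable (fun x => Complex.I • ψ₂ x • k x) :=
        (integrable_schwartz_smul ψ₂ k).smul Complex.I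
      rw [← integral_smul, ← integral_add (integrable_schwartz_smul _ _) h5]
      simp only [add_apply, smul_apply, add_smul, smul_assoc]
    rw [map_add, map_smul, hadd, hadd, hreal, hreal, smul_add, smul_comm]
  · exact isClosed_eq ((continuous_integral_schwartz_smul f).comp (schwartzDeriv β).continuous)
      ((continuous_integral_schwartz_smul g).const_smul _)

end WeakDerivative

/-! ### Passage between real and complex states -/

section RealImaginary

variable {m n₁ n₂ : ℕ}

/-- Complexification of states as a continuous linear map. -/
def complexify (n₁ n₂ : ℕ) : State n₁ n₂ →L[ℝ] CState n₁ n₂ :=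
  LinearMap.toContinuousLinearMap
    { toFun := vecToC
      map_add' := fun u v => by ext i; simp [vecToC]
      map_smul' := fun c v => by ext i; simp [vecToC] }

/-- The real part of a complex state. -/
def realPart (n₁ n₂ : ℕ) : CState n₁ n₂ →L[ℝ] State n₁ n₂ :=
  LinearMap.toContinuousLinearMap
    { toFun := fun v => WithLp.toLp 2 fun i => (v i).re
      map_add' := fun u v => by ext i; simp
      map_smul' := fun c v => by ext i; simp }

lemma complexify_apply (v : State n₁ n₂) : complexify n₁ n₂ v = vecToC v := rfl

lemma realPart_apply (v : CState n₁ n₂) (i : Fin n₁ ⊕ Fin n₂) :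
    realPart n₁ n₂ v i = (v i).re := rfl

lemma realPart_complexify (v : State n₁ n₂) : realPart n₁ n₂ (complexify n₁ n₂ v) = v := by
  ext i
  rw [realPart_apply]
  exact Complex.ofReal_re _

lemma norm_vecToC (v : State n₁ n₂) : ‖vecToC v‖ = ‖v‖ := by
  simp [EuclideanSpace.norm_eq, vecToC]

lemma norm_realPart_le (v : CState n₁ n₂) : ‖realPart n₁ n₂ v‖ ≤ ‖v‖ := by
  rw [EuclideanSpace.norm_eq, EuclideanSpace.norm_eq]
  refine Real.sqrt_le_sqrt (Finset.sum_le_sum fun i _ => ?_)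
  rw [realPart_apply]
  gcongr
  exact Complex.abs_re_le_norm _

lemma inner_realPart_left (u : CState n₁ n₂) (v : State n₁ n₂) :
    ⟪realPart n₁ n₂ u, v⟫_ℝ = (inner ℂ u (vecToC v)).re := by
  simp [PiLp.inner_apply, realPart_apply, vecToC]

/-- Square integrable functions with values in `ℂ^{n₁ + n₂}`. -/
abbrev CL2 (m n₁ n₂ : ℕ) : Type := Lp (CState n₁ n₂) 2 (volume : Measure (Space m))

/-- Complexification `L²(ℝ^m, ℝ^n) → L²(ℝ^m, ℂ^n)`. -/
def complexifyL2 (m n₁ n₂ : ℕ) : L2 m n₁ n₂ →L[ℝ] CL2 m n₁ n₂ :=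
  (complexify n₁ n₂).compLpL 2 volume

/-- Real part `L²(ℝ^m, ℂ^n) → L²(ℝ^m, ℝ^n)`. -/
def realPartL2 (m n₁ n₂ : ℕ) : CL2 m n₁ n₂ →L[ℝ] L2 m n₁ n₂ :=
  (realPart n₁ n₂).compLpL 2 volume

lemma coeFn_complexifyL2 (w : L2 m n₁ n₂) :
    complexifyL2 m n₁ n₂ w =ᵐ[volume] fun x => vecToC (w x) :=
  (complexify n₁ n₂).coeFn_compLpL w

lemma coeFn_realPartL2 (f : CL2 m n₁ n₂) :
    realPartL2 m n₁ n₂ f =ᵐ[volume] fun x => realPart n₁ n₂ (f x) :=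
  (realPart n₁ n₂).coeFn_compLpL f

lemma realPartL2_complexifyL2 (w : L2 m n₁ n₂) :
    realPartL2 m n₁ n₂ (complexifyL2 m n₁ n₂ w) = w := by
  ext1
  filter_upwards [coeFn_realPartL2 (complexifyL2 m n₁ n₂ w), coeFn_complexifyL2 w] with x h1 h2
  rw [h1, h2]
  exact realPart_complexify _

lemma norm_complexifyL2 (w : L2 m n₁ n₂) : ‖complexifyL2 m n₁ n₂ w‖ = ‖w‖ := by
  rw [Lp.norm_def, Lp.norm_def]
  congr 1
  refine eLpNorm_congr_norm_ae ?_
  filter_upwards [coeFn_complexifyL2 w] with x h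
  rw [h, norm_vecToC]

lemma norm_realPartL2_le (f : CL2 m n₁ n₂) : ‖realPartL2 m n₁ n₂ f‖ ≤ ‖f‖ := by
  refine Lp.norm_le_norm_of_ae_le ?_
  filter_upwards [coeFn_realPartL2 f] with x h
  rw [h]
  exact norm_realPart_le _

end RealImaginary

/-! ### Matrix-valued Fourier multipliers on L² -/

section Multiplier

open scoped Matrix.Norms.L2Operator

variable {m n₁ n₂ : ℕ}

/-- Measurable bounded matrix symbols. -/
def IsMultiplier (σ : Space m → CMat n₁ n₂) : Prop :=
  AEStronglyMeasurable σ volume ∧ ∃ M : ℝ, ∀ η, ‖σ η‖ ≤ M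

lemma aestronglyMeasurable_cact {σ : Space m → CMat n₁ n₂} {f : Space m → CState n₁ n₂}
    (hσ : AEStronglyMeasurable σ volume) (hf : AEStronglyMeasurable f volume) :
    AEStronglyMeasurable (fun η => cact (σ η) (f η)) volume :=
  (continuous_cact continuous_fst continuous_snd).comp_aestronglyMeasurable
    (hσ.prodMk hf)

lemma memLp_cact {σ : Space m → CMat n₁ n₂} (hσ : IsMultiplier σ) (f : CL2 m n₁ n₂) :
    MemLp (fun η => cact (σ η) (f η)) 2 volume := by
  obtain ⟨hm, M, hM⟩ := hσ
  refine MemLp.of_le_mul (Lp.memLp f) (aestronglyMeasurable_cact hm (Lp.aestronglyMeasurable f))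
    (c := M) (Eventually.of_forall fun η => ?_)
  exact (norm_cact_le _ _).trans (by gcongr; exact hM η)

open Classical in
/-- Multiplication by a bounded symbol. -/
def mulSymbol (σ : Space m → CMat n₁ n₂) : CL2 m n₁ n₂ →L[ℂ] CL2 m n₁ n₂ :=
  -- The default value 0 for inadmissible symbols keeps the operator defined for every function σ.
  if h : IsMultiplier σ then
    LinearMap.mkContinuousOfExistsBound
      { toFun := fun f => (memLp_cact h f).toLp
        map_add' := fun f g => by
          rw [← MemLp.toLp_add]
          refine MemLp.toLp_congr _ _ ?_
          filter_upwards [Lp.coeFn_add f g] with η hη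
          rw [hη, Pi.add_apply, cact_vadd, Pi.add_apply]
        map_smul' := fun c f => by
          rw [RingHom.id_apply, ← MemLp.toLp_const_smul]
          refine MemLp.toLp_congr _ _ ?_
          filter_upwards [Lp.coeFn_smul c f] with η hη
          rw [hη, Pi.smul_apply, cact_vsmul, Pi.smul_apply] }
      ⟨h.2.choose, fun f => by
        refine Lp.norm_le_mul_norm_of_ae_le_mul ?_
        filter_upwards [(memLp_cact h f).coeFn_toLp] with η hη
        simp only [LinearMap.coe_mk, AddHom.coe_mk]
        rw [hη]
        exact (norm_cact_le _ _).trans (by gcongr; exact h.2.choose_spec η)⟩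
  else 0

lemma coeFn_mulSymbol {σ : Space m → CMat n₁ n₂} (hσ : IsMultiplier σ) (f : CL2 m n₁ n₂) :
    mulSymbol σ f =ᵐ[volume] fun η => cact (σ η) (f η) := by
  rw [mulSymbol, dif_pos hσ]
  exact (memLp_cact hσ f).coeFn_toLp

lemma norm_mulSymbol_le {σ : Space m → CMat n₁ n₂} (hσ : IsMultiplier σ) {M : ℝ}
    (hM : ∀ η, ‖σ η‖ ≤ M) (f : CL2 m n₁ n₂) : ‖mulSymbol σ f‖ ≤ M * ‖f‖ := by
  refine Lp.norm_le_mul_norm_of_ae_le_mul ?_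
  filter_upwards [coeFn_mulSymbol hσ f] with η hη
  rw [hη]
  exact (norm_cact_le _ _).trans (by gcongr; exact hM η)

lemma IsMultiplier.add {σ τ : Space m → CMat n₁ n₂} (hσ : IsMultiplier σ) (hτ : IsMultiplier τ) :
    IsMultiplier fun η => σ η + τ η := by
  obtain ⟨h1, M, hM⟩ := hσ
  obtain ⟨h2, N, hN⟩ := hτ
  exact ⟨h1.add h2, M + N, fun η => (norm_add_le _ _).trans (add_le_add (hM η) (hN η))⟩

lemma IsMultiplier.sub {σ τ : Space m → CMat n₁ n₂} (hσ : IsMultiplier σ) (hτ : IsMultiplier τ) :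
    IsMultiplier fun η => σ η - τ η := by
  obtain ⟨h1, M, hM⟩ := hσ
  obtain ⟨h2, N, hN⟩ := hτ
  exact ⟨h1.sub h2, M + N, fun η => (norm_sub_le _ _).trans (add_le_add (hM η) (hN η))⟩

/-- The complex Fourier multiplier with symbol `σ`, applied to a real function. -/
def complexMultiplier (σ : Space m → CMat n₁ n₂) (w : L2 m n₁ n₂) : CL2 m n₁ n₂ :=
  𝓕⁻ (mulSymbol σ (𝓕 (complexifyL2 m n₁ n₂ w)))

lemma fourier_complexMultiplier (σ : Space m → CMat n₁ n₂) (w : L2 m n₁ n₂) :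
    𝓕 (complexMultiplier σ w) = mulSymbol σ (𝓕 (complexifyL2 m n₁ n₂ w)) :=
  FourierTransform.fourier_fourierInv_eq _

/-- The real Fourier multiplier with symbol `σ`: the real part of the complex one. -/
def fourierMultiplier (σ : Space m → CMat n₁ n₂) : L2 m n₁ n₂ →L[ℝ] L2 m n₁ n₂ :=
  realPartL2 m n₁ n₂ ∘L
    (FourierTransform.fourierInvCLM ℂ (CL2 m n₁ n₂)).restrictScalars ℝ ∘L
    (mulSymbol σ).restrictScalars ℝ ∘L
    (FourierTransform.fourierCLM ℂ (CL2 m n₁ n₂)).restrictScalars ℝ ∘L complexifyL2 m n₁ n₂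

lemma fourierMultiplier_apply (σ : Space m → CMat n₁ n₂) (w : L2 m n₁ n₂) :
    fourierMultiplier σ w = realPartL2 m n₁ n₂ (complexMultiplier σ w) := rfl

lemma fourierMultiplier_add {σ τ : Space m → CMat n₁ n₂} (hσ : IsMultiplier σ)
    (hτ : IsMultiplier τ) :
    fourierMultiplier (fun η => σ η + τ η) = fourierMultiplier σ + fourierMultiplier τ := by
  ext1 w
  have h : mulSymbol (fun η => σ η + τ η) = mulSymbol σ + mulSymbol τ := by
    ext1 f
    refine Lp.ext ?_
    rw [add_apply]
    filter_upwards [coeFn_mulSymbol (hσ.add hτ) f, coeFn_mulSymbol hσ f, coeFn_mulSymbol hτ f,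
      Lp.coeFn_add (mulSymbol σ f) (mulSymbol τ f)] with η h1 h2 h3 h4
    rw [h1, h4, Pi.add_apply, h2, h3, cact_add]
  rw [add_apply, fourierMultiplier_apply, fourierMultiplier_apply,
    fourierMultiplier_apply, complexMultiplier, h, add_apply,
    FourierTransform.fourierInv_add, map_add]
  rfl

lemma norm_complexMultiplier_le {σ : Space m → CMat n₁ n₂} (hσ : IsMultiplier σ) {M : ℝ}
    (hM : ∀ η, ‖σ η‖ ≤ M) (w : L2 m n₁ n₂) : ‖complexMultiplier σ w‖ ≤ M * ‖w‖ := by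
  rw [← Lp.norm_fourier_eq, fourier_complexMultiplier]
  refine (norm_mulSymbol_le hσ hM _).trans ?_
  rw [Lp.norm_fourier_eq, norm_complexifyL2]

lemma norm_fourierMultiplier_le {σ : Space m → CMat n₁ n₂} (hσ : IsMultiplier σ) {M : ℝ}
    (hM : ∀ η, ‖σ η‖ ≤ M) (w : L2 m n₁ n₂) : ‖fourierMultiplier σ w‖ ≤ M * ‖w‖ :=
  (norm_realPartL2_le _).trans (norm_complexMultiplier_le hσ hM w)

end Multiplier

/-! ### Weak derivatives of real functions on the Fourier side -/

section WeakDerivative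

variable {m n₁ n₂ : ℕ}

lemma integrable_smul_of_memLp {F : Type*} [NormedAddCommGroup F] [NormedSpace ℝ F]
    {φ : Space m → ℝ} (h₁ : Continuous φ)
    (h₂ : HasCompactSupport φ) {f : Space m → F} (hf : LocallyIntegrable f volume) :
    Integrable (fun x => φ x • f x) :=
  hf.integrable_smul_left_of_hasCompactSupport h₁ h₂

lemma hasCompactSupport_partialDeriv {F : Type*} [NormedAddCommGroup F] [NormedSpace ℝ F]
    {φ : Space m → F} (h : HasCompactSupport φ) (α : Fin m) :
    HasCompactSupport (partialDeriv α φ) :=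
  h.fderiv_apply (𝕜 := ℝ) _

lemma contDiff_hasCompactSupport_multiDeriv {F : Type*} [NormedAddCommGroup F] [NormedSpace ℝ F]
    {φ : Space m → F} (h₁ : ContDiff ℝ ∞ φ) (h₂ : HasCompactSupport φ) (β : Fin m → ℕ) :
    ContDiff ℝ ∞ (multiDeriv β φ) ∧ HasCompactSupport (multiDeriv β φ) := by
  unfold multiDeriv
  induction List.finRange m with
  | nil => exact ⟨h₁, h₂⟩
  | cons α l ih =>
    rw [List.foldr_cons]
    induction β α with
    | zero => exact ih
    | succ k ihk =>
      rw [Function.iterate_succ_apply']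
      exact ⟨contDiff_partialDeriv ihk.1 α, hasCompactSupport_partialDeriv ihk.2 α⟩

/-- Real parts of functions related by the Fourier symbol of `D^β`. -/
lemma hasWeakDeriv_realPartL2 {β : Fin m → ℕ} {f g : CL2 m n₁ n₂}
    (h : (𝓕 g : CL2 m n₁ n₂) =ᵐ[volume] fun η => derivSymbol β η • (𝓕 f : CL2 m n₁ n₂) η) :
    HasWeakDeriv β (realPartL2 m n₁ n₂ f) (realPartL2 m n₁ n₂ g) := by
  refine ⟨Lp_locallyIntegrable _, Lp_locallyIntegrable _, fun φ h₁ h₂ => ?_⟩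
  have h3 := integral_multiDeriv_of_schwartz (integral_schwartzDeriv_smul_of_fourier h) h₁ h₂
  have h4 : ∀ (ψ : Space m → ℝ) (k : CL2 m n₁ n₂), Continuous ψ → HasCompactSupport ψ →
      ∫ x, ψ x • realPartL2 m n₁ n₂ k x = realPart n₁ n₂ (∫ x, ψ x • k x) := by
    intro ψ k hψ hψ'
    rw [← (realPart n₁ n₂).integral_comp_comm
      (integrable_smul_of_memLp hψ hψ' (Lp_locallyIntegrable k))]
    refine integral_congr_ae ?_
    filter_upwards [coeFn_realPartL2 k] with x hx
    rw [hx, map_smul]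
  obtain ⟨h5, h6⟩ := contDiff_hasCompactSupport_multiDeriv h₁ h₂ β
  rw [h4 _ _ h5.continuous h6, h4 _ _ h₁.continuous h₂, h3, map_smul]

/-- The Fourier transform of a weak derivative. -/
lemma fourier_complexifyL2_of_hasWeakDeriv {β : Fin m → ℕ} {w v : L2 m n₁ n₂}
    (h : HasWeakDeriv β w v) :
    (𝓕 (complexifyL2 m n₁ n₂ v) : CL2 m n₁ n₂) =ᵐ[volume] fun η => derivSymbol β η •
      (𝓕 (complexifyL2 m n₁ n₂ w) : CL2 m n₁ n₂) η := by
  refine fourier_ae_eq_of_integral_schwartzDeriv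
    (integral_schwartzDeriv_of_real fun φ h₁ h₂ => ?_)
  have h4 : ∀ (ψ : Space m → ℝ) (k : L2 m n₁ n₂), Continuous ψ → HasCompactSupport ψ →
      ∫ x, ψ x • complexifyL2 m n₁ n₂ k x = complexify n₁ n₂ (∫ x, ψ x • k x) := by
    intro ψ k hψ hψ'
    rw [← (complexify n₁ n₂).integral_comp_comm
      (integrable_smul_of_memLp hψ hψ' (Lp_locallyIntegrable k))]
    refine integral_congr_ae ?_
    filter_upwards [coeFn_complexifyL2 k] with x hx
    rw [hx, map_smul]
    rfl
  obtain ⟨h5, h6⟩ := contDiff_hasCompactSupport_multiDeriv h₁ h₂ β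
  rw [h4 _ _ h5.continuous h6, h4 _ _ h₁.continuous h₂, h.2.2 φ h₁ h₂, map_smul]

end WeakDerivative

/-! ### The formal adjoint and its symbol -/

section Adjoint

open SchwartzMap LineDeriv

variable {m n₁ n₂ : ℕ}

lemma realPart_cact_toC (M : Mat n₁ n₂) (u : CState n₁ n₂) :
    realPart n₁ n₂ (cact (toC M) u) = act M (realPart n₁ n₂ u) := by
  ext i
  simp [realPart_apply, cact, act, toC, Matrix.mulVec, dotProduct]

lemma vecToC_act (M : Mat n₁ n₂) (v : State n₁ n₂) :
    vecToC (act M v) = cact (toC M) (vecToC v) := by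
  ext i
  simp [vecToC, cact, act, toC, Matrix.mulVec, dotProduct]

/-- The formal adjoint of the spatial operator on Schwartz functions. -/
def schwartzAdjoint (A : Fin m → Mat n₁ n₂) (B : Mat n₁ n₂) :
    𝓢(Space m, CState n₁ n₂) →L[ℂ] 𝓢(Space m, CState n₁ n₂) :=
  ∑ α, postcompCLM (Matrix.toEuclideanCLM (𝕜 := ℂ) (toC (A α).transpose)) ∘L
      lineDerivOpCLM ℂ 𝓢(Space m, CState n₁ n₂) (EuclideanSpace.single α (1 : ℝ)) +
    postcompCLM (Matrix.toEuclideanCLM (𝕜 := ℂ) (toC B.transpose))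

lemma schwartzAdjoint_eq (A : Fin m → Mat n₁ n₂) (B : Mat n₁ n₂)
    (Ψ : 𝓢(Space m, CState n₁ n₂)) : schwartzAdjoint A B Ψ =
      ∑ α, postcompCLM (Matrix.toEuclideanCLM (𝕜 := ℂ) (toC (A α).transpose))
        (∂_{EuclideanSpace.single α (1 : ℝ)} Ψ) +
      postcompCLM (Matrix.toEuclideanCLM (𝕜 := ℂ) (toC B.transpose)) Ψ := by
  simp [schwartzAdjoint]

lemma schwartzAdjoint_apply (A : Fin m → Mat n₁ n₂) (B : Mat n₁ n₂)
    (Ψ : 𝓢(Space m, CState n₁ n₂)) (x : Space m) : schwartzAdjoint A B Ψ x =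
      ∑ α, cact (toC (A α).transpose) (partialDeriv α Ψ x) + cact (toC B.transpose) (Ψ x) := by
  rw [schwartzAdjoint_eq, add_apply, sum_apply, postcompCLM_apply,
    cact_eq_toEuclideanCLM]
  rfl

lemma adjointOp_realPart (A : Fin m → Mat n₁ n₂) (B : Mat n₁ n₂)
    (Ψ : 𝓢(Space m, CState n₁ n₂)) :
    adjointOp A B (fun x => realPart n₁ n₂ (Ψ x)) =
      fun x => realPart n₁ n₂ (schwartzAdjoint A B Ψ x) := by
  ext1 x
  rw [schwartzAdjoint_apply, map_add, map_sum, realPart_cact_toC, adjointOp]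
  simp only [realPart_cact_toC, partialDeriv_clm_comp (realPart n₁ n₂) (Ψ.smooth ⊤)]

lemma schwartzAdjoint_vecToC (A : Fin m → Mat n₁ n₂) (B : Mat n₁ n₂)
    {Ψ : 𝓢(Space m, CState n₁ n₂)} {φ : Space m → State n₁ n₂} (hφ : ContDiff ℝ ∞ φ)
    (h : ∀ x, Ψ x = vecToC (φ x)) (x : Space m) :
    schwartzAdjoint A B Ψ x = vecToC (adjointOp A B φ x) := by
  have h1 : ⇑Ψ = fun x => vecToC (φ x) := funext h
  have h2 := partialDeriv_clm_comp (complexify n₁ n₂) hφ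
  simp only [complexify_apply] at h2
  rw [schwartzAdjoint_apply, h1, adjointOp, ← complexify_apply (_ + _), map_add, map_sum]
  simp only [h2, complexify_apply, vecToC_act]

lemma fourier_postcompCLM (L : CState n₁ n₂ →L[ℂ] CState n₁ n₂)
    (Ψ : 𝓢(Space m, CState n₁ n₂)) (η : Space m) :
    (𝓕 (postcompCLM L Ψ)) η = L ((𝓕 Ψ) η) := by
  rw [fourier_coe, fourier_coe, Real.fourier_eq, Real.fourier_eq]
  rw [← L.integral_comp_comm ((Real.fourierIntegral_convergent_iff η).2 Ψ.integrable)]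
  congr 1
  ext1 x
  rw [postcompCLM_apply, Circle.smul_def, Circle.smul_def, map_smul]

lemma conjTranspose_symbol (A : Fin m → Mat n₁ n₂) (B : Mat n₁ n₂) (ξ : Space m) :
    (symbol A B ξ).conjTranspose =
      ∑ α, (Complex.I * (ξ α : ℂ)) • toC (A α).transpose + toC B.transpose := by
  ext i j
  simp [symbol, toC, fluxMat, Matrix.sum_apply, Finset.mul_sum, mul_assoc, add_comm]

/-- With ξ = 2πη the derivative ∂_α becomes iξ_α, and Bᵀ + iA(ξ)ᵀ is the conjugate transpose of
E(iξ). So the weak equation is the pairing of the ODE for each frequency with a test function. -/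
lemma fourier_schwartzAdjoint (A : Fin m → Mat n₁ n₂) (B : Mat n₁ n₂)
    (Ψ : 𝓢(Space m, CState n₁ n₂)) (η : Space m) :
    (𝓕 (schwartzAdjoint A B Ψ)) η =
      cact (symbol A B ((2 * Real.pi) • η)).conjTranspose ((𝓕 Ψ) η) := by
  have hadd : ∀ (s : Finset (Fin m)) (f : Fin m → 𝓢(Space m, CState n₁ n₂)),
      𝓕 (∑ α ∈ s, f α) = ∑ α ∈ s, 𝓕 (f α) := fun s f =>
    map_sum (FourierTransform.fourierCLM ℂ 𝓢(Space m, CState n₁ n₂)) f s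
  rw [schwartzAdjoint_eq, FourierTransform.fourier_add, hadd, add_apply, sum_apply,
    fourier_postcompCLM, conjTranspose_symbol, cact_eq_toEuclideanCLM, map_add, map_sum, add_apply,
    sum_apply]
  congr 1
  refine Finset.sum_congr rfl fun α _ => ?_
  have hg : (fun x : Space m => inner ℝ x (EuclideanSpace.single α (1 : ℝ))).HasTemperateGrowth :=
    by fun_prop
  rw [fourier_postcompCLM, fourier_lineDerivOp_eq, smul_apply, smulLeftCLM_apply_apply hg,
    EuclideanSpace.inner_single_right, ← Complex.coe_smul, map_smul, map_smul, map_smul, smul_apply, smul_smul]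
  congr 1
  simp
  ring

end Adjoint

/-! ### Existence of the solution operator -/

section Existence

open SchwartzMap
open scoped Matrix.Norms.L2Operator

variable {m n₁ n₂ : ℕ}

/-- The symbol of the solution operator at frequency `2πη` (constant for `t ≤ 0`). -/
def evolutionSymbol (A : Fin m → Mat n₁ n₂) (B : Mat n₁ n₂) (t : ℝ) (η : Space m) :
    CMat n₁ n₂ :=
  NormedSpace.exp (((max t 0 : ℝ) : ℂ) • symbol A B ((2 * Real.pi) • η))

lemma continuous_evolutionSymbol (A : Fin m → Mat n₁ n₂) (B : Mat n₁ n₂) (t : ℝ) :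
    Continuous (evolutionSymbol A B t) :=
  continuous_exp_smul continuous_const ((continuous_symbol A B).comp (by fun_prop))

lemma isMultiplier_evolutionSymbol {A : Fin m → Mat n₁ n₂} {B : Mat n₁ n₂}
    (h : ∀ ξ : Space m, ∀ t : ℝ, 0 ≤ t → ‖NormedSpace.exp ((t : ℂ) • symbol A B ξ)‖ ≤ 1)
    (t : ℝ) : IsMultiplier (evolutionSymbol A B t) :=
  ⟨(continuous_evolutionSymbol A B t).aestronglyMeasurable, 1,
    fun _ => h _ _ (le_max_right _ _)⟩

/-- A bound of the group generated by the symbol, for positive and negative times. -/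
lemma norm_exp_symbol_le {A : Fin m → Mat n₁ n₂} (hA : ∀ α, (A α).IsSymm) (B : Mat n₁ n₂)
    (ξ : Space m) (t : ℝ) :
    ‖NormedSpace.exp ((t : ℂ) • symbol A B ξ)‖ ≤ Real.exp (‖toC B‖ * |t|) := by
  have hB : ∀ u : CState n₁ n₂, |(inner ℂ u (cact (toC B) u)).re| ≤ ‖toC B‖ * ‖u‖ ^ 2 := by
    intro u
    calc _ ≤ ‖inner ℂ u (cact (toC B) u)‖ := Complex.abs_re_le_norm _
      _ ≤ ‖u‖ * ‖cact (toC B) u‖ := norm_inner_le_norm _ _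
      _ ≤ ‖u‖ * (‖toC B‖ * ‖u‖) := by gcongr; exact norm_cact_le _ _
      _ = _ := by ring
  rcases le_total 0 t with ht | ht
  · rw [abs_of_nonneg ht]
    refine norm_exp_le (fun u => ?_) ht
    rw [re_inner_symbol hA]
    exact (le_abs_self _).trans (hB u)
  · rw [abs_of_nonpos ht]
    have h : (t : ℂ) • symbol A B ξ = ((-t : ℝ) : ℂ) • (-symbol A B ξ) := by
      push_cast
      rw [neg_smul_neg]
    rw [h]
    refine norm_exp_le (fun u => ?_) (neg_nonneg.2 ht)
    rw [cact_neg, inner_neg_right, Complex.neg_re, re_inner_symbol hA]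
    exact (neg_le_abs _).trans (hB u)

lemma integrable_inner_schwartz {f : Space m → CState n₁ n₂} (hf : MemLp f 2 volume)
    (Θ : 𝓢(Space m, CState n₁ n₂)) : Integrable fun η => inner ℂ (f η) (Θ η) :=
  memLp_one_iff_integrable.1 <| by
    have := L2.integrable_inner (𝕜 := ℂ) hf.toLp (Θ.toLp 2 volume)
    refine memLp_one_iff_integrable.2 (this.congr ?_)
    filter_upwards [hf.coeFn_toLp, Θ.coeFn_toLp 2 volume] with η h1 h2
    rw [h1, h2]

/-- The derivative of the pairing of a solution with a test function, on the Fourier side. -/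
lemma hasDerivAt_pairing {A : Fin m → Mat n₁ n₂} (hA : ∀ α, (A α).IsSymm) (B : Mat n₁ n₂)
    (F : CL2 m n₁ n₂) {Θ Θ' : 𝓢(Space m, CState n₁ n₂)}
    (hΘ : ∀ η, Θ' η = cact (symbol A B ((2 * Real.pi) • η)).conjTranspose (Θ η)) (t : ℝ) :
    HasDerivAt (fun s : ℝ => ∫ η, inner ℂ
        (cact (NormedSpace.exp ((s : ℂ) • symbol A B ((2 * Real.pi) • η))) (F η)) (Θ η))
      (∫ η, inner ℂ
        (cact (NormedSpace.exp ((t : ℂ) • symbol A B ((2 * Real.pi) • η))) (F η)) (Θ' η)) t := by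
  have hmult : ∀ s : ℝ, IsMultiplier fun η : Space m =>
      NormedSpace.exp ((s : ℂ) • symbol A B ((2 * Real.pi) • η)) := fun s =>
    ⟨(continuous_exp_smul continuous_const
      ((continuous_symbol A B).comp (by fun_prop))).aestronglyMeasurable, _,
      fun η => norm_exp_symbol_le hA B _ s⟩
  have hint : ∀ (s : ℝ) (Φ : 𝓢(Space m, CState n₁ n₂)), Integrable fun η => inner ℂ
      (cact (NormedSpace.exp ((s : ℂ) • symbol A B ((2 * Real.pi) • η))) (F η)) (Φ η) :=
    fun s Φ => integrable_inner_schwartz (memLp_cact (hmult s) F) Φ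
  have hbound : Integrable fun η => Real.exp (‖toC B‖ * (|t| + 1)) * (‖F η‖ * ‖Θ' η‖) := by
    refine Integrable.const_mul ?_ _
    have h1 := (Θ'.memLp 2 volume).norm
    have h2 := (Lp.memLp F).norm
    exact h2.integrable_mul h1
  -- The neighbourhood of t may contain negative times, hence the bound for the whole group. The
  -- unbounded symbol is moved to the test function, so that |F||Θ'|, a product of L² functions,
  -- dominates.
  refine (hasDerivAt_integral_of_dominated_loc_of_deriv_le (Metric.ball_mem_nhds t one_pos)
    (Eventually.of_forall fun s => (hint s Θ).aestronglyMeasurable) (hint t Θ)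
    (hint t Θ').aestronglyMeasurable (Eventually.of_forall fun η s hs => ?_) hbound
    (F' := fun s η => inner ℂ
      (cact (NormedSpace.exp ((s : ℂ) • symbol A B ((2 * Real.pi) • η))) (F η)) (Θ' η))
    (Eventually.of_forall fun η s hs => ?_)).2
  · have hs' : |s| ≤ |t| + 1 := by
      have h1 : |s - t| < 1 := by simpa [Real.dist_eq] using hs
      have h2 := abs_sub_abs_le_abs_sub s t
      linarith
    calc _ ≤ ‖cact (NormedSpace.exp ((s : ℂ) • symbol A B ((2 * Real.pi) • η))) (F η)‖ *
          ‖Θ' η‖ := norm_inner_le_norm _ _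
      _ ≤ (Real.exp (‖toC B‖ * (|t| + 1)) * ‖F η‖) * ‖Θ' η‖ := by
        gcongr
        refine (norm_cact_le _ _).trans ?_
        gcongr
        refine (norm_exp_symbol_le hA B _ s).trans ?_
        gcongr
      _ = _ := mul_assoc _ _ _
  · have h1 := (hasDerivAt_cact_exp (symbol A B ((2 * Real.pi) • η)) (F η) s).inner ℂ
      (hasDerivAt_const s (Θ η))
    rw [inner_zero_right, zero_add, inner_cact_left] at h1
    rw [hΘ]
    exact h1

lemma inner_fourier_toLp (f : CL2 m n₁ n₂) (Ψ : 𝓢(Space m, CState n₁ n₂)) :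
    inner ℂ f (Ψ.toLp 2 volume) = ∫ η, inner ℂ ((𝓕 f : CL2 m n₁ n₂) η) ((𝓕 Ψ) η) := by
  rw [← Lp.inner_fourier_eq, SchwartzMap.toLp_fourier_eq, L2.inner_def]
  refine integral_congr_ae ?_
  filter_upwards [(𝓕 Ψ).coeFn_toLp 2 volume] with η h
  rw [h]

/-- The pairing with a real test function. -/
lemma integral_inner_realPartL2 (f : CL2 m n₁ n₂) {Ψ : 𝓢(Space m, CState n₁ n₂)}
    {φ : Space m → State n₁ n₂} (h : ∀ x, Ψ x = vecToC (φ x)) :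
    ∫ x, ⟪realPartL2 m n₁ n₂ f x, φ x⟫_ℝ = (inner ℂ f (Ψ.toLp 2 volume)).re := by
  have h1 : Integrable fun x => inner ℂ (f x) (Ψ x) := integrable_inner_schwartz (Lp.memLp f) Ψ
  have h2 : inner ℂ f (Ψ.toLp 2 volume) = ∫ x, inner ℂ (f x) (Ψ x) := by
    rw [L2.inner_def]
    refine integral_congr_ae ?_
    filter_upwards [Ψ.coeFn_toLp 2 volume] with η h
    rw [h]
  rw [h2, ← Complex.reCLM_apply, ← Complex.reCLM.integral_comp_comm h1]
  refine integral_congr_ae ?_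
  filter_upwards [coeFn_realPartL2 f] with x hx
  rw [hx, inner_realPart_left, h, Complex.reCLM_apply]

/-- A real vector-valued test function as a complex Schwartz function. -/
def testToSchwartzState {φ : Space m → State n₁ n₂} (h₁ : ContDiff ℝ ∞ φ)
    (h₂ : HasCompactSupport φ) : 𝓢(Space m, CState n₁ n₂) :=
  HasCompactSupport.toSchwartzMap (f := fun x => complexify n₁ n₂ (φ x))
    (h₂.comp_left (g := complexify n₁ n₂) (map_zero _)) ((complexify n₁ n₂).contDiff.comp h₁)

lemma testToSchwartzState_apply {φ : Space m → State n₁ n₂} (h₁ : ContDiff ℝ ∞ φ)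
    (h₂ : HasCompactSupport φ) (x : Space m) : testToSchwartzState h₁ h₂ x = vecToC (φ x) := rfl

/-- Strong continuity. -/
lemma continuous_mulSymbol_evolutionSymbol {A : Fin m → Mat n₁ n₂} {B : Mat n₁ n₂}
    (h : ∀ ξ : Space m, ∀ t : ℝ, 0 ≤ t → ‖NormedSpace.exp ((t : ℂ) • symbol A B ξ)‖ ≤ 1)
    (F : CL2 m n₁ n₂) : Continuous fun t => mulSymbol (evolutionSymbol A B t) F := by
  rw [continuous_iff_continuousAt]
  intro t
  rw [ContinuousAt, tendsto_iff_norm_sub_tendsto_zero]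
  have hsq : ∀ s, ‖mulSymbol (evolutionSymbol A B s) F - mulSymbol (evolutionSymbol A B t) F‖ ^ 2 =
      ∫ η, ‖cact (evolutionSymbol A B s η) (F η) - cact (evolutionSymbol A B t η) (F η)‖ ^ 2 := by
    intro s
    have h1 := L2.inner_def (𝕜 := ℂ)
      (mulSymbol (evolutionSymbol A B s) F - mulSymbol (evolutionSymbol A B t) F)
      (mulSymbol (evolutionSymbol A B s) F - mulSymbol (evolutionSymbol A B t) F)
    rw [inner_self_eq_norm_sq_to_K] at h1
    have h2 : ∀ᵐ η, inner ℂ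
        ((mulSymbol (evolutionSymbol A B s) F - mulSymbol (evolutionSymbol A B t) F : CL2 m n₁ n₂) η)
        ((mulSymbol (evolutionSymbol A B s) F - mulSymbol (evolutionSymbol A B t) F : CL2 m n₁ n₂) η) =
        ((‖cact (evolutionSymbol A B s η) (F η) - cact (evolutionSymbol A B t η) (F η)‖ ^ 2 : ℝ) :
          ℂ) := by
      filter_upwards [Lp.coeFn_sub (mulSymbol (evolutionSymbol A B s) F)
        (mulSymbol (evolutionSymbol A B t) F),
        coeFn_mulSymbol (isMultiplier_evolutionSymbol h s) F,
        coeFn_mulSymbol (isMultiplier_evolutionSymbol h t) F] with η h3 h4 h5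
      rw [h3, Pi.sub_apply, h4, h5, inner_self_eq_norm_sq_to_K]
      push_cast
      rfl
    rw [integral_congr_ae h2, integral_complex_ofReal] at h1
    refine Complex.ofReal_injective ?_
    rw [Complex.ofReal_pow]
    exact h1
  -- Dominated convergence: the exponential is continuous in time at each frequency, and contraction
  -- gives the majorant (2|F|)².
  have hlim : Tendsto (fun s => ‖mulSymbol (evolutionSymbol A B s) F -
      mulSymbol (evolutionSymbol A B t) F‖ ^ 2) (nhds t) (nhds 0) := by
    simp_rw [hsq]
    have h0 : ∫ _ : Space m, (0 : ℝ) = 0 := by simp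
    rw [← h0]
    refine tendsto_integral_filter_of_dominated_convergence (fun η => (2 * ‖F η‖) ^ 2)
      (Eventually.of_forall fun s => ?_) (Eventually.of_forall fun s =>
        Eventually.of_forall fun η => ?_) ?_ (Eventually.of_forall fun η => ?_)
    · exact ((aestronglyMeasurable_cact (continuous_evolutionSymbol A B s).aestronglyMeasurable
        (Lp.aestronglyMeasurable F)).sub
        (aestronglyMeasurable_cact (continuous_evolutionSymbol A B t).aestronglyMeasurable
        (Lp.aestronglyMeasurable F))).norm.pow 2
    · rw [norm_pow, norm_norm]
      gcongr
      have h1 : ∀ s, ‖cact (evolutionSymbol A B s η) (F η)‖ ≤ ‖F η‖ := fun s =>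
        (norm_cact_le _ _).trans (mul_le_of_le_one_left (norm_nonneg _) (h _ _ (le_max_right _ _)))
      refine (norm_sub_le _ _).trans ?_
      linarith [h1 s, h1 t]
    · exact ((Lp.memLp F).norm.const_mul 2).integrable_sq
    · have hc : Continuous fun s => ‖cact (evolutionSymbol A B s η) (F η) -
          cact (evolutionSymbol A B t η) (F η)‖ ^ 2 := by
        refine (((continuous_cact ?_ continuous_const).sub continuous_const).norm).pow 2
        exact continuous_exp_smul (by fun_prop) continuous_const
      simpa using hc.tendsto t
  have := hlim.sqrt
  simpa [Real.sqrt_sq (norm_nonneg _)] using this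

/-- Plancherel reduces the weak equation to the ODE at each frequency. A real test function sees
only the real part of the complex multiplier, so its reality plays no role here. -/
theorem isSolution_fourierMultiplier {A : Fin m → Mat n₁ n₂} (hA : ∀ α, (A α).IsSymm)
    {B : Mat n₁ n₂}
    (h : ∀ ξ : Space m, ∀ t : ℝ, 0 ≤ t → ‖NormedSpace.exp ((t : ℂ) • symbol A B ξ)‖ ≤ 1)
    (w : L2 m n₁ n₂) : IsSolution A B w fun t => fourierMultiplier (evolutionSymbol A B t) w := by
  refine ⟨?_, ?_, fun φ h₁ h₂ t ht => ?_⟩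
  · refine Continuous.continuousOn ?_
    refine (realPartL2 m n₁ n₂).continuous.comp ?_
    exact (FourierTransform.fourierInvCLM ℂ (CL2 m n₁ n₂)).continuous.comp
      (continuous_mulSymbol_evolutionSymbol h _)
  · have h0 : mulSymbol (evolutionSymbol A B 0) (𝓕 (complexifyL2 m n₁ n₂ w)) =
        𝓕 (complexifyL2 m n₁ n₂ w) := by
      refine Lp.ext ?_
      filter_upwards [coeFn_mulSymbol (isMultiplier_evolutionSymbol h 0)
        (𝓕 (complexifyL2 m n₁ n₂ w))] with η hη
      rw [hη, evolutionSymbol, max_self, Complex.ofReal_zero, zero_smul, NormedSpace.exp_zero,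
        cact_one]
    beta_reduce
    rw [fourierMultiplier_apply, complexMultiplier, h0, FourierTransform.fourierInv_fourier_eq,
      realPartL2_complexifyL2]
  · set Ψ := testToSchwartzState h₁ h₂
    set F : CL2 m n₁ n₂ := 𝓕 (complexifyL2 m n₁ n₂ w)
    have hpair : ∀ (s : ℝ) (Φ : 𝓢(Space m, CState n₁ n₂)) (ψ : Space m → State n₁ n₂),
        0 ≤ s → (∀ x, Φ x = vecToC (ψ x)) →
        ∫ x, ⟪fourierMultiplier (evolutionSymbol A B s) w x, ψ x⟫_ℝ =
        (∫ η, inner ℂ (cact (NormedSpace.exp ((s : ℂ) • symbol A B ((2 * Real.pi) • η))) (F η))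
          ((𝓕 Φ) η)).re := by
      intro s Φ ψ hs hΦ
      rw [fourierMultiplier_apply, integral_inner_realPartL2 _ hΦ, inner_fourier_toLp,
        fourier_complexMultiplier]
      congr 1
      refine integral_congr_ae ?_
      filter_upwards [coeFn_mulSymbol (isMultiplier_evolutionSymbol h s) F] with η hη
      rw [hη, evolutionSymbol, max_eq_left hs]
    have hd := hasDerivAt_pairing hA B F (fourier_schwartzAdjoint A B Ψ) t
    have hd' := (Complex.reCLM.hasFDerivAt.comp_hasDerivAt t hd).hasDerivWithinAt (s := Ici 0)
    rw [hpair t (schwartzAdjoint A B Ψ) _ ht (schwartzAdjoint_vecToC A B h₁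
      (testToSchwartzState_apply h₁ h₂))]
    refine hd'.congr (fun s hs => ?_) ?_
    · exact hpair s Ψ φ hs (testToSchwartzState_apply h₁ h₂)
    · exact hpair t Ψ φ ht (testToSchwartzState_apply h₁ h₂)

end Existence

/-! ### Uniqueness of weak solutions -/

section Uniqueness

open SchwartzMap
open scoped Matrix.Norms.L2Operator

variable {m n₁ n₂ : ℕ}

lemma re_inner_complexifyL2 (w : L2 m n₁ n₂) (Ψ : 𝓢(Space m, CState n₁ n₂)) :
    (inner ℂ (complexifyL2 m n₁ n₂ w) (Ψ.toLp 2 volume)).re =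
      ∫ x, ⟪w x, realPart n₁ n₂ (Ψ x)⟫_ℝ := by
  have h1 : Integrable fun x => inner ℂ (complexifyL2 m n₁ n₂ w x) (Ψ x) :=
    integrable_inner_schwartz (Lp.memLp _) Ψ
  have h2 : inner ℂ (complexifyL2 m n₁ n₂ w) (Ψ.toLp 2 volume) =
      ∫ x, inner ℂ (complexifyL2 m n₁ n₂ w x) (Ψ x) := by
    rw [L2.inner_def]
    refine integral_congr_ae ?_
    filter_upwards [Ψ.coeFn_toLp 2 volume] with η h
    rw [h]
  rw [h2, ← Complex.reCLM_apply, ← Complex.reCLM.integral_comp_comm h1]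
  refine integral_congr_ae ?_
  filter_upwards [coeFn_complexifyL2 w] with x hx
  rw [hx, real_inner_comm, inner_realPart_left, Complex.reCLM_apply, ← inner_conj_symm,
    Complex.conj_re]

lemma IsSolution.hasDerivWithinAt_re_inner {A : Fin m → Mat n₁ n₂} {B : Mat n₁ n₂}
    {w₀ : L2 m n₁ n₂} {w : ℝ → L2 m n₁ n₂} (hw : IsSolution A B w₀ w)
    {Ψ : 𝓢(Space m, CState n₁ n₂)} (hΨ : HasCompactSupport Ψ) {t : ℝ} (ht : 0 ≤ t) :
    HasDerivWithinAt (fun s => (inner ℂ (complexifyL2 m n₁ n₂ (w s)) (Ψ.toLp 2 volume)).re)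
      (inner ℂ (complexifyL2 m n₁ n₂ (w t)) ((schwartzAdjoint A B Ψ).toLp 2 volume)).re
      (Ici 0) t := by
  simp_rw [re_inner_complexifyL2]
  have h := hw.2.2 (fun x => realPart n₁ n₂ (Ψ x)) ((realPart n₁ n₂).contDiff.comp (Ψ.smooth ⊤))
    (hΨ.comp_left (g := realPart n₁ n₂) (map_zero _)) t ht
  rwa [adjointOp_realPart] at h

/-- Taylor estimate for weak solutions with vanishing initial value. -/
lemma abs_re_inner_le_of_weak_solution {A : Fin m → Mat n₁ n₂} {B : Mat n₁ n₂}
    {d : ℝ → CL2 m n₁ n₂} (h0 : d 0 = 0)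
    (hd : ∀ Ψ : 𝓢(Space m, CState n₁ n₂), HasCompactSupport Ψ → ∀ t : ℝ, 0 ≤ t →
      HasDerivWithinAt (fun s => (inner ℂ (d s) (Ψ.toLp 2 volume)).re)
        (inner ℂ (d t) ((schwartzAdjoint A B Ψ).toLp 2 volume)).re (Ici 0) t)
    {M T : ℝ} (hM : ∀ t ∈ Icc 0 T, ‖d t‖ ≤ M) (k : ℕ) :
    ∀ (Ψ : 𝓢(Space m, CState n₁ n₂)), ∀ t ∈ Icc 0 T,
      |(inner ℂ (d t) (Ψ.toLp 2 volume)).re| ≤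
        M * ‖((schwartzAdjoint A B)^[k] Ψ).toLp 2 volume‖ * (t ^ k / k.factorial) := by
  induction k with
  | zero =>
    intro Ψ t ht
    simp only [Function.iterate_zero, id, pow_zero, Nat.factorial_zero, Nat.cast_one, div_one,
      mul_one]
    refine (Complex.abs_re_le_norm _).trans ((norm_inner_le_norm _ _).trans ?_)
    gcongr
    exact hM t ht
  | succ k ih =>
    intro Ψ t ht
    have hT : (0 : ℝ) ≤ T := ht.1.trans ht.2
    have hM0 : 0 ≤ M := (norm_nonneg _).trans (hM 0 ⟨le_rfl, hT⟩)
    -- The equation is known only for compactly supported Ψ, but the estimate will be used for Ψ =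
    -- 𝓕⁻Θ, which need not be one. Hence it is extended to all Schwartz functions by density.
    refine dense_hasCompactSupport.induction (P := fun Ψ : 𝓢(Space m, CState n₁ n₂) =>
      |(inner ℂ (d t) (Ψ.toLp 2 volume)).re| ≤
        M * ‖((schwartzAdjoint A B)^[k + 1] Ψ).toLp 2 volume‖ *
          (t ^ (k + 1) / (k + 1).factorial)) ?_ ?_ Ψ
    · intro Ψ hΨ
      set c := M * ‖((schwartzAdjoint A B)^[k + 1] Ψ).toLp 2 volume‖ with hc
      -- One integration in time: the derivative is the pairing with the adjoint applied to Ψ, which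
      -- the previous order controls by t^k/k!.
      refine image_norm_le_of_norm_deriv_right_le_deriv_boundary (a := 0) (b := T)
        (f := fun s => (inner ℂ (d s) (Ψ.toLp 2 volume)).re)
        (f' := fun s => (inner ℂ (d s) ((schwartzAdjoint A B Ψ).toLp 2 volume)).re)
        (B := fun s => c * (s ^ (k + 1) / (k + 1).factorial))
        (B' := fun s => c * (s ^ k / k.factorial)) ?_ ?_ ?_ ?_ ?_ ht
      · intro s hs
        exact ((hd Ψ hΨ s hs.1).continuousWithinAt).mono Icc_subset_Ici_self
      · intro s hs
        exact (hd Ψ hΨ s hs.1).mono (Ici_subset_Ici.2 hs.1)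
      · simp [h0]
      · intro s
        have h1 := ((hasDerivAt_pow (k + 1) s).div_const ((k + 1).factorial : ℝ)).const_mul c
        refine h1.congr_deriv ?_
        rw [Nat.factorial_succ, Nat.add_sub_cancel]
        push_cast
        have : (k.factorial : ℝ) ≠ 0 := by positivity
        field_simp
      · intro s hs
        have h1 := ih (schwartzAdjoint A B Ψ) s ⟨hs.1, hs.2.le⟩
        rw [← Function.iterate_succ_apply] at h1
        exact h1
    · refine isClosed_le ?_ ?_
      · exact (Complex.continuous_re.comp
          (continuous_const.inner (SchwartzMap.continuous_toLp (p := 2)))).abs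
      · refine (continuous_const.mul ?_).mul continuous_const
        exact (SchwartzMap.continuous_toLp.comp
          ((schwartzAdjoint A B).continuous.iterate (k + 1))).norm

/-- On a band-limited function the adjoint multiplies the transform by matrices bounded by C on its
support, so k iterations cost only C^k. -/
lemma norm_fourier_iterate_schwartzAdjoint_le {A : Fin m → Mat n₁ n₂} {B : Mat n₁ n₂}
    {Θ : 𝓢(Space m, CState n₁ n₂)} {C : ℝ} (hC0 : 0 ≤ C)
    (hC : ∀ η, Θ η ≠ 0 → ‖(symbol A B ((2 * Real.pi) • η)).conjTranspose‖ ≤ C) (k : ℕ) :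
    ‖((schwartzAdjoint A B)^[k] (𝓕⁻ Θ)).toLp 2 volume‖ ≤ C ^ k * ‖Θ.toLp 2 volume‖ := by
  have hpt : ∀ η, ‖(𝓕 ((schwartzAdjoint A B)^[k] (𝓕⁻ Θ))) η‖ ≤ C ^ k * ‖Θ η‖ := by
    intro η
    induction k with
    | zero => simp
    | succ k ih =>
      rw [Function.iterate_succ_apply', fourier_schwartzAdjoint]
      by_cases hη : Θ η = 0
      · rw [hη, norm_zero, mul_zero, norm_le_zero_iff] at ih
        rw [ih, cact_vzero, norm_zero]
        positivity
      · refine (norm_cact_le _ _).trans ?_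
        rw [pow_succ', mul_assoc]
        gcongr
        exact hC η hη
  rw [← Lp.norm_fourier_eq, SchwartzMap.toLp_fourier_eq]
  refine Lp.norm_le_mul_norm_of_ae_le_mul ?_
  filter_upwards [(𝓕 ((schwartzAdjoint A B)^[k] (𝓕⁻ Θ))).coeFn_toLp 2 volume,
    Θ.coeFn_toLp 2 volume] with η h1 h2
  rw [h1, h2]
  exact hpt η

/-- For band-limited test functions the Taylor estimate is a constant times (Ct)^k/k!, which tends
to zero with k. Such functions are dense, so d(t) is orthogonal to everything. -/
lemma eq_zero_of_weak_solution {A : Fin m → Mat n₁ n₂} {B : Mat n₁ n₂}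
    {d : ℝ → CL2 m n₁ n₂} (hcont : ContinuousOn d (Ici 0)) (h0 : d 0 = 0)
    (hd : ∀ Ψ : 𝓢(Space m, CState n₁ n₂), HasCompactSupport Ψ → ∀ t : ℝ, 0 ≤ t →
      HasDerivWithinAt (fun s => (inner ℂ (d s) (Ψ.toLp 2 volume)).re)
        (inner ℂ (d t) ((schwartzAdjoint A B Ψ).toLp 2 volume)).re (Ici 0) t)
    {t : ℝ} (ht : 0 ≤ t) : d t = 0 := by
  obtain ⟨M, hM⟩ := isCompact_Icc.exists_bound_of_continuousOn
    (hcont.mono (Icc_subset_Ici_self : Icc 0 t ⊆ Ici 0))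
  have hcompact : ∀ Θ : 𝓢(Space m, CState n₁ n₂), HasCompactSupport Θ →
      (inner ℂ (𝓕 (d t)) (Θ.toLp 2 volume)).re = 0 := by
    intro Θ hΘ
    have hcS : Continuous fun η : Space m =>
        (symbol A B ((2 * Real.pi) • η)).conjTranspose :=
      ((continuous_symbol A B).comp (by fun_prop : Continuous fun η : Space m =>
        (2 * Real.pi) • η)).matrix_conjTranspose
    obtain ⟨C, hC⟩ := hΘ.exists_bound_of_continuousOn hcS.continuousOn
    have hC' : ∀ η, Θ η ≠ 0 → ‖(symbol A B ((2 * Real.pi) • η)).conjTranspose‖ ≤ max C 0 :=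
      fun η hη => (hC η (subset_tsupport _ hη)).trans (le_max_left _ _)
    have hinner : inner ℂ (𝓕 (d t)) (Θ.toLp 2 volume) =
        inner ℂ (d t) ((𝓕⁻ Θ).toLp 2 volume) := by
      rw [← Lp.inner_fourier_eq (d t), SchwartzMap.toLp_fourier_eq,
        FourierTransform.fourier_fourierInv_eq]
    have hb : ∀ k : ℕ, |(inner ℂ (𝓕 (d t)) (Θ.toLp 2 volume)).re| ≤
        M * ‖Θ.toLp 2 volume‖ * ((max C 0 * t) ^ k / k.factorial) := by
      intro k
      have h1 := abs_re_inner_le_of_weak_solution h0 hd hM k (𝓕⁻ Θ) t ⟨ht, le_rfl⟩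
      have hM0 : 0 ≤ M := (norm_nonneg _).trans (hM t ⟨ht, le_rfl⟩)
      rw [hinner]
      refine h1.trans ?_
      calc _ ≤ M * (max C 0 ^ k * ‖Θ.toLp 2 volume‖) * (t ^ k / k.factorial) := by
            gcongr
            exact norm_fourier_iterate_schwartzAdjoint_le (le_max_right _ _) hC' k
        _ = _ := by rw [mul_pow]; ring
    have hlim : Tendsto (fun k : ℕ => M * ‖Θ.toLp 2 volume‖ *
        ((max C 0 * t) ^ k / k.factorial)) atTop (nhds 0) := by
      simpa using (FloorSemiring.tendsto_pow_div_factorial_atTop (max C 0 * t)).const_mul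
        (M * ‖Θ.toLp 2 volume‖)
    exact abs_eq_zero.1 (le_antisymm (ge_of_tendsto' hlim hb) (abs_nonneg _))
  have hschwartz : ∀ Θ : 𝓢(Space m, CState n₁ n₂),
      (inner ℂ (𝓕 (d t)) (Θ.toLp 2 volume)).re = 0 :=
    dense_hasCompactSupport.induction hcompact
      (isClosed_eq (Complex.continuous_re.comp
        (continuous_const.inner (SchwartzMap.continuous_toLp (p := 2)))) continuous_const)
  have hall : ∀ F : CL2 m n₁ n₂, (inner ℂ (𝓕 (d t)) F).re = 0 := by
    intro F
    refine DenseRange.induction_on (p := fun F => (inner ℂ (𝓕 (d t)) F).re = 0)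
      (SchwartzMap.denseRange_toLpCLM (p := 2) (μ := volume) ENNReal.ofNat_ne_top) F ?_ ?_
    · exact isClosed_eq (Complex.continuous_re.comp (continuous_const.inner continuous_id))
        continuous_const
    · exact hschwartz
  -- Testing with the transform of d(t) itself makes the inner product real, so that vanishing real
  -- parts suffice.
  have h1 := hall (𝓕 (d t))
  have h2 : ‖d t‖ ^ 2 = 0 := by
    rw [← h1, ← Lp.norm_fourier_eq, ← inner_self_eq_norm_sq (𝕜 := ℂ)]
    rfl
  exact norm_eq_zero.1 (pow_eq_zero_iff two_ne_zero |>.1 h2)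

theorem IsSolution.unique {A : Fin m → Mat n₁ n₂} {B : Mat n₁ n₂} {w₀ : L2 m n₁ n₂}
    {w w' : ℝ → L2 m n₁ n₂} (hw : IsSolution A B w₀ w) (hw' : IsSolution A B w₀ w') {t : ℝ}
    (ht : 0 ≤ t) : w t = w' t := by
  have h := eq_zero_of_weak_solution (A := A) (B := B)
    (d := fun s => complexifyL2 m n₁ n₂ (w s) - complexifyL2 m n₁ n₂ (w' s))
    (((complexifyL2 m n₁ n₂).continuous.comp_continuousOn hw.1).sub
      ((complexifyL2 m n₁ n₂).continuous.comp_continuousOn hw'.1))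
    (by rw [hw.2.1, hw'.2.1, sub_self]) (fun Ψ hΨ s hs => ?_) ht
  · rw [← map_sub] at h
    have h1 : ‖w t - w' t‖ = 0 := by rw [← norm_complexifyL2, h, norm_zero]
    exact sub_eq_zero.1 (norm_eq_zero.1 h1)
  · simp only [inner_sub_left, Complex.sub_re]
    exact (hw.hasDerivWithinAt_re_inner hΨ hs).sub (hw'.hasDerivWithinAt_re_inner hΨ hs)

theorem isSolutionOperator_fourierMultiplier {A : Fin m → Mat n₁ n₂} (hA : ∀ α, (A α).IsSymm)
    {B : Mat n₁ n₂}
    (h : ∀ ξ : Space m, ∀ t : ℝ, 0 ≤ t → ‖NormedSpace.exp ((t : ℂ) • symbol A B ξ)‖ ≤ 1) :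
    IsSolutionOperator A B fun t => fourierMultiplier (evolutionSymbol A B t) := fun w₀ =>
  ⟨isSolution_fourierMultiplier hA h w₀, fun _ hw _ ht =>
    hw.unique (isSolution_fourierMultiplier hA h w₀) ht⟩

end Uniqueness

/-! ### Complex conjugation and the Fourier integral -/

section Reality

variable {m n₁ n₂ : ℕ}

/-- Componentwise complex conjugation. -/
def conjState (n₁ n₂ : ℕ) : CState n₁ n₂ →L[ℝ] CState n₁ n₂ :=
  LinearMap.toContinuousLinearMap
    { toFun := fun v => WithLp.toLp 2 fun i => starRingEnd ℂ (v i)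
      map_add' := fun u v => by ext i; simp
      map_smul' := fun c v => by ext i; simp }

lemma conjState_apply (v : CState n₁ n₂) (i : Fin n₁ ⊕ Fin n₂) :
    conjState n₁ n₂ v i = starRingEnd ℂ (v i) := rfl

lemma conjState_smul (c : ℂ) (v : CState n₁ n₂) :
    conjState n₁ n₂ (c • v) = starRingEnd ℂ c • conjState n₁ n₂ v := by
  ext i
  simp [conjState_apply]

lemma conjState_vecToC (v : State n₁ n₂) : conjState n₁ n₂ (vecToC v) = vecToC v := by
  ext i
  exact Complex.conj_ofReal _

lemma conjState_cact (M : CMat n₁ n₂) (v : CState n₁ n₂) :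
    conjState n₁ n₂ (cact M v) = cact (conjMat M) (conjState n₁ n₂ v) := by
  ext i
  simp [conjState_apply, cact, conjMat, Matrix.mulVec, dotProduct]

lemma vecToC_realPart {v : CState n₁ n₂} (h : conjState n₁ n₂ v = v) :
    vecToC (realPart n₁ n₂ v) = v := by
  ext i
  have h1 := congrArg (fun u : CState n₁ n₂ => u i) h
  exact Complex.conj_eq_iff_re.1 h1

lemma conjState_fourier {f : Space m → CState n₁ n₂} (hf : Integrable f volume) (η : Space m) :
    conjState n₁ n₂ (𝓕 f η) = 𝓕 (fun x => conjState n₁ n₂ (f x)) (-η) := by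
  rw [Real.fourier_eq, Real.fourier_eq,
    ← (conjState n₁ n₂).integral_comp_comm ((Real.fourierIntegral_convergent_iff η).2 hf)]
  congr 1
  ext1 x
  rw [Circle.smul_def, Circle.smul_def, conjState_smul, inner_neg_right, neg_neg,
    ← Circle.coe_inv_eq_conj, ← AddChar.map_neg_eq_inv, neg_neg]

lemma conjState_fourierInv {f : Space m → CState n₁ n₂} (hf : Integrable f volume) (x : Space m) :
    conjState n₁ n₂ (𝓕⁻ f x) = 𝓕⁻ (fun η => conjState n₁ n₂ (f (-η))) x := by
  rw [Real.fourierInv_eq_fourier_neg, conjState_fourier hf, neg_neg,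
    Real.fourierInv_eq_fourier_comp_neg]
  simp only [neg_neg]

end Reality

/-! ### Integrable symbols: pointwise formula and preservation of real functions -/

section IntegrableMultiplier

open scoped Matrix.Norms.L2Operator

variable {m n₁ n₂ : ℕ}

lemma integrable_vecToC {w : L2 m n₁ n₂} (hw : MemLp w 1 volume) :
    Integrable (fun x => vecToC (w x)) volume :=
  (complexify n₁ n₂).integrable_comp (memLp_one_iff_integrable.1 hw)

lemma fourier_complexifyL2_ae_eq {w : L2 m n₁ n₂} (hw : MemLp w 1 volume) :
    (𝓕 (complexifyL2 m n₁ n₂ w) : CL2 m n₁ n₂) =ᵐ[volume] 𝓕 fun x => vecToC (w x) := by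
  have h1 : Integrable (complexifyL2 m n₁ n₂ w) volume :=
    (integrable_vecToC hw).congr (coeFn_complexifyL2 w).symm
  refine (Lp_fourier_ae_eq _ h1).trans (Eventually.of_forall fun η => ?_)
  rw [Real.fourier_eq, Real.fourier_eq]
  refine integral_congr_ae ?_
  filter_upwards [coeFn_complexifyL2 w] with x hx
  rw [hx]

lemma norm_fourier_le_integral {F : Type*} [NormedAddCommGroup F] [NormedSpace ℂ F]
    (f : Space m → F) (η : Space m) : ‖𝓕 f η‖ ≤ ∫ x, ‖f x‖ :=
  VectorFourier.norm_fourierIntegral_le_integral_norm _ _ _ _ _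

lemma aestronglyMeasurable_fourier {f : Space m → CState n₁ n₂} (hf : Integrable f volume) :
    AEStronglyMeasurable (𝓕 f) volume :=
  (VectorFourier.fourierIntegral_continuous Real.continuous_fourierChar
    (by exact continuous_inner) hf).aestronglyMeasurable

lemma integrable_cact_fourier {σ : Space m → CMat n₁ n₂} (hσ : Integrable σ volume)
    {f : Space m → CState n₁ n₂} (hf : Integrable f volume) :
    Integrable (fun η => cact (σ η) (𝓕 f η)) volume := by
  refine (hσ.norm.mul_const (∫ x, ‖f x‖)).mono'
    (aestronglyMeasurable_cact hσ.aestronglyMeasurable (aestronglyMeasurable_fourier hf))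
    (Eventually.of_forall fun η => ?_)
  refine (norm_cact_le _ _).trans ?_
  gcongr
  exact norm_fourier_le_integral f η

lemma coeFn_mulSymbol_fourier {σ : Space m → CMat n₁ n₂} (hσ : IsMultiplier σ)
    {w : L2 m n₁ n₂} (hw : MemLp w 1 volume) :
    mulSymbol σ (𝓕 (complexifyL2 m n₁ n₂ w)) =ᵐ[volume]
      fun η => cact (σ η) (𝓕 (fun x => vecToC (w x)) η) := by
  filter_upwards [coeFn_mulSymbol hσ (𝓕 (complexifyL2 m n₁ n₂ w)),
    fourier_complexifyL2_ae_eq hw] with η h1 h2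
  rw [h1, h2]

lemma complexMultiplier_ae_eq {σ : Space m → CMat n₁ n₂} (hσ : IsMultiplier σ)
    (hσ' : Integrable σ volume) {w : L2 m n₁ n₂} (hw : MemLp w 1 volume) :
    complexMultiplier σ w =ᵐ[volume]
      𝓕⁻ fun η => cact (σ η) (𝓕 (fun x => vecToC (w x)) η) := by
  have h1 := coeFn_mulSymbol_fourier hσ hw
  have h2 : Integrable (mulSymbol σ (𝓕 (complexifyL2 m n₁ n₂ w))) volume :=
    (integrable_cact_fourier hσ' (integrable_vecToC hw)).congr h1.symm
  refine (Lp_fourierInv_ae_eq _ h2).trans (Eventually.of_forall fun x => ?_)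
  rw [Real.fourierInv_eq, Real.fourierInv_eq]
  refine integral_congr_ae ?_
  filter_upwards [h1] with η hη
  rw [hη]

/-- Conjugation reverses the frequency; the symmetry of σ and that of the transform of a real
function undo this. -/
lemma conjState_multiplier {σ : Space m → CMat n₁ n₂} (hσ : Integrable σ volume)
    (hsymm : ∀ η, σ (-η) = conjMat (σ η)) {w : L2 m n₁ n₂} (hw : MemLp w 1 volume) (x : Space m) :
    conjState n₁ n₂ (𝓕⁻ (fun η => cact (σ η) (𝓕 (fun x => vecToC (w x)) η)) x) =
      𝓕⁻ (fun η => cact (σ η) (𝓕 (fun x => vecToC (w x)) η)) x := by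
  rw [conjState_fourierInv (integrable_cact_fourier hσ (integrable_vecToC hw))]
  refine congrFun (congrArg _ (funext fun η => ?_)) x
  rw [conjState_cact, ← hsymm, neg_neg, conjState_fourier (integrable_vecToC hw), neg_neg]
  simp only [conjState_vecToC]

/-- A multiplier with a Hermitian integrable symbol maps real functions to real functions. -/
lemma vecToC_fourierMultiplier {σ : Space m → CMat n₁ n₂} (hσ : IsMultiplier σ)
    (hσ' : Integrable σ volume) (hsymm : ∀ η, σ (-η) = conjMat (σ η)) {w : L2 m n₁ n₂}
    (hw : MemLp w 1 volume) :
    ∀ᵐ x, vecToC (fourierMultiplier σ w x) =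
      𝓕⁻ (fun η => cact (σ η) (𝓕 (fun x => vecToC (w x)) η)) x := by
  filter_upwards [coeFn_realPartL2 (complexMultiplier σ w), complexMultiplier_ae_eq hσ hσ' hw]
    with x h1 h2
  rw [fourierMultiplier_apply, h1, h2]
  exact vecToC_realPart (conjState_multiplier hσ' hsymm hw x)

end IntegrableMultiplier

/-! ### Gaussian integrals and interpolation -/

section GaussianBounds

variable {m : ℕ}

lemma integral_gaussian {q : ℝ} (hq : 0 < q) :
    ∫ η : Space m, Real.exp (-q * ‖η‖ ^ 2) = (Real.pi / q) ^ ((m : ℝ) / 2) := by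
  rw [GaussianFourier.integral_rexp_neg_mul_sq_norm hq]
  simp

lemma integrable_gaussian {q : ℝ} (hq : 0 < q) :
    Integrable fun η : Space m => Real.exp (-q * ‖η‖ ^ 2) := by
  -- The integral of a nonintegrable function is 0 by convention, so a nonzero value proves
  -- integrability.
  refine Integrable.of_integral_ne_zero ?_
  rw [integral_gaussian hq]
  positivity

/-- Interpolation between `L²` and `L^∞`. -/
lemma eLpNorm_le_of_two_of_top {α F : Type*} [MeasurableSpace α] {μ : Measure α}
    [NormedAddCommGroup F] {f : α → F} {S T N : ℝ} (hS : 0 ≤ S) (hT : 0 < T)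
    (h2 : eLpNorm f 2 μ ≤ ENNReal.ofReal (S * T ^ (-(N / 2))))
    (htop : ∀ᵐ x ∂μ, ‖f x‖ ≤ S * T ^ (-N)) {p : ℝ≥0∞} (hp : 2 ≤ p) :
    eLpNorm f p μ ≤ ENNReal.ofReal (S * T ^ (-(N * (1 - (p⁻¹).toReal)))) := by
  rcases eq_or_ne p ∞ with rfl | hp'
  · rw [eLpNorm_exponent_top]
    refine (eLpNormEssSup_le_of_ae_bound htop).trans ?_
    simp
  set P := p.toReal with hP
  have hP2 : 2 ≤ P := by
    rw [hP, ← ENNReal.toReal_ofNat]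
    exact ENNReal.toReal_mono hp' hp
  have hp0 : p ≠ 0 := (lt_of_lt_of_le (by norm_num) hp).ne'
  set M : ℝ := S * T ^ (-N) with hM
  set L : ℝ := S * T ^ (-(N / 2)) with hL
  have hM0 : 0 ≤ M := by positivity
  have hL0 : 0 ≤ L := by positivity
  have hsq : ∫⁻ x, ‖f x‖ₑ ^ (2 : ℝ) ∂μ ≤ ENNReal.ofReal L ^ (2 : ℝ) := by
    rw [eLpNorm_eq_lintegral_rpow_enorm_toReal two_ne_zero ENNReal.ofNat_ne_top,
      ENNReal.toReal_ofNat] at h2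
    have h3 := ENNReal.rpow_le_rpow h2 (zero_le_two (α := ℝ))
    rwa [← ENNReal.rpow_mul, one_div, inv_mul_cancel₀ two_ne_zero, ENNReal.rpow_one] at h3
  -- Interpolation by |f|^P ≤ M^{P-2}|f|². The exponents of T add up to -N(P-2) - N = -N(P-1).
  have hint : ∫⁻ x, ‖f x‖ₑ ^ P ∂μ ≤
      ENNReal.ofReal M ^ (P - 2) * ENNReal.ofReal L ^ (2 : ℝ) := by
    calc _ ≤ ∫⁻ x, ENNReal.ofReal M ^ (P - 2) * ‖f x‖ₑ ^ (2 : ℝ) ∂μ := by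
          refine lintegral_mono_ae ?_
          filter_upwards [htop] with x hx
          have h1 : ‖f x‖ₑ ≤ ENNReal.ofReal M := by
            rw [← ofReal_norm]
            exact ENNReal.ofReal_le_ofReal hx
          calc ‖f x‖ₑ ^ P = ‖f x‖ₑ ^ (P - 2) * ‖f x‖ₑ ^ (2 : ℝ) := by
                rw [← ENNReal.rpow_add_of_nonneg _ _ (by linarith) (by norm_num), sub_add_cancel]
            _ ≤ _ := by gcongr
      _ = ENNReal.ofReal M ^ (P - 2) * ∫⁻ x, ‖f x‖ₑ ^ (2 : ℝ) ∂μ :=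
          lintegral_const_mul' _ _ (ENNReal.rpow_ne_top_of_nonneg (by linarith) ENNReal.ofReal_ne_top)
      _ ≤ _ := by gcongr
  rw [eLpNorm_eq_lintegral_rpow_enorm_toReal hp0 hp', ← hP]
  calc _ ≤ (ENNReal.ofReal M ^ (P - 2) * ENNReal.ofReal L ^ (2 : ℝ)) ^ (1 / P) := by gcongr
    _ = ENNReal.ofReal ((M ^ (P - 2) * L ^ (2 : ℝ)) ^ (1 / P)) := by
      rw [ENNReal.ofReal_rpow_of_nonneg hM0 (by linarith),
        ENNReal.ofReal_rpow_of_nonneg hL0 (by norm_num), ← ENNReal.ofReal_mul (by positivity),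
        ENNReal.ofReal_rpow_of_nonneg (by positivity) (by positivity)]
    _ ≤ _ := by
      refine ENNReal.ofReal_le_ofReal (le_of_eq ?_)
      have hpinv : (p⁻¹).toReal = 1 / P := by rw [ENNReal.toReal_inv, one_div]
      have h1 : M ^ (P - 2) * L ^ (2 : ℝ) = S ^ P * T ^ (-(N * (P - 1))) := by
        rw [hM, hL, Real.mul_rpow hS (by positivity), Real.mul_rpow hS (by positivity),
          ← Real.rpow_mul hT.le, ← Real.rpow_mul hT.le]
        have h2 : S ^ P = S ^ (P - 2) * S ^ (2 : ℝ) := by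
          rw [← Real.rpow_add' hS (by linarith), sub_add_cancel]
        have h3 : T ^ (-(N * (P - 1))) = T ^ (-N * (P - 2)) * T ^ (-(N / 2) * 2) := by
          rw [← Real.rpow_add hT]
          congr 1
          ring
        rw [h2, h3]
        ring
      have hP0 : P ≠ 0 := by linarith
      rw [h1, hpinv, Real.mul_rpow (by positivity) (by positivity), ← Real.rpow_mul hS,
        ← Real.rpow_mul hT.le, mul_one_div_cancel hP0, Real.rpow_one]
      congr 2
      field_simp

end GaussianBounds

/-! ### From Gaussian bounds on the Fourier side to decay in L^p -/

section GaussianDecay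

variable {m n₁ n₂ : ℕ}

lemma norm_fourierInv_le_integral {F : Type*} [NormedAddCommGroup F] [NormedSpace ℂ F]
    (f : Space m → F) (x : Space m) : ‖𝓕⁻ f x‖ ≤ ∫ η, ‖f η‖ :=
  VectorFourier.norm_fourierIntegral_le_integral_norm _ _ _ _ _

lemma eLpNorm_fourierInv_two {h : Space m → CState n₁ n₂} (h1 : Integrable h volume)
    (h2 : MemLp h 2 volume) : eLpNorm (𝓕⁻ h) 2 volume = eLpNorm h 2 volume := by
  have hint : Integrable h2.toLp volume := h1.congr h2.coeFn_toLp.symm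
  have hae : (𝓕⁻ h2.toLp : CL2 m n₁ n₂) =ᵐ[volume] 𝓕⁻ h := by
    refine (Lp_fourierInv_ae_eq _ hint).trans (Eventually.of_forall fun x => ?_)
    rw [Real.fourierInv_eq, Real.fourierInv_eq]
    refine integral_congr_ae ?_
    filter_upwards [h2.coeFn_toLp] with η hη
    rw [hη]
  have hnorm : ‖(𝓕⁻ h2.toLp : CL2 m n₁ n₂)‖ = ‖h2.toLp‖ := by
    rw [← Lp.norm_fourier_eq, FourierTransform.fourier_fourierInv_eq]
  rw [← eLpNorm_congr_ae hae, ← eLpNorm_congr_ae h2.coeFn_toLp, ← Lp.enorm_def, ← Lp.enorm_def,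
    ← ofReal_norm, ← ofReal_norm, hnorm]

/-- The constant in the `L^p` estimates of functions with a Gaussian bound on the Fourier side. -/
def gaussianConst (m : ℕ) (q : ℝ) : ℝ :=
  (Real.pi / q) ^ ((m : ℝ) / 2) + ((Real.pi / (2 * q)) ^ ((m : ℝ) / 2)) ^ (2⁻¹ : ℝ)

lemma gaussianConst_pos (m : ℕ) {q : ℝ} (hq : 0 < q) : 0 < gaussianConst m q := by
  unfold gaussianConst
  positivity

/-- `L^p` estimate of functions with a Gaussian bound on the Fourier side. -/
lemma eLpNorm_fourierInv_le {h : Space m → CState n₁ n₂} (hm : AEStronglyMeasurable h volume)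
    {S q T : ℝ} (hS : 0 ≤ S) (hq : 0 < q) (hT : 0 < T)
    (hh : ∀ η, ‖h η‖ ≤ S * Real.exp (-(q * T) * ‖η‖ ^ 2)) {p : ℝ≥0∞} (hp : 2 ≤ p) :
    eLpNorm (𝓕⁻ h) p volume ≤
      ENNReal.ofReal (S * gaussianConst m q * T ^ (-((m : ℝ) / 2 * (1 - (p⁻¹).toReal)))) := by
  have hqT : 0 < q * T := by positivity
  have hg1 : Integrable (fun η : Space m => S * Real.exp (-(q * T) * ‖η‖ ^ 2)) volume :=
    (integrable_gaussian hqT).const_mul S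
  have hsq : ∀ η : Space m, (S * Real.exp (-(q * T) * ‖η‖ ^ 2)) ^ 2 =
      S ^ 2 * Real.exp (-(2 * (q * T)) * ‖η‖ ^ 2) := by
    intro η
    rw [mul_pow, ← Real.exp_nat_mul]
    congr 2
    push_cast
    ring
  have hg2 : MemLp (fun η : Space m => S * Real.exp (-(q * T) * ‖η‖ ^ 2)) 2 volume := by
    rw [memLp_two_iff_integrable_sq hg1.aestronglyMeasurable]
    simp_rw [hsq]
    exact (integrable_gaussian (by positivity)).const_mul _
  have h1 : Integrable h volume := hg1.mono' hm (Eventually.of_forall hh)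
  have hnn : ∀ η : Space m, 0 ≤ S * Real.exp (-(q * T) * ‖η‖ ^ 2) := fun η => by positivity
  have h2 : MemLp h 2 volume := hg2.mono hm (Eventually.of_forall fun η =>
    (hh η).trans (le_abs_self _))
  have hG1 : (Real.pi / q) ^ ((m : ℝ) / 2) ≤ gaussianConst m q := by
    unfold gaussianConst
    have : 0 ≤ ((Real.pi / (2 * q)) ^ ((m : ℝ) / 2)) ^ (2⁻¹ : ℝ) := by positivity
    linarith
  have hG2 : ((Real.pi / (2 * q)) ^ ((m : ℝ) / 2)) ^ (2⁻¹ : ℝ) ≤ gaussianConst m q := by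
    unfold gaussianConst
    have : 0 ≤ (Real.pi / q) ^ ((m : ℝ) / 2) := by positivity
    linarith
  have hG0 := (gaussianConst_pos m hq).le
  -- Here N = m/2: Plancherel at p = 2, and at p = ∞ the L¹ norm of the Fourier side. The two
  -- summands of `gaussianConst` come from these end points.
  refine eLpNorm_le_of_two_of_top (by positivity) hT ?_ ?_ hp
  · rw [eLpNorm_fourierInv_two h1 h2]
    refine (eLpNorm_mono_ae (g := fun η : Space m => S * Real.exp (-(q * T) * ‖η‖ ^ 2))
      (Eventually.of_forall fun η =>
      (hh η).trans (le_abs_self _))).trans ?_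
    rw [hg2.eLpNorm_eq_integral_rpow_norm two_ne_zero ENNReal.ofNat_ne_top]
    refine ENNReal.ofReal_le_ofReal ?_
    simp only [ENNReal.toReal_ofNat, Real.rpow_two, Real.norm_eq_abs, sq_abs, hsq]
    rw [integral_const_mul, integral_gaussian (by positivity),
      Real.mul_rpow (by positivity) (by positivity), ← Real.rpow_natCast S 2, ← Real.rpow_mul hS,
      Nat.cast_ofNat, mul_inv_cancel₀ two_ne_zero, Real.rpow_one, mul_assoc]
    gcongr
    have h3 : Real.pi / (2 * (q * T)) = Real.pi / (2 * q) * T⁻¹ := by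
      field_simp
    rw [h3, Real.mul_rpow (by positivity) (by positivity),
      Real.mul_rpow (by positivity) (by positivity), Real.inv_rpow hT.le, ← Real.rpow_neg hT.le,
      ← Real.rpow_mul hT.le (-((m : ℝ) / 2)), show -((m : ℝ) / 2) * 2⁻¹ = -((m : ℝ) / 2 / 2) by ring]
    gcongr
  · refine Eventually.of_forall fun x => (norm_fourierInv_le_integral h x).trans ?_
    calc ∫ η, ‖h η‖ ≤ ∫ η : Space m, S * Real.exp (-(q * T) * ‖η‖ ^ 2) :=
          integral_mono h1.norm hg1 hh
      _ = S * (Real.pi / q) ^ ((m : ℝ) / 2) * T ^ (-((m : ℝ) / 2)) := by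
        rw [integral_const_mul, integral_gaussian hqT, mul_assoc, Real.rpow_neg hT.le,
          ← Real.inv_rpow hT.le, ← Real.mul_rpow (by positivity) (by positivity)]
        congr 2
        field_simp
      _ ≤ _ := by gcongr

/-- The power of max{1, t} treats short and long times at once and avoids the singularity of t^{-s}
at t = 0. -/
lemma decay_eq {t s : ℝ} (hs : 0 ≤ s) :
    decay t s = ENNReal.ofReal (max 1 t ^ (-s)) := by
  unfold decay
  rcases le_total t 1 with h | h
  · rw [max_eq_left h, Real.one_rpow, ENNReal.ofReal_one, min_eq_left]
    rw [ENNReal.rpow_neg, ENNReal.one_le_inv]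
    exact ENNReal.rpow_le_one (ENNReal.ofReal_le_one.2 h) hs
  · rw [max_eq_right h, ENNReal.ofReal_rpow_of_pos (by linarith), min_eq_right]
    rw [← ENNReal.ofReal_one]
    exact ENNReal.ofReal_le_ofReal (Real.rpow_le_one_of_one_le_of_nonpos h (by linarith))

/-- The constant in the comparison of powers times Gaussians with slower Gaussians. -/
def heatConst (a c : ℝ) (k : ℕ) : ℝ := Real.exp (c * a ^ 2) * (k.factorial * Real.exp (1 / (2 * c)))

lemma heatConst_mono (a c : ℝ) : Monotone (heatConst a c) := by
  intro k l hkl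
  unfold heatConst
  have : (k.factorial : ℝ) ≤ l.factorial := by exact_mod_cast Nat.factorial_le hkl
  gcongr

lemma heatConst_pos (a c : ℝ) (k : ℕ) : 0 < heatConst a c k := by
  unfold heatConst
  positivity

/-- In y = ρ√T, T = max{1, t}, one has y^k ≤ k!·e^y, and e^y is absorbed by half of the Gaussian by
completing the square. Replacing t by T ≤ t + 1 costs e^{ca²}, as ρ ≤ a. -/
lemma pow_mul_exp_le {a c ρ t : ℝ} (hc : 0 < c) (hρ : 0 ≤ ρ) (hρa : ρ ≤ a) (ht : 0 ≤ t) (k : ℕ) :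
    ρ ^ k * Real.exp (-(c * ρ ^ 2 * t)) ≤
      heatConst a c k * max 1 t ^ (-((k : ℝ) / 2)) * Real.exp (-(c / 2 * ρ ^ 2 * max 1 t)) := by
  set T := max 1 t with hT
  have hT0 : 0 < T := lt_of_lt_of_le one_pos (le_max_left _ _)
  set y := ρ * Real.sqrt T with hy
  have hy0 : 0 ≤ y := by positivity
  have hy2 : y ^ 2 = ρ ^ 2 * T := by rw [hy, mul_pow, Real.sq_sqrt hT0.le]
  have hpow : ρ ^ k = y ^ k * T ^ (-((k : ℝ) / 2)) := by
    have h1 : Real.sqrt T ^ k = T ^ ((k : ℝ) / 2) := by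
      rw [Real.sqrt_eq_rpow, ← Real.rpow_natCast, ← Real.rpow_mul hT0.le]
      congr 1
      ring
    rw [hy, mul_pow, h1, mul_assoc, ← Real.rpow_add hT0, add_neg_cancel, Real.rpow_zero, mul_one]
  have hexp1 : Real.exp (-(c * ρ ^ 2 * t)) ≤ Real.exp (c * a ^ 2) * Real.exp (-(c * y ^ 2)) := by
    rw [← Real.exp_add, hy2]
    refine Real.exp_le_exp.2 ?_
    have h1 : ρ ^ 2 ≤ a ^ 2 := pow_le_pow_left₀ hρ hρa 2
    have h2 : T ≤ t + 1 := max_le (by linarith) (by linarith)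
    nlinarith [mul_nonneg hc.le (sub_nonneg.2 h1),
      mul_nonneg (mul_nonneg hc.le (sq_nonneg ρ)) (sub_nonneg.2 h2)]
  have hexp2 : y ^ k ≤ k.factorial * Real.exp y := by
    have := Real.pow_div_factorial_le_exp y hy0 k
    rwa [div_le_iff₀' (by positivity)] at this
  have hexp3 : Real.exp y ≤ Real.exp (1 / (2 * c)) * Real.exp (c / 2 * y ^ 2) := by
    rw [← Real.exp_add]
    refine Real.exp_le_exp.2 ?_
    have h1 : 1 / (2 * c) + c / 2 * y ^ 2 - y = (c * y - 1) ^ 2 / (2 * c) := by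
      field_simp
      ring
    have h2 : 0 ≤ (c * y - 1) ^ 2 / (2 * c) := by positivity
    linarith
  calc _ ≤ (k.factorial * (Real.exp (1 / (2 * c)) * Real.exp (c / 2 * y ^ 2))) *
        T ^ (-((k : ℝ) / 2)) * (Real.exp (c * a ^ 2) * Real.exp (-(c * y ^ 2))) := by
        rw [hpow]
        gcongr
        exact hexp2.trans (by gcongr)
    _ = heatConst a c k * T ^ (-((k : ℝ) / 2)) *
        (Real.exp (c / 2 * y ^ 2) * Real.exp (-(c * y ^ 2))) := by
        unfold heatConst
        ring
    _ = _ := by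
        rw [← Real.exp_add, hy2]
        congr 2
        ring

end GaussianDecay

/-! ### The operator K(t) and its derivatives -/

section LowFrequency

open scoped Matrix.Norms.L2Operator

variable {m n₁ n₂ : ℕ}

/-- The symbol of `K(t)` at frequency `2πη` (constant for `t ≤ 0`). -/
def lowSymbol (A : Fin m → Mat n₁ n₂) (B : Mat n₁ n₂) (r a t : ℝ) (η : Space m) : CMat n₁ n₂ :=
  lowMultiplier A B r a (max t 0) ((2 * Real.pi) • η)

/-- The symbol of `D^β K(t)`. -/
def derivLowSymbol (A : Fin m → Mat n₁ n₂) (B : Mat n₁ n₂) (r a : ℝ) (β : Fin m → ℕ) (t : ℝ)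
    (η : Space m) : CMat n₁ n₂ :=
  derivSymbol β η • lowSymbol A B r a t η

lemma lowSymbol_eq_zero {A : Fin m → Mat n₁ n₂} {B : Mat n₁ n₂} {r a t : ℝ} {η : Space m}
    (h : a < ‖(2 * Real.pi) • η‖) : lowSymbol A B r a t η = 0 := by
  rw [lowSymbol, lowMultiplier, if_neg (not_le.2 h)]

lemma norm_two_pi_smul (η : Space m) : ‖(2 * Real.pi) • η‖ = 2 * Real.pi * ‖η‖ := by
  rw [norm_smul, Real.norm_of_nonneg (by positivity)]

variable {A : Fin m → Mat n₁ n₂} {B : Mat n₁ n₂} {r a C c : ℝ}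

lemma SpectralBounds.norm_lowSymbol_le (h : SpectralBounds A B r a C c) (t : ℝ) (η : Space m) :
    ‖lowSymbol A B r a t η‖ ≤ 1 + C := by
  have h1 := h.contraction ((2 * Real.pi) • η) (max t 0) (le_max_right _ _)
  have h2 := h.remainder ((2 * Real.pi) • η) (max t 0) (le_max_right _ _)
  have h3 : Real.exp (-(c * max t 0)) ≤ 1 := by
    rw [Real.exp_le_one_iff, neg_nonpos]
    exact mul_nonneg h.pos_c.le (le_max_right _ _)
  have h4 := norm_sub_norm_le (lowSymbol A B r a t η)
    (NormedSpace.exp (((max t 0 : ℝ) : ℂ) • symbol A B ((2 * Real.pi) • η)))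
  rw [norm_sub_rev] at h4
  have h5 := mul_le_of_le_one_right h.pos_C.le h3
  unfold lowSymbol at h4 ⊢
  linarith

lemma SpectralBounds.norm_derivLowSymbol_le (h : SpectralBounds A B r a C c) (β : Fin m → ℕ)
    (t : ℝ) (η : Space m) : ‖derivLowSymbol A B r a β t η‖ ≤ a ^ order β * (1 + C) := by
  have hC := h.pos_C
  have ha := h.pos_a
  rcases le_or_gt ‖(2 * Real.pi) • η‖ a with hη | hη
  · rw [derivLowSymbol, norm_smul]
    gcongr
    · exact (norm_derivSymbol_le β η).trans (by gcongr)
    · exact h.norm_lowSymbol_le t η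
  · rw [derivLowSymbol, lowSymbol_eq_zero hη, smul_zero, norm_zero]
    positivity

lemma SpectralBounds.isMultiplier_derivLowSymbol (h : SpectralBounds A B r a C c)
    (β : Fin m → ℕ) (t : ℝ) : IsMultiplier (derivLowSymbol A B r a β t) :=
  ⟨(continuous_derivSymbol β).aestronglyMeasurable.smul
    (aestronglyMeasurable_lowMultiplier h.continuousOn _), _, h.norm_derivLowSymbol_le β t⟩

lemma SpectralBounds.integrable_derivLowSymbol (h : SpectralBounds A B r a C c)
    (β : Fin m → ℕ) (t : ℝ) : Integrable (derivLowSymbol A B r a β t) volume := by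
  have h1 : IntegrableOn (derivLowSymbol A B r a β t) (Metric.closedBall 0 (a / (2 * Real.pi)))
      volume :=
    Measure.integrableOn_of_bounded (M := a ^ order β * (1 + C)) measure_closedBall_lt_top.ne
      (h.isMultiplier_derivLowSymbol β t).1
      (Eventually.of_forall (h.norm_derivLowSymbol_le β t))
  refine h1.integrable_of_forall_notMem_eq_zero fun η hη => ?_
  have h2 : a < ‖(2 * Real.pi) • η‖ := by
    rw [norm_two_pi_smul]
    rw [Metric.mem_closedBall, dist_zero_right, not_le, div_lt_iff₀' (by positivity)] at hη
    exact hη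
  rw [derivLowSymbol, lowSymbol_eq_zero h2, smul_zero]

lemma derivLowSymbol_zero (A : Fin m → Mat n₁ n₂) (B : Mat n₁ n₂) (r a t : ℝ) :
    derivLowSymbol A B r a 0 t = lowSymbol A B r a t := by
  ext1 η
  simp [derivLowSymbol, derivSymbol]

lemma SpectralBounds.isMultiplier_lowSymbol (h : SpectralBounds A B r a C c) (t : ℝ) :
    IsMultiplier (lowSymbol A B r a t) :=
  derivLowSymbol_zero A B r a t ▸ h.isMultiplier_derivLowSymbol 0 t

lemma SpectralBounds.integrable_lowSymbol (h : SpectralBounds A B r a C c) (t : ℝ) :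
    Integrable (lowSymbol A B r a t) volume :=
  derivLowSymbol_zero A B r a t ▸ h.integrable_derivLowSymbol 0 t

lemma SpectralBounds.vecToC_low_ae_eq (h : SpectralBounds A B r a C c) {w : L2 m n₁ n₂}
    (hw : MemLp w 1 volume) {t : ℝ} (ht : 0 ≤ t) :
    ∀ᵐ x, vecToC (fourierMultiplier (lowSymbol A B r a t) w x) = lowFreq A B r a t w x := by
  have h1 := vecToC_fourierMultiplier (h.isMultiplier_lowSymbol t) (h.integrable_lowSymbol t)
    (fun η => by rw [lowSymbol, lowSymbol, smul_neg, lowMultiplier_neg]) hw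
  unfold lowSymbol at h1
  rw [max_eq_left ht] at h1
  unfold lowSymbol
  rw [max_eq_left ht]
  exact h1

lemma SpectralBounds.hasWeakDeriv_low (h : SpectralBounds A B r a C c) (β : Fin m → ℕ)
    (w : L2 m n₁ n₂) (t : ℝ) : HasWeakDeriv β (fourierMultiplier (lowSymbol A B r a t) w)
      (fourierMultiplier (derivLowSymbol A B r a β t) w) := by
  rw [fourierMultiplier_apply, fourierMultiplier_apply]
  refine hasWeakDeriv_realPartL2 ?_
  rw [fourier_complexMultiplier, fourier_complexMultiplier]
  filter_upwards [coeFn_mulSymbol (h.isMultiplier_derivLowSymbol β t)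
    (𝓕 (complexifyL2 m n₁ n₂ w)), coeFn_mulSymbol (h.isMultiplier_lowSymbol t)
    (𝓕 (complexifyL2 m n₁ n₂ w))] with η h1 h2
  rw [h1, h2, derivLowSymbol, cact_smul]

end LowFrequency

/-! ### The L^p estimates of K(t) -/

section LowFrequencyEstimate

open scoped Matrix.Norms.L2Operator

variable {m n₁ n₂ : ℕ}

lemma cact_fourier (M : CMat n₁ n₂) {f : Space m → CState n₁ n₂} (hf : Integrable f volume)
    (η : Space m) : cact M (𝓕 f η) = 𝓕 (fun x => cact M (f x)) η := by
  rw [cact_eq_toEuclideanCLM, Real.fourier_eq, Real.fourier_eq,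
    ← (Matrix.toEuclideanCLM (𝕜 := ℂ) M).integral_comp_comm
      ((Real.fourierIntegral_convergent_iff η).2 hf)]
  simp only [Circle.smul_def, map_smul, cact_eq_toEuclideanCLM]

lemma cact_fourierInv (M : CMat n₁ n₂) {f : Space m → CState n₁ n₂} (hf : Integrable f volume)
    (x : Space m) : cact M (𝓕⁻ f x) = 𝓕⁻ (fun η => cact M (f η)) x := by
  rw [Real.fourierInv_eq_fourier_neg, Real.fourierInv_eq_fourier_neg, cact_fourier M hf]

lemma integrable_cact (M : CMat n₁ n₂) {f : Space m → CState n₁ n₂} (hf : Integrable f volume) :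
    Integrable (fun x => cact M (f x)) volume := by
  simp_rw [cact_eq_toEuclideanCLM]
  exact (Matrix.toEuclideanCLM (𝕜 := ℂ) M).integrable_comp hf

lemma norm_cact_projC_vecToC (v : State n₁ n₂) : ‖cact projC (vecToC v)‖ = ‖L₀ v‖ := by
  simp [EuclideanSpace.norm_eq, Fintype.sum_sum_type, projC_apply_inl, projC_apply_inr, L₀, vecToC]

lemma norm_cact_projD_vecToC (v : State n₁ n₂) : ‖cact projD (vecToC v)‖ = ‖Lminus v‖ := by
  simp [EuclideanSpace.norm_eq, Fintype.sum_sum_type, projD_apply_inl, projD_apply_inr, Lminus,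
    vecToC]

lemma norm_L₀_realPart_le (u : CState n₁ n₂) : ‖L₀ (realPart n₁ n₂ u)‖ ≤ ‖cact projC u‖ := by
  rw [EuclideanSpace.norm_eq, EuclideanSpace.norm_eq, Fintype.sum_sum_type]
  simp only [projC_apply_inl, projC_apply_inr, norm_zero, ne_eq, OfNat.ofNat_ne_zero,
    not_false_eq_true, zero_pow, Finset.sum_const_zero, add_zero]
  refine Real.sqrt_le_sqrt (Finset.sum_le_sum fun i _ => ?_)
  gcongr
  exact Complex.abs_re_le_norm _

lemma norm_Lminus_realPart_le (u : CState n₁ n₂) :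
    ‖Lminus (realPart n₁ n₂ u)‖ ≤ ‖cact projD u‖ := by
  rw [EuclideanSpace.norm_eq, EuclideanSpace.norm_eq, Fintype.sum_sum_type]
  simp only [projD_apply_inl, projD_apply_inr, norm_zero, ne_eq, OfNat.ofNat_ne_zero,
    not_false_eq_true, zero_pow, Finset.sum_const_zero, zero_add]
  refine Real.sqrt_le_sqrt (Finset.sum_le_sum fun i _ => ?_)
  gcongr
  exact Complex.abs_re_le_norm _

lemma ofReal_integral_norm_eq {F : Type*} [NormedAddCommGroup F] {f : Space m → F}
    (hf : Integrable f volume) :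
    ENNReal.ofReal (∫ x, ‖f x‖) = eLpNorm f 1 volume := by
  rw [ofReal_integral_norm_eq_lintegral_enorm hf, eLpNorm_one_eq_lintegral_enorm]

lemma rate_nonneg (m : ℕ) {p : ℝ≥0∞} (hp : 2 ≤ p) (b : ℕ) : 0 ≤ rate m p b := by
  have h1 : (p⁻¹).toReal ≤ 1 := by
    rw [← ENNReal.toReal_one]
    refine ENNReal.toReal_mono ENNReal.one_ne_top (ENNReal.inv_le_one.2 ?_)
    exact le_trans (by norm_num) hp
  unfold rate
  have : 0 ≤ 1 - (p⁻¹).toReal := by linarith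
  positivity

variable {A : Fin m → Mat n₁ n₂} {B : Mat n₁ n₂} {r a C c : ℝ}

/-- The constant in the estimates of `D^β K(t)`, depending on `|β|`. -/
def lowConst (m : ℕ) (a C c : ℝ) (b : ℕ) : ℝ :=
  C * heatConst a c (b + 2) * gaussianConst m (c / 2 * (2 * Real.pi) ^ 2)

/-- Pointwise bound of one block row (`X = projC`, `i = 0` or `X = projD`, `i = 1`) of the symbol of
`D^β K(t)`. -/
lemma SpectralBounds.norm_block_le (h : SpectralBounds A B r a C c) (β : Fin m → ℕ)
    {X : CMat n₁ n₂} {i : ℕ} (hi : i ≤ 1)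
    (hXC : ∀ ξ : Space m, ∀ t : ℝ, 0 ≤ t → ‖X * lowMultiplier A B r a t ξ * projC‖ ≤
      C * ‖ξ‖ ^ i * Real.exp (-(c * ‖ξ‖ ^ 2 * t)))
    (hXD : ∀ ξ : Space m, ∀ t : ℝ, 0 ≤ t → ‖X * lowMultiplier A B r a t ξ * projD‖ ≤
      C * ‖ξ‖ ^ (i + 1) * Real.exp (-(c * ‖ξ‖ ^ 2 * t)))
    {t : ℝ} (ht : 0 ≤ t) {Sc Sd : ℝ} (u : CState n₁ n₂) (hSc : ‖cact projC u‖ ≤ Sc)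
    (hSd : ‖cact projD u‖ ≤ Sd) (η : Space m) :
    ‖cact X (cact (derivLowSymbol A B r a β t η) u)‖ ≤
      C * heatConst a c (order β + 2) * (max 1 t ^ (-(((order β + i : ℕ) : ℝ) / 2)) * Sc +
        max 1 t ^ (-(((order β + (i + 1) : ℕ) : ℝ) / 2)) * Sd) *
      Real.exp (-(c / 2 * (2 * Real.pi) ^ 2 * max 1 t) * ‖η‖ ^ 2) := by
  have hC := h.pos_C
  have hc := h.pos_c
  have hSc0 : 0 ≤ Sc := (norm_nonneg _).trans hSc
  have hSd0 : 0 ≤ Sd := (norm_nonneg _).trans hSd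
  have hH0 := heatConst_pos a c (order β + 2)
  have hT0 : 0 < max 1 t := lt_of_lt_of_le one_pos (le_max_left _ _)
  rcases le_or_gt ‖(2 * Real.pi) • η‖ a with hη | hη
  · set ξ := (2 * Real.pi) • η with hξ
    have hlow : lowSymbol A B r a t η = lowMultiplier A B r a t ξ := by
      rw [lowSymbol, max_eq_left ht]
    have hE : Real.exp (-(c / 2 * ‖ξ‖ ^ 2 * max 1 t)) =
        Real.exp (-(c / 2 * (2 * Real.pi) ^ 2 * max 1 t) * ‖η‖ ^ 2) := by
      congr 1
      rw [hξ, norm_two_pi_smul]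
      ring
    set E := Real.exp (-(c / 2 * (2 * Real.pi) ^ 2 * max 1 t) * ‖η‖ ^ 2)
    set H := heatConst a c (order β + 2)
    -- Since i ≤ 1, the largest power that occurs is |β| + 2; its constant serves for all of them
    -- and depends only on |β|.
    have hheat : ∀ k, k ≤ order β + 2 → ‖ξ‖ ^ k * Real.exp (-(c * ‖ξ‖ ^ 2 * t)) ≤
        H * max 1 t ^ (-((k : ℝ) / 2)) * E := by
      intro k hk
      rw [← hE]
      refine (pow_mul_exp_le hc (norm_nonneg ξ) hη ht k).trans ?_
      gcongr
      exact heatConst_mono a c hk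
    have hsplit : cact X (cact (derivLowSymbol A B r a β t η) u) = derivSymbol β η •
        (cact (X * lowMultiplier A B r a t ξ * projC) (cact projC u) +
          cact (X * lowMultiplier A B r a t ξ * projD) (cact projD u)) := by
      rw [derivLowSymbol, cact_smul, cact_vsmul, hlow, ← cact_mul, ← cact_mul, mul_assoc _ projC,
        projC_mul_projC, ← cact_mul, mul_assoc _ projD, projD_mul_projD, cact_mul _ projC,
        cact_mul _ projD, ← cact_vadd, projC_cact_add_projD]
    have h1 : ‖cact (X * lowMultiplier A B r a t ξ * projC) (cact projC u)‖ ≤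
        C * ‖ξ‖ ^ i * Real.exp (-(c * ‖ξ‖ ^ 2 * t)) * Sc :=
      (norm_cact_le _ _).trans (mul_le_mul (hXC ξ t ht) hSc (norm_nonneg _) (by positivity))
    have h2 : ‖cact (X * lowMultiplier A B r a t ξ * projD) (cact projD u)‖ ≤
        C * ‖ξ‖ ^ (i + 1) * Real.exp (-(c * ‖ξ‖ ^ 2 * t)) * Sd :=
      (norm_cact_le _ _).trans (mul_le_mul (hXD ξ t ht) hSd (norm_nonneg _) (by positivity))
    have h3 := mul_le_mul_of_nonneg_left (hheat (order β + i) (by omega))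
      (mul_nonneg hC.le hSc0)
    have h4 := mul_le_mul_of_nonneg_left (hheat (order β + (i + 1)) (by omega))
      (mul_nonneg hC.le hSd0)
    rw [hsplit, norm_smul]
    calc _ ≤ ‖ξ‖ ^ order β * (C * ‖ξ‖ ^ i * Real.exp (-(c * ‖ξ‖ ^ 2 * t)) * Sc +
          C * ‖ξ‖ ^ (i + 1) * Real.exp (-(c * ‖ξ‖ ^ 2 * t)) * Sd) :=
          mul_le_mul (norm_derivSymbol_le β η) ((norm_add_le _ _).trans (add_le_add h1 h2))
            (norm_nonneg _) (by positivity)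
      _ = C * Sc * (‖ξ‖ ^ (order β + i) * Real.exp (-(c * ‖ξ‖ ^ 2 * t))) +
          C * Sd * (‖ξ‖ ^ (order β + (i + 1)) * Real.exp (-(c * ‖ξ‖ ^ 2 * t))) := by ring
      _ ≤ _ := add_le_add h3 h4
      _ = _ := by ring
  · rw [derivLowSymbol, lowSymbol_eq_zero hη, smul_zero, cact_zero, cact_vzero, norm_zero]
    positivity

/-- Estimate of one block row (`X = projC`, `i = 0` or `X = projD`, `i = 1`) of `D^β K(t)`. -/
lemma SpectralBounds.eLpNorm_block_le (h : SpectralBounds A B r a C c) (β : Fin m → ℕ)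
    {X : CMat n₁ n₂} {i : ℕ} (hi : i ≤ 1)
    (hXC : ∀ ξ : Space m, ∀ t : ℝ, 0 ≤ t → ‖X * lowMultiplier A B r a t ξ * projC‖ ≤
      C * ‖ξ‖ ^ i * Real.exp (-(c * ‖ξ‖ ^ 2 * t)))
    (hXD : ∀ ξ : Space m, ∀ t : ℝ, 0 ≤ t → ‖X * lowMultiplier A B r a t ξ * projD‖ ≤
      C * ‖ξ‖ ^ (i + 1) * Real.exp (-(c * ‖ξ‖ ^ 2 * t)))
    {w : L2 m n₁ n₂} (hw : MemLp w 1 volume) {t : ℝ} (ht : 0 ≤ t) {p : ℝ≥0∞} (hp : 2 ≤ p) :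
    eLpNorm (fun x => cact X (𝓕⁻ (fun η => cact (derivLowSymbol A B r a β t η)
        (𝓕 (fun x => vecToC (w x)) η)) x)) p volume ≤
      ENNReal.ofReal (lowConst m a C c (order β)) * decay t (rate m p (order β) + (i : ℝ) / 2)
          * eLpNorm (fun x => L₀ (w x)) 1 volume
        + ENNReal.ofReal (lowConst m a C c (order β))
          * decay t (rate m p (order β) + ((i : ℝ) + 1) / 2)
          * eLpNorm (fun x => Lminus (w x)) 1 volume := by
  have hC := h.pos_C
  have hc := h.pos_c
  have hf := integrable_vecToC hw
  have hT0 : 0 < max 1 t := lt_of_lt_of_le one_pos (le_max_left _ _)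
  obtain ⟨Sc, hSc⟩ : ∃ S : ℝ, S = ∫ x, ‖cact projC (vecToC (w x))‖ := ⟨_, rfl⟩
  obtain ⟨Sd, hSd⟩ : ∃ S : ℝ, S = ∫ x, ‖cact projD (vecToC (w x))‖ := ⟨_, rfl⟩
  have hSc0 : 0 ≤ Sc := hSc ▸ integral_nonneg fun _ => norm_nonneg _
  have hSd0 : 0 ≤ Sd := hSd ▸ integral_nonneg fun _ => norm_nonneg _
  have hSc' : ENNReal.ofReal Sc = eLpNorm (fun x => L₀ (w x)) 1 volume := by
    rw [hSc, ofReal_integral_norm_eq (integrable_cact projC hf)]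
    exact eLpNorm_congr_norm_ae (Eventually.of_forall fun x => norm_cact_projC_vecToC _)
  have hSd' : ENNReal.ofReal Sd = eLpNorm (fun x => Lminus (w x)) 1 volume := by
    rw [hSd, ofReal_integral_norm_eq (integrable_cact projD hf)]
    exact eLpNorm_congr_norm_ae (Eventually.of_forall fun x => norm_cact_projD_vecToC _)
  have hH0 := heatConst_pos a c (order β + 2)
  have hint := integrable_cact_fourier (h.integrable_derivLowSymbol β t) hf
  -- A constant matrix commutes with the transform, so the L¹ norm of each group of components
  -- bounds its transform uniformly in frequency.
  have hpt := fun η => h.norm_block_le β hi hXC hXD ht (Sc := Sc) (Sd := Sd)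
    (𝓕 (fun x => vecToC (w x)) η)
    (by rw [cact_fourier _ hf, hSc]; exact norm_fourier_le_integral _ η)
    (by rw [cact_fourier _ hf, hSd]; exact norm_fourier_le_integral _ η) η
  have hmain := eLpNorm_fourierInv_le
    (h := fun η => cact X (cact (derivLowSymbol A B r a β t η) (𝓕 (fun x => vecToC (w x)) η)))
    (S := C * heatConst a c (order β + 2) *
      (max 1 t ^ (-(((order β + i : ℕ) : ℝ) / 2)) * Sc +
        max 1 t ^ (-(((order β + (i + 1) : ℕ) : ℝ) / 2)) * Sd))
    (q := c / 2 * (2 * Real.pi) ^ 2) (T := max 1 t)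
    (aestronglyMeasurable_cact aestronglyMeasurable_const hint.aestronglyMeasurable)
    (by positivity) (by positivity) hT0 hpt hp
  have hcomm := funext fun x => cact_fourierInv X hint x
  rw [hcomm]
  refine hmain.trans ?_
  have hr := rate_nonneg m hp (order β)
  have hL : 0 ≤ lowConst m a C c (order β) := by
    have := gaussianConst_pos m (q := c / 2 * (2 * Real.pi) ^ 2) (by positivity)
    unfold lowConst
    positivity
  rw [← hSc', ← hSd', decay_eq (by positivity), decay_eq (by positivity),
    ← ENNReal.ofReal_mul hL, ← ENNReal.ofReal_mul (by positivity),
    ← ENNReal.ofReal_mul hL, ← ENNReal.ofReal_mul (by positivity),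
    ← ENNReal.ofReal_add (by positivity) (by positivity)]
  refine ENNReal.ofReal_le_ofReal (le_of_eq ?_)
  have e1 : max 1 t ^ (-(rate m p (order β) + (i : ℝ) / 2)) =
      max 1 t ^ (-(((order β + i : ℕ) : ℝ) / 2)) *
        max 1 t ^ (-((m : ℝ) / 2 * (1 - (p⁻¹).toReal))) := by
    rw [← Real.rpow_add hT0, rate]
    congr 1
    push_cast
    ring
  have e2 : max 1 t ^ (-(rate m p (order β) + ((i : ℝ) + 1) / 2)) =
      max 1 t ^ (-(((order β + (i + 1) : ℕ) : ℝ) / 2)) *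
        max 1 t ^ (-((m : ℝ) / 2 * (1 - (p⁻¹).toReal))) := by
    rw [← Real.rpow_add hT0, rate]
    congr 1
    push_cast
    ring
  rw [e1, e2, lowConst]
  ring

/-- The `L^p` estimates of `D^β K(t)`. -/
theorem SpectralBounds.eLpNorm_low_le (h : SpectralBounds A B r a C c) (β : Fin m → ℕ)
    {w : L2 m n₁ n₂} (hw : MemLp w 1 volume) {t : ℝ} (ht : 0 ≤ t) {p : ℝ≥0∞} (hp : 2 ≤ p) :
    eLpNorm (fun x => L₀ (fourierMultiplier (derivLowSymbol A B r a β t) w x)) p volume ≤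
      ENNReal.ofReal (lowConst m a C c (order β)) * decay t (rate m p (order β))
          * eLpNorm (fun x => L₀ (w x)) 1 volume
        + ENNReal.ofReal (lowConst m a C c (order β)) * decay t (rate m p (order β) + 1 / 2)
          * eLpNorm (fun x => Lminus (w x)) 1 volume ∧
    eLpNorm (fun x => Lminus (fourierMultiplier (derivLowSymbol A B r a β t) w x)) p volume ≤
      ENNReal.ofReal (lowConst m a C c (order β)) * decay t (rate m p (order β) + 1 / 2)
          * eLpNorm (fun x => L₀ (w x)) 1 volume
        + ENNReal.ofReal (lowConst m a C c (order β)) * decay t (rate m p (order β) + 1)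
          * eLpNorm (fun x => Lminus (w x)) 1 volume := by
  have hae : fourierMultiplier (derivLowSymbol A B r a β t) w =ᵐ[volume] fun x =>
      realPart n₁ n₂ (𝓕⁻ (fun η => cact (derivLowSymbol A B r a β t η)
        (𝓕 (fun x => vecToC (w x)) η)) x) := by
    rw [fourierMultiplier_apply]
    filter_upwards [coeFn_realPartL2 (complexMultiplier (derivLowSymbol A B r a β t) w),
      complexMultiplier_ae_eq (h.isMultiplier_derivLowSymbol β t)
        (h.integrable_derivLowSymbol β t) hw] with x h1 h2
    rw [h1, h2]
  constructor
  · have h1 := h.eLpNorm_block_le β (X := projC) (i := 0) zero_le_one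
      (by simpa using h.block_cc) (by simpa using h.block_cd) hw ht hp
    simp only [Nat.cast_zero, zero_div, add_zero, zero_add] at h1
    refine (eLpNorm_mono_ae ?_).trans h1
    filter_upwards [hae] with x hx
    rw [hx]
    exact norm_L₀_realPart_le _
  · have h1 := h.eLpNorm_block_le β (X := projD) (i := 1) le_rfl
      (by simpa using h.block_dc) (by simpa using h.block_dd) hw ht hp
    simp only [Nat.cast_one, one_add_one_eq_two, div_self (two_ne_zero' ℝ)] at h1
    refine (eLpNorm_mono_ae ?_).trans h1
    filter_upwards [hae] with x hx
    rw [hx]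
    exact norm_Lminus_realPart_le _

end LowFrequencyEstimate

/-! ### The remainder Γ(t) - K(t) -/

section Remainder

open scoped Matrix.Norms.L2Operator

variable {m n₁ n₂ : ℕ} {A : Fin m → Mat n₁ n₂} {B : Mat n₁ n₂} {r a C c : ℝ}

/-- The symbol of the remainder `Γ(t) - K(t)` at frequency `2πη`. -/
def remainderSymbol (A : Fin m → Mat n₁ n₂) (B : Mat n₁ n₂) (r a t : ℝ) (η : Space m) :
    CMat n₁ n₂ :=
  evolutionSymbol A B t η - lowSymbol A B r a t η

lemma SpectralBounds.isMultiplier_remainderSymbol (h : SpectralBounds A B r a C c) (t : ℝ) :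
    IsMultiplier (remainderSymbol A B r a t) :=
  (isMultiplier_evolutionSymbol h.contraction t).sub (h.isMultiplier_lowSymbol t)

lemma SpectralBounds.evolution_eq_low_add_remainder (h : SpectralBounds A B r a C c) (t : ℝ) :
    fourierMultiplier (evolutionSymbol A B t) =
      fourierMultiplier (lowSymbol A B r a t) + fourierMultiplier (remainderSymbol A B r a t) := by
  rw [← fourierMultiplier_add (h.isMultiplier_lowSymbol t) (h.isMultiplier_remainderSymbol t)]
  congr 1
  ext1 η
  rw [remainderSymbol, add_sub_cancel]

/-- Fourier multipliers commute with weak derivatives. -/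
lemma hasWeakDeriv_fourierMultiplier {σ : Space m → CMat n₁ n₂} (hσ : IsMultiplier σ)
    {β : Fin m → ℕ} {w v : L2 m n₁ n₂} (h : HasWeakDeriv β w v) :
    HasWeakDeriv β (fourierMultiplier σ w) (fourierMultiplier σ v) := by
  rw [fourierMultiplier_apply, fourierMultiplier_apply]
  refine hasWeakDeriv_realPartL2 ?_
  rw [fourier_complexMultiplier, fourier_complexMultiplier]
  filter_upwards [coeFn_mulSymbol hσ (𝓕 (complexifyL2 m n₁ n₂ v)),
    coeFn_mulSymbol hσ (𝓕 (complexifyL2 m n₁ n₂ w)), fourier_complexifyL2_of_hasWeakDeriv h]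
    with η h1 h2 h3
  rw [h1, h2, h3, cact_vsmul]

lemma HasWeakDeriv.congr_right {F : Type*} [NormedAddCommGroup F] [NormedSpace ℝ F]
    {β : Fin m → ℕ} {f g g' : Space m → F} (h : HasWeakDeriv β f g) (hg : g =ᵐ[volume] g') :
    HasWeakDeriv β f g' := by
  refine ⟨h.1, h.2.1.congr hg, fun φ h₁ h₂ => ?_⟩
  rw [h.2.2 φ h₁ h₂]
  congr 1
  refine integral_congr_ae ?_
  filter_upwards [hg] with x hx
  rw [hx]

/-- The multiplier commutes with D^β, so the derivative is the remainder operator applied to D^βw,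
and the uniform bound of its symbol applies. -/
theorem SpectralBounds.remainder_estimate (h : SpectralBounds A B r a C c) {β : Fin m → ℕ}
    {w : L2 m n₁ n₂} {v : Space m → State n₁ n₂} (hv : HasWeakDeriv β w v)
    (hv2 : MemLp v 2 volume) {t : ℝ} (ht : 0 ≤ t) :
    ∃ g : Space m → State n₁ n₂,
      HasWeakDeriv β (fourierMultiplier (remainderSymbol A B r a t) w) g ∧
      eLpNorm g 2 volume ≤ ENNReal.ofReal (C * Real.exp (-(c * t))) * eLpNorm v 2 volume := by
  refine ⟨fourierMultiplier (remainderSymbol A B r a t) hv2.toLp,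
    hasWeakDeriv_fourierMultiplier (h.isMultiplier_remainderSymbol t)
      (hv.congr_right hv2.coeFn_toLp.symm), ?_⟩
  have h1 := norm_fourierMultiplier_le (h.isMultiplier_remainderSymbol t)
    (M := C * Real.exp (-(c * t))) (fun η => by
      have := h.remainder ((2 * Real.pi) • η) t ht
      rwa [remainderSymbol, evolutionSymbol, lowSymbol, max_eq_left ht]) hv2.toLp
  rw [← eLpNorm_congr_ae hv2.coeFn_toLp, ← Lp.enorm_def, ← Lp.enorm_def, ← ofReal_norm,
    ← ofReal_norm, ← ENNReal.ofReal_mul' (norm_nonneg _)]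
  exact ENNReal.ofReal_le_ofReal h1

end Remainder

end CDForm

end

theorem theorem4p2 (m n₁ n₂ : ℕ) (A : Fin m → Mat n₁ n₂)
    (D : Matrix (Fin n₂) (Fin n₂) ℝ)
    (hA : ∀ α, (A α).IsSymm) (hD : IsNegDef D)
    (hSK : ShizutaKawashima A (sourceMat n₁ D)) :
    ∃ Γ : ℝ → L2 m n₁ n₂ →L[ℝ] L2 m n₁ n₂,
      IsSolutionOperator A (sourceMat n₁ D) Γ ∧
      ∃ r a : ℝ, 0 < r ∧ 0 < a ∧ Separates A (sourceMat n₁ D) r a ∧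
      ∃ K Krem : ℝ → L2 m n₁ n₂ →L[ℝ] L2 m n₁ n₂,
        -- the decomposition of the solution operator
        (∀ t : ℝ, 0 ≤ t → Γ t = K t + Krem t) ∧
        -- `K(t)` is the projected low-frequency part
        (∀ w₀ : L2 m n₁ n₂, MemLp w₀ 1 volume → ∀ t : ℝ, 0 ≤ t →
          ∀ᵐ x, vecToC (K t w₀ x) = lowFreq A (sourceMat n₁ D) r a t w₀ x) ∧
        -- estimates of `K(t)`
        (∃ C : ℕ → ℝ≥0, ∀ β : Fin m → ℕ, ∀ w₀ : L2 m n₁ n₂, MemLp w₀ 1 volume →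
          ∀ t : ℝ, 0 ≤ t → ∃ g : Space m → State n₁ n₂, HasWeakDeriv β (K t w₀) g ∧
            ∀ p : ℝ≥0∞, 2 ≤ p →
              eLpNorm (fun x => L₀ (g x)) p volume
                ≤ C (order β) * decay t (rate m p (order β))
                      * eLpNorm (fun x => L₀ (w₀ x)) 1 volume
                  + C (order β) * decay t (rate m p (order β) + 1 / 2)
                      * eLpNorm (fun x => Lminus (w₀ x)) 1 volume ∧
              eLpNorm (fun x => Lminus (g x)) p volume
                ≤ C (order β) * decay t (rate m p (order β) + 1 / 2)
                      * eLpNorm (fun x => L₀ (w₀ x)) 1 volume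
                  + C (order β) * decay t (rate m p (order β) + 1)
                      * eLpNorm (fun x => Lminus (w₀ x)) 1 volume) ∧
        -- estimate of the remainder
        (∃ c C : ℝ, 0 < c ∧ 0 < C ∧ ∀ β : Fin m → ℕ, ∀ w₀ : L2 m n₁ n₂, MemLp w₀ 1 volume →
          ∀ v : Space m → State n₁ n₂, HasWeakDeriv β w₀ v → MemLp v 2 volume →
          ∀ t : ℝ, 0 ≤ t → ∃ g : Space m → State n₁ n₂, HasWeakDeriv β (Krem t w₀) g ∧
            eLpNorm g 2 volume ≤ ENNReal.ofReal (C * Real.exp (-(c * t))) * eLpNorm v 2 volume) := by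
  obtain ⟨r, a, C, c, h⟩ := exists_spectralBounds hA hD hSK
  refine ⟨fun t => fourierMultiplier (evolutionSymbol A (sourceMat n₁ D) t),
    isSolutionOperator_fourierMultiplier hA h.contraction, r, a, h.pos_r, h.pos_a, h.separates,
    fun t => fourierMultiplier (lowSymbol A (sourceMat n₁ D) r a t),
    fun t => fourierMultiplier (remainderSymbol A (sourceMat n₁ D) r a t),
    fun t _ => h.evolution_eq_low_add_remainder t,
    fun w₀ hw₀ t ht => h.vecToC_low_ae_eq hw₀ ht,
    -- One constant per order |β| serves both components, every p and every time.
    ⟨fun b => (lowConst m a C c b).toNNReal, fun β w₀ hw₀ t ht =>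
      ⟨_, h.hasWeakDeriv_low β w₀ t, fun p hp => h.eLpNorm_low_le β hw₀ ht hp⟩⟩,
    c, C, h.pos_c, h.pos_C, fun β w₀ _ v hv hv2 t ht => h.remainder_estimate hv hv2 ht⟩
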